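/- **Theorem 1.1 (Large deviations for $L_N$).** Let $\beta\in(0,\infty)$, $d\in\mathbb N$, let $\mathcal C=\mathcal C([0,\beta];\mathbb R^d)$ be the space of continuous paths with the topology of uniform convergence and its Borel $\sigma$-field, and let $\mathcal M_1(X)$ denote the set of Borel probability measures on $X$, with the weak topology. For $x,y\in\mathbb R^d$ let $\mathbb P^\beta_{x,y}\in\mathcal M_1(\mathcal C)$ be the normalised Brownian bridge measure from $x$ to $y$ on $[0,\beta]$ for the Brownian motion with generator $\Delta$, i.e. the law of the continuous Gaussian process $B$ with mean $x+\frac t\beta(y-x)$ at time $t$ and covariance matrix $2\,(\min(s,t)-\frac{st}\beta)\,\mathrm{Id}$ between times $s$ and $t$; $\mathbb E^\beta_{x,y}$ is the corresponding expectation. Let $\mathfrak m\in\mathcal M_1(\mathbb R^d)$ have compact support. For $N\ge 1$ define on $\mathcal C^N$ the symmetrised measure $$\mathbb P^{\rm sym}_{\mathfrak m,N}=\frac1{N!}\sum_{\sigma\in\mathfrak S_N}\int_{\mathbb R^d}\!\cdots\!\int_{\mathbb R^d}\mathfrak m(dx_1)\cdots\mathfrak m(dx_N)\bigotimes_{i=1}^N\mathbb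 P^\beta_{x_i,x_{\sigma(i)}},$$ and for $(B^{(1)},\dots,B^{(N)})\in\mathcal C^N$ the empirical path measure $L_N=\frac1N\sum_{i=1}^N\delta_{B^{(i)}}\in\mathcal M_1(\mathcal C)$. Let $\mathcal M_1^{(s)}(\mathbb R^d\times\mathbb R^d)$ be the set of probability measures $q$ on $\mathbb R^d\times\mathbb R^d$ whose two marginals coincide, and write $\overline q$ for the common marginal. Let $H(q|\widetilde q)=\int \log\frac{dq}{d\widetilde q}\,dq$ be the relative entropy ($+\infty$ if $q\not\ll\widetilde q$). For $\mu\in\mathcal M_1(\mathcal C)$ put $$I^{(q)}(\mu)=\sup_{\Phi\in\mathcal C_b(\mathcal C)}\Big\{\int\Phi\,d\mu-\int\!\!\int q(dx,dy)\log\mathbb E^\beta_{x,y}\big[e^{\Phi(B)}\big]\Big\},\qquad I^{\rm sym}_{\mathfrak m}(\mu)=\inf_{q\in\mathcal M_1^{(s)}(\mathbb R^d\times\mathbb R^d)}\big\{H(q|\overline q\otimes\mathfrak m)+I^{(q)}(\mu)\big\}.$$ Then, as $N\to\infty$, $L_N$ under $\mathbb P^{\rm sym}_{\mathfrak m,N}$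 satisfies a large deviations principle on $\mathcal M_1(\mathcal C)$ with speed $N$ and rate function $I^{\rm sym}_{\mathfrak m}$. That is, $I^{\rm sym}_{\mathfrak m}\colon\mathcal M_1(\mathcal C)\to[0,\infty]$ is lower semicontinuous, not identically $\infty$, and has compact level sets $\{I^{\rm sym}_{\mathfrak m}\le c\}$, $c\ge0$; for every closed $F\subset\mathcal M_1(\mathcal C)$, $$\limsup_{N\to\infty}\frac1N\log\mathbb P^{\rm sym}_{\mathfrak m,N}(L_N\in F)\le-\inf_{\mu\in F}I^{\rm sym}_{\mathfrak m}(\mu),$$ and for every open $G\subset\mathcal M_1(\mathcal C)$, $$\liminf_{N\to\infty}\frac1N\log\mathbb P^{\rm sym}_{\mathfrak m,N}(L_N\in G)\ge-\inf_{\mu\in G}I^{\rm sym}_{\mathfrak m}(\mu).$$ -/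

import Mathlib

open MeasureTheory ProbabilityTheory Set Filter Topology
open InformationTheory
open scoped ENNReal NNReal RealInnerProductSpace BoundedContinuousFunction

/-- The tent `u ↦ max (0, min (u, 1 - u))`, supported on `[0,1]` with peak `1/2` at `1/2`. -/
def tentFunction (u : ℝ) : ℝ := max 0 (min u (1 - u))

/-- The Schauder function on `[0,1]` of level `n` and position `k` (`0 ≤ k < 2 ^ n`), the primitive
of the `L²`-normalised Haar function: a tent on `[k 2⁻ⁿ, (k+1) 2⁻ⁿ]` of height
`2 ^ (-n/2) / 2`. -/
noncomputable def schauderFunction (n k : ℕ) (u : ℝ) : ℝ :=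
  (√2)⁻¹ ^ n * tentFunction (2 ^ n * u - k)

theorem tentFunction_nonneg (u : ℝ) : 0 ≤ tentFunction u := le_max_left _ _

theorem tentFunction_of_le {u : ℝ} (h : u ≤ 0) : tentFunction u = 0 := by
  unfold tentFunction; exact max_eq_left ((min_le_left _ _).trans h)

theorem tentFunction_of_ge {u : ℝ} (h : 1 ≤ u) : tentFunction u = 0 := by
  unfold tentFunction; exact max_eq_left ((min_le_right _ _).trans (by linarith))

theorem continuous_tentFunction : Continuous tentFunction := by
  unfold tentFunction; fun_prop

theorem continuous_schauderFunction (n k : ℕ) : Continuous (schauderFunction n k) := by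
  unfold schauderFunction
  exact continuous_const.mul (continuous_tentFunction.comp (by fun_prop))

theorem tentFunction_sub_le (u : ℝ) (k : ℕ) :
    tentFunction (u - k) ≤ if k = ⌊u⌋₊ then 1 else 0 := by
  split_ifs with h
  · unfold tentFunction
    refine max_le zero_le_one ?_
    rcases le_total (u - k) 1 with h' | h'
    · exact (min_le_left _ _).trans h'
    · exact (min_le_right _ _).trans (by linarith)
  · rcases lt_or_ge u k with h' | h'
    · exact (tentFunction_of_le (by linarith)).le
    · refine (tentFunction_of_ge ?_).le
      by_contra! h2
      exact h ((Nat.floor_eq_iff ((Nat.cast_nonneg k).trans h')).2 ⟨h', by linarith⟩).symm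

theorem sum_tentFunction_le (u : ℝ) (m : ℕ) :
    ∑ k ∈ Finset.range m, tentFunction (u - k) ≤ 1 := by
  refine (Finset.sum_le_sum fun k _ => tentFunction_sub_le u k).trans ?_
  rw [Finset.sum_ite_eq']
  split_ifs <;> norm_num

theorem sum_schauderFunction_mul_succ (N : ℕ) (a b : ℝ) :
    ∑ n ∈ Finset.range (N + 1), ∑ k ∈ Finset.range (2 ^ n),
        schauderFunction n k a * schauderFunction n k b
      = tentFunction a * tentFunction b + 2⁻¹ * (
          ∑ n ∈ Finset.range N, ∑ k ∈ Finset.range (2 ^ n),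
            schauderFunction n k (2 * a) * schauderFunction n k (2 * b)
          + ∑ n ∈ Finset.range N, ∑ k ∈ Finset.range (2 ^ n),
            schauderFunction n k (2 * a - 1) * schauderFunction n k (2 * b - 1)) := by
  have hs : (√2)⁻¹ * (√2)⁻¹ = (2⁻¹ : ℝ) := by
    rw [← mul_inv, Real.mul_self_sqrt (by norm_num)]
  rw [Finset.sum_range_succ', add_comm]
  congr 1
  · simp [schauderFunction]
  · rw [← Finset.sum_add_distrib, Finset.mul_sum]
    refine Finset.sum_congr rfl fun n _ => ?_
    rw [pow_succ, mul_two, Finset.sum_range_add, mul_add, Finset.mul_sum, Finset.mul_sum]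
    congr 1 <;> refine Finset.sum_congr rfl fun k _ => ?_
    · have e (x : ℝ) : schauderFunction (n + 1) k x
          = (√2)⁻¹ * schauderFunction n k (2 * x) := by
        unfold schauderFunction; rw [pow_succ, pow_succ]; ring_nf
      rw [e, e, ← hs]; ring
    · have e (x : ℝ) : schauderFunction (n + 1) (2 ^ n + k) x
          = (√2)⁻¹ * schauderFunction n k (2 * x - 1) := by
        unfold schauderFunction; rw [pow_succ, pow_succ]; push_cast; ring_nf
      rw [e, e, ← hs]; ring

theorem schauderFunction_of_le {n k : ℕ} {u : ℝ} (h : u ≤ 0) : schauderFunction n k u = 0 := by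
  unfold schauderFunction
  rw [tentFunction_of_le, mul_zero]
  have : (2 : ℝ) ^ n * u ≤ 0 := mul_nonpos_of_nonneg_of_nonpos (by positivity) h
  have : (0 : ℝ) ≤ k := Nat.cast_nonneg k
  linarith

theorem schauderFunction_of_ge {n k : ℕ} (hk : k < 2 ^ n) {u : ℝ} (h : 1 ≤ u) :
    schauderFunction n k u = 0 := by
  unfold schauderFunction
  rw [tentFunction_of_ge, mul_zero]
  have h1 : (2 : ℝ) ^ n * 1 ≤ 2 ^ n * u := by gcongr
  have h2 : ((k + 1 : ℕ) : ℝ) ≤ ((2 ^ n : ℕ) : ℝ) := Nat.cast_le.2 hk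
  push_cast at h2
  linarith

/-- The Schauder functions add up to the covariance `min a b - a b`. -/
theorem abs_sum_schauderFunction_mul_sub_le (N : ℕ) {a b : ℝ}
    (ha : a ∈ Icc (0 : ℝ) 1) (hb : b ∈ Icc (0 : ℝ) 1) :
    |∑ n ∈ Finset.range N, ∑ k ∈ Finset.range (2 ^ n),
        schauderFunction n k a * schauderFunction n k b - (min a b - a * b)| ≤ 2⁻¹ ^ N := by
  have z1 (N : ℕ) {x y : ℝ} (h : x ≤ 0 ∨ 1 ≤ x ∨ y ≤ 0 ∨ 1 ≤ y) :
      ∑ n ∈ Finset.range N, ∑ k ∈ Finset.range (2 ^ n),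
        schauderFunction n k x * schauderFunction n k y = 0 := by
    refine Finset.sum_eq_zero fun n _ => Finset.sum_eq_zero fun k hk => ?_
    rw [Finset.mem_range] at hk
    rcases h with h | h | h | h
    · rw [schauderFunction_of_le h, zero_mul]
    · rw [schauderFunction_of_ge hk h, zero_mul]
    · rw [schauderFunction_of_le h, mul_zero]
    · rw [schauderFunction_of_ge hk h, mul_zero]
  induction N generalizing a b with
  | zero =>
    obtain ⟨ha0, ha1⟩ := ha
    obtain ⟨hb0, hb1⟩ := hb
    simp only [Finset.range_zero, Finset.sum_empty, zero_sub, pow_zero, abs_neg]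
    rw [abs_le]
    rcases le_total a b with h | h
    · rw [min_eq_left h]; constructor <;> nlinarith
    · rw [min_eq_right h]; constructor <;> nlinarith
  | succ N ih =>
    obtain ⟨ha0, ha1⟩ := ha
    obtain ⟨hb0, hb1⟩ := hb
    rw [sum_schauderFunction_mul_succ, pow_succ]
    have tl {x : ℝ} (h0 : 0 ≤ x) (h : x ≤ 1 / 2) : tentFunction x = x := by
      unfold tentFunction; rw [min_eq_left (by linarith), max_eq_right h0]
    have tr {x : ℝ} (h0 : x ≤ 1) (h : 1 / 2 ≤ x) : tentFunction x = 1 - x := by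
      unfold tentFunction; rw [min_eq_right (by linarith), max_eq_right (by linarith)]
    have hp : (0 : ℝ) ≤ 2⁻¹ ^ N * 2⁻¹ := by positivity
    rcases le_total a (1 / 2) with h1 | h1 <;> rcases le_total b (1 / 2) with h2 | h2
    · rw [z1 N (x := 2 * a - 1) (Or.inl (by linarith)), tl ha0 h1, tl hb0 h2]
      have := ih (a := 2 * a) (b := 2 * b) ⟨by linarith, by linarith⟩ ⟨by linarith, by linarith⟩
      rw [← mul_min_of_nonneg _ _ (by norm_num : (0 : ℝ) ≤ 2)] at this
      rw [abs_le] at this ⊢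
      constructor <;> nlinarith
    · rw [z1 N (x := 2 * a - 1) (Or.inl (by linarith)),
        z1 N (y := 2 * b) (Or.inr (Or.inr (Or.inr (by linarith)))), tl ha0 h1, tr hb1 h2,
        min_eq_left (by linarith)]
      ring_nf; simp
    · rw [z1 N (x := 2 * a) (Or.inr (Or.inl (by linarith))),
        z1 N (y := 2 * b - 1) (Or.inr (Or.inr (Or.inl (by linarith)))), tr ha1 h1, tl hb0 h2,
        min_eq_right (by linarith)]
      ring_nf; simp
    · rw [z1 N (x := 2 * a) (Or.inr (Or.inl (by linarith))), tr ha1 h1, tr hb1 h2]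
      have := ih (a := 2 * a - 1) (b := 2 * b - 1) ⟨by linarith, by linarith⟩
        ⟨by linarith, by linarith⟩
      rw [min_sub_sub_right, ← mul_min_of_nonneg _ _ (by norm_num : (0 : ℝ) ≤ 2)] at this
      rw [abs_le] at this ⊢
      constructor <;> nlinarith

/-- Continuous paths `[0,β] → ℝ^d` with the topology of uniform convergence. -/
abbrev PathSpace (β : ℝ) (d : ℕ) := C(Icc (0 : ℝ) β, EuclideanSpace ℝ (Fin d))

/-- The path space carries its Borel `σ`-field. -/
noncomputable instance instMeasurableSpacePathSpace (β : ℝ) (d : ℕ) :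
    MeasurableSpace (PathSpace β d) := borel _

instance instBorelSpacePathSpace (β : ℝ) (d : ℕ) : BorelSpace (PathSpace β d) := ⟨rfl⟩

/-- The `n`-th level of the Schauder expansion on `[0,β]` with coefficients `Z (n, k)`. -/
noncomputable def levyTerm (β : ℝ) (d n : ℕ) (Z : ℕ × ℕ → EuclideanSpace ℝ (Fin d)) :
    PathSpace β d where
  toFun t := ∑ k ∈ Finset.range (2 ^ n), schauderFunction n k (t / β) • Z (n, k)
  continuous_toFun := continuous_finsetSum _ fun k _ =>
    ((continuous_schauderFunction n k).comp (by fun_prop)).smul continuous_const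

/-- The law of a family of independent standard Gaussian vectors in `ℝ^d`. -/
noncomputable def iidGaussian (d : ℕ) : Measure (ℕ × ℕ → EuclideanSpace ℝ (Fin d)) :=
  Measure.infinitePi fun _ => stdGaussian (EuclideanSpace ℝ (Fin d))

/-- Lévy's construction of the Brownian bridge from `0` to `0` in time `β`, with generator `Δ`
(variance `2 t` per coordinate for the free motion). The series converges absolutely in the uniform
norm for almost every `Z`, see `ae_summable_levyTerm`. -/
noncomputable def centredBridgePath (β : ℝ) (d : ℕ) (Z : ℕ × ℕ → EuclideanSpace ℝ (Fin d)) :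
    PathSpace β d :=
  √(2 * β) • ∑' n, levyTerm β d n Z

/-- The straight line from `x` to `y` in time `β`. -/
noncomputable def linePath {d : ℕ} (β : ℝ) (x y : EuclideanSpace ℝ (Fin d)) : PathSpace β d where
  toFun t := x + (t / β : ℝ) • (y - x)
  continuous_toFun := by fun_prop

/-- The normalised Brownian bridge measure on `[0,β]` from `x` to `y`, for the Brownian motion with
generator `Δ`: the law of the straight line from `x` to `y` plus the centred bridge. For `0 < β` it is
the probability measure on path space characterised by `IsBrownianBridge`, as is proved in
`isBrownianBridge_brownianBridge`. -/
noncomputable def brownianBridge {d : ℕ} (β : ℝ) (x y : EuclideanSpace ℝ (Fin d)) :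
    Measure (PathSpace β d) :=
  (iidGaussian d).map fun Z => linePath β x y + centredBridgePath β d Z

/-- The defining property of the law of the Brownian bridge from `x` to `y` in time `β` for the
Brownian motion with generator `Δ`, that is, of this Brownian motion started at `x` and conditioned on
being at `y` at time `β`: the coordinate process is Gaussian, with mean `x + (t / β) (y - x)` at time
`t` and covariance `2 (min s t - s t / β) Id` between times `s` and `t`. This is said through the laws
of all finite linear combinations of coordinates, which determine a Borel measure on path space. -/
structure IsBrownianBridge {d : ℕ} (β : ℝ) (x y : EuclideanSpace ℝ (Fin d))
    (P : Measure (PathSpace β d)) : Prop where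
  isProbabilityMeasure : IsProbabilityMeasure P
  map_eq_gaussianReal (J : Finset (Icc (0 : ℝ) β))
    (u : Icc (0 : ℝ) β → EuclideanSpace ℝ (Fin d)) :
    P.map (fun ω => ∑ t ∈ J, ⟪u t, ω t⟫) =
      gaussianReal (∑ t ∈ J, ⟪u t, x + (t / β : ℝ) • (y - x)⟫)
        (∑ s ∈ J, ∑ t ∈ J, 2 * (min s t - s * t / β : ℝ) * ⟪u s, u t⟫).toNNReal

instance instIsProbabilityMeasureIidGaussian (d : ℕ) : IsProbabilityMeasure (iidGaussian d) := by
  unfold iidGaussian; infer_instance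

theorem charFun_sum_inner_iidGaussian {d : ℕ} (S : Finset (ℕ × ℕ))
    (v : ℕ × ℕ → EuclideanSpace ℝ (Fin d)) :
    ∫ Z, Complex.exp ((∑ j ∈ S, ⟪Z j, v j⟫ : ℝ) * Complex.I) ∂(iidGaussian d)
      = Complex.exp (((-(∑ j ∈ S, ‖v j‖ ^ 2) / 2 : ℝ) : ℂ)) := by
  have h := integral_restrict_infinitePi
    (μ := fun _ : ℕ × ℕ => stdGaussian (EuclideanSpace ℝ (Fin d))) (s := S)
    (f := fun z : S → EuclideanSpace ℝ (Fin d) =>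
      ∏ j : S, Complex.exp ((⟪z j, v j⟫ : ℝ) * Complex.I))
    (Continuous.aestronglyMeasurable (by fun_prop))
  rw [integral_fintype_prod_eq_prod
    (f := fun (j : S) z => Complex.exp ((⟪z, v j⟫ : ℝ) * Complex.I))] at h
  have e (j : S) : ∫ z, Complex.exp ((⟪z, v j⟫ : ℝ) * Complex.I)
      ∂(stdGaussian (EuclideanSpace ℝ (Fin d))) = Complex.exp (-‖v j‖ ^ 2 / 2) := by
    have := charFun_stdGaussian (v j : EuclideanSpace ℝ (Fin d))
    rwa [charFun_apply] at this
  simp only [e, ← Complex.exp_sum] at h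
  rw [iidGaussian]
  convert h using 1
  · refine integral_congr_ae (ae_of_all _ fun Z => ?_)
    simp only [Finset.restrict]
    rw [← Finset.sum_mul]
    congr 2
    push_cast
    exact (Finset.sum_coe_sort S fun j => ((⟪Z j, v j⟫ : ℝ) : ℂ)).symm
  · congr 1
    rw [Finset.sum_coe_sort S fun j => -(‖v j‖ : ℂ) ^ 2 / 2]
    push_cast
    rw [← Finset.sum_div, Finset.sum_neg_distrib]

theorem ae_summable_levyTerm (β : ℝ) (d : ℕ) :
    ∀ᵐ Z ∂(iidGaussian d), Summable fun n => ‖levyTerm β d n Z‖ := by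
  set γ := stdGaussian (EuclideanSpace ℝ (Fin d))
  have hm : MemLp id 4 γ := IsGaussian.memLp_id γ 4 (by norm_num)
  have hfin : ∫⁻ z, ‖z‖ₑ ^ 4 ∂γ < ∞ := by
    have := lintegral_rpow_enorm_lt_top_of_eLpNorm_lt_top (by norm_num) (by norm_num) hm.2
    simpa using this
  set c := ∫⁻ z, ‖z‖ₑ ^ 4 ∂γ
  have htail (n : ℕ) : γ {z | (5 / 4 : ℝ) ^ n < ‖z‖} ≤ c * ENNReal.ofReal ((256 / 625) ^ n) := by
    have h1 := mul_meas_ge_le_lintegral₀ (μ := γ) (f := fun z => ‖z‖ₑ ^ 4)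
      (by fun_prop) (ENNReal.ofReal ((625 / 256) ^ n))
    have h0 : {z : EuclideanSpace ℝ (Fin d) | (5 / 4 : ℝ) ^ n < ‖z‖} ⊆
        {z | ENNReal.ofReal ((625 / 256) ^ n) ≤ ‖z‖ₑ ^ 4} := by
      intro z hz
      simp only [mem_ofPred_eq] at hz ⊢
      rw [← ofReal_norm, ← ENNReal.ofReal_pow (norm_nonneg _)]
      refine ENNReal.ofReal_le_ofReal ?_
      calc ((625 / 256 : ℝ)) ^ n = ((5 / 4) ^ n) ^ 4 := by rw [pow_right_comm]; norm_num
        _ ≤ ‖z‖ ^ 4 := by gcongr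
    have hpos : ENNReal.ofReal ((625 / 256) ^ n) ≠ 0 := by
      simp only [ne_eq, ENNReal.ofReal_eq_zero, not_le]; positivity
    calc γ {z | (5 / 4 : ℝ) ^ n < ‖z‖} ≤ γ {z | ENNReal.ofReal ((625 / 256) ^ n) ≤ ‖z‖ₑ ^ 4} :=
          measure_mono h0
      _ ≤ c / ENNReal.ofReal ((625 / 256) ^ n) := by
          rw [ENNReal.le_div_iff_mul_le (Or.inl hpos) (Or.inl ENNReal.ofReal_ne_top), mul_comm]
          exact h1
      _ = c * ENNReal.ofReal ((256 / 625) ^ n) := by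
          rw [div_eq_mul_inv, ← ENNReal.ofReal_inv_of_pos (by positivity), ← inv_pow]
          norm_num
  let A (n : ℕ) : Set (ℕ × ℕ → EuclideanSpace ℝ (Fin d)) :=
    ⋃ k ∈ Finset.range (2 ^ n), (fun Z => Z (n, k)) ⁻¹' {z | (5 / 4 : ℝ) ^ n < ‖z‖}
  have hA (n : ℕ) : iidGaussian d (A n) ≤ c * ENNReal.ofReal ((512 / 625) ^ n) := by
    calc iidGaussian d (A n) ≤ ∑ k ∈ Finset.range (2 ^ n),
          iidGaussian d ((fun Z => Z (n, k)) ⁻¹' {z | (5 / 4 : ℝ) ^ n < ‖z‖}) :=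
          measure_biUnion_finset_le _ _
      _ ≤ ∑ k ∈ Finset.range (2 ^ n), c * ENNReal.ofReal ((256 / 625) ^ n) := by
          refine Finset.sum_le_sum fun k _ => ?_
          have := measurePreserving_eval_infinitePi
            (fun _ : ℕ × ℕ => stdGaussian (EuclideanSpace ℝ (Fin d))) (n, k)
          rw [iidGaussian]
          refine (this.measure_preimage ?_).trans_le (htail n)
          exact (measurableSet_lt measurable_const measurable_norm).nullMeasurableSet
      _ = c * ENNReal.ofReal ((512 / 625) ^ n) := by
          rw [Finset.sum_const, Finset.card_range, nsmul_eq_mul, mul_left_comm,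
            ← ENNReal.ofReal_natCast, ← ENNReal.ofReal_mul (by positivity)]
          push_cast
          rw [← mul_pow]; norm_num
  have hsum : ∑' n, iidGaussian d (A n) ≠ ∞ := by
    refine ne_top_of_le_ne_top ?_ (ENNReal.tsum_le_tsum hA)
    rw [ENNReal.tsum_mul_left]
    refine ENNReal.mul_ne_top hfin.ne ?_
    exact (summable_geometric_of_lt_one (r := (512 / 625 : ℝ)) (by norm_num)
      (by norm_num)).tsum_ofReal_ne_top
  filter_upwards [ae_eventually_notMem hsum] with Z hZ
  have hr : Summable fun n : ℕ => ((√2)⁻¹ * (5 / 4) : ℝ) ^ n := by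
    refine summable_geometric_of_lt_one (by positivity) ?_
    rw [inv_mul_lt_iff₀ (by positivity), mul_one]
    exact Real.lt_sqrt_of_sq_lt (by norm_num)
  refine Summable.of_norm_bounded_eventually_nat hr ?_
  filter_upwards [hZ] with n hn
  rw [norm_norm, ContinuousMap.norm_le _ (by positivity)]
  intro t
  have hb : ∀ k ∈ Finset.range (2 ^ n), ‖Z (n, k)‖ ≤ (5 / 4) ^ n := by
    intro k hk
    by_contra! h
    exact hn (mem_biUnion hk h)
  calc ‖levyTerm β d n Z t‖
      ≤ ∑ k ∈ Finset.range (2 ^ n), ‖schauderFunction n k (t / β) • Z (n, k)‖ := by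
        change ‖∑ k ∈ Finset.range (2 ^ n), schauderFunction n k (t / β) • Z (n, k)‖ ≤ _
        exact norm_sum_le _ _
    _ ≤ ∑ k ∈ Finset.range (2 ^ n),
        (√2)⁻¹ ^ n * tentFunction (2 ^ n * (t / β) - k) * (5 / 4) ^ n := by
        refine Finset.sum_le_sum fun k hk => ?_
        have h0 : 0 ≤ schauderFunction n k (t / β) :=
          mul_nonneg (by positivity) (tentFunction_nonneg _)
        rw [norm_smul, Real.norm_of_nonneg h0]
        exact mul_le_mul_of_nonneg_left (hb k hk) h0
    _ = ((√2)⁻¹ * (5 / 4)) ^ n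
        * ∑ k ∈ Finset.range (2 ^ n), tentFunction (2 ^ n * (t / β) - k) := by
        rw [← Finset.sum_mul, ← Finset.mul_sum, mul_pow]; ring
    _ ≤ ((√2)⁻¹ * (5 / 4)) ^ n := mul_le_of_le_one_right (by positivity) (sum_tentFunction_le _ _)

theorem continuous_levyTerm (β : ℝ) (d n : ℕ) : Continuous (levyTerm β d n) := by
  refine ContinuousMap.continuous_of_continuous_uncurry _ ?_
  have h (k : ℕ) : Continuous fun p : (ℕ × ℕ → EuclideanSpace ℝ (Fin d)) × Icc (0 : ℝ) β =>
      schauderFunction n k (p.2 / β) • p.1 (n, k) :=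
    ((continuous_schauderFunction n k).comp (by fun_prop)).smul (by fun_prop)
  exact continuous_finsetSum (Finset.range (2 ^ n)) fun k _ => h k

theorem aemeasurable_centredBridgePath (β : ℝ) (d : ℕ) :
    AEMeasurable (centredBridgePath β d) (iidGaussian d) := by
  suffices h : AEMeasurable (fun Z => ∑' n, levyTerm β d n Z) (iidGaussian d) from
    (continuous_const_smul √(2 * β)).measurable.comp_aemeasurable h
  refine aemeasurable_of_tendsto_metrizable_ae atTop
    (f := fun N Z => ∑ n ∈ Finset.range N, levyTerm β d n Z) (fun N => ?_) ?_
  · exact (continuous_finsetSum _ fun n _ => continuous_levyTerm β d n).measurable.aemeasurable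
  · filter_upwards [ae_summable_levyTerm β d] with Z hZ
    exact hZ.of_norm.hasSum.tendsto_sum_nat

theorem sum_inner_levyTerm {d : ℕ} (β : ℝ) (J : Finset (Icc (0 : ℝ) β))
    (u : Icc (0 : ℝ) β → EuclideanSpace ℝ (Fin d)) (N : ℕ) (S : Finset (ℕ × ℕ))
    (hS : ∀ p, p ∈ S ↔ p.1 ∈ Finset.range N ∧ p.2 ∈ Finset.range (2 ^ p.1))
    (Z : ℕ × ℕ → EuclideanSpace ℝ (Fin d)) :
    ∑ t ∈ J, ⟪u t, (∑ n ∈ Finset.range N, levyTerm β d n Z) t⟫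
      = ∑ j ∈ S, ⟪Z j, ∑ t ∈ J, schauderFunction j.1 j.2 (t / β) • u t⟫ := by
  rw [Finset.sum_finset_product S (Finset.range N) (fun n => Finset.range (2 ^ n)) hS]
  simp only [ContinuousMap.coe_sum, Finset.sum_apply, inner_sum, inner_smul_right]
  rw [Finset.sum_comm]
  refine Finset.sum_congr rfl fun n _ => ?_
  rw [Finset.sum_comm]
  refine Finset.sum_congr rfl fun t _ => ?_
  change ⟪u t, ∑ k ∈ Finset.range (2 ^ n), schauderFunction n k (t / β) • Z (n, k)⟫ = _
  rw [inner_sum]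
  refine Finset.sum_congr rfl fun k _ => ?_
  rw [inner_smul_right, real_inner_comm]

theorem sum_norm_sq_schauder {d : ℕ} (β : ℝ) (J : Finset (Icc (0 : ℝ) β))
    (u : Icc (0 : ℝ) β → EuclideanSpace ℝ (Fin d)) (N : ℕ) (S : Finset (ℕ × ℕ))
    (hS : ∀ p, p ∈ S ↔ p.1 ∈ Finset.range N ∧ p.2 ∈ Finset.range (2 ^ p.1)) :
    ∑ j ∈ S, ‖∑ t ∈ J, schauderFunction j.1 j.2 (t / β) • u t‖ ^ 2
      = ∑ s ∈ J, ∑ t ∈ J, (∑ n ∈ Finset.range N, ∑ k ∈ Finset.range (2 ^ n),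
          schauderFunction n k (s / β) * schauderFunction n k (t / β)) * ⟪u s, u t⟫ := by
  have h1 (j : ℕ × ℕ) : ‖∑ t ∈ J, schauderFunction j.1 j.2 (t / β) • u t‖ ^ 2
      = ∑ s ∈ J, ∑ t ∈ J, schauderFunction j.1 j.2 (s / β) * schauderFunction j.1 j.2 (t / β)
        * ⟪u s, u t⟫ := by
    rw [← real_inner_self_eq_norm_sq]
    simp only [inner_sum, sum_inner, inner_smul_left, inner_smul_right, RCLike.conj_to_real]
    rw [Finset.sum_comm]
    refine Finset.sum_congr rfl fun s _ => ?_
    rw [Finset.mul_sum]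
    refine Finset.sum_congr rfl fun t _ => ?_
    rw [real_inner_comm]; ring
  simp only [h1]
  rw [Finset.sum_comm]
  refine Finset.sum_congr rfl fun s _ => ?_
  rw [Finset.sum_comm]
  refine Finset.sum_congr rfl fun t _ => ?_
  rw [← Finset.sum_mul, Finset.sum_finset_product S (Finset.range N) (fun n => Finset.range (2 ^ n)) hS]

theorem tendsto_schauder_covariance {β s t : ℝ} (hβ : 0 < β) (hs : s ∈ Icc 0 β)
    (ht : t ∈ Icc 0 β) :
    Tendsto (fun N => ∑ n ∈ Finset.range N, ∑ k ∈ Finset.range (2 ^ n),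
      schauderFunction n k (s / β) * schauderFunction n k (t / β)) atTop
      (𝓝 ((min s t - s * t / β) / β)) := by
  have e : (min s t - s * t / β) / β = min (s / β) (t / β) - s / β * (t / β) := by
    rw [min_div_div_right hβ.le]; field_simp
  have h (x : ℝ) (hx : x ∈ Icc 0 β) : x / β ∈ Icc (0 : ℝ) 1 :=
    ⟨div_nonneg hx.1 hβ.le, (div_le_one hβ).2 hx.2⟩
  rw [e, tendsto_iff_norm_sub_tendsto_zero]
  exact squeeze_zero (fun _ => norm_nonneg _)
    (fun N => abs_sum_schauderFunction_mul_sub_le N (h s hs) (h t ht))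
    (tendsto_pow_atTop_nhds_zero_of_lt_one (by norm_num) (by norm_num))

/-- The measure `brownianBridge β x y` is the law of the Brownian bridge. -/
theorem isBrownianBridge_brownianBridge {d : ℕ} {β : ℝ} (hβ : 0 < β)
    (x y : EuclideanSpace ℝ (Fin d)) : IsBrownianBridge β x y (brownianBridge β x y) := by
  have hF : AEMeasurable (fun Z => linePath β x y + centredBridgePath β d Z) (iidGaussian d) :=
    (aemeasurable_centredBridgePath β d).const_add _
  have hP : IsProbabilityMeasure (brownianBridge β x y) :=
    Measure.isProbabilityMeasure_map hF
  refine ⟨hP, fun J u => ?_⟩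
  set V := ∑ s ∈ J, ∑ t ∈ J, 2 * (min s t - s * t / β : ℝ) * ⟪u s, u t⟫ with hV
  set m := ∑ t ∈ J, ⟪u t, x + (t / β : ℝ) • (y - x)⟫ with hm
  let S (N : ℕ) : Finset (ℕ × ℕ) :=
    (Finset.range N ×ˢ Finset.range (2 ^ N)).filter fun p => p.2 < 2 ^ p.1
  have hS (N : ℕ) (p : ℕ × ℕ) :
      p ∈ S N ↔ p.1 ∈ Finset.range N ∧ p.2 ∈ Finset.range (2 ^ p.1) := by
    simp only [S, Finset.mem_filter, Finset.mem_product, Finset.mem_range]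
    refine ⟨fun h => ⟨h.1.1, h.2⟩, fun h => ⟨⟨h.1, h.2.trans ?_⟩, h.2⟩⟩
    exact Nat.pow_lt_pow_right (by norm_num) h.1
  let v (j : ℕ × ℕ) := ∑ t ∈ J, schauderFunction j.1 j.2 (t / β) • u t
  have hvar : Tendsto (fun N => 2 * β * ∑ j ∈ S N, ‖v j‖ ^ 2) atTop (𝓝 V) := by
    simp only [v, sum_norm_sq_schauder β J u _ _ (hS _)]
    have : V = 2 * β * ∑ s ∈ J, ∑ t ∈ J, (min s t - s * t / β : ℝ) / β * ⟪u s, u t⟫ := by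
      simp only [hV, Finset.mul_sum]
      refine Finset.sum_congr rfl fun s _ => Finset.sum_congr rfl fun t _ => ?_
      field_simp
    rw [this]
    exact (tendsto_finsetSum _ fun s _ => tendsto_finsetSum _ fun t _ =>
      (tendsto_schauder_covariance hβ s.2 t.2).mul_const _).const_mul _
  have hV0 : 0 ≤ V := ge_of_tendsto' hvar fun N => by positivity
  have hchar (θ : ℝ) : ∫ Z, Complex.exp
      ((θ * ∑ t ∈ J, ⟪u t, centredBridgePath β d Z t⟫ : ℝ) * Complex.I) ∂(iidGaussian d)
        = Complex.exp ((-(θ ^ 2 * V) / 2 : ℝ) : ℂ) := by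
    have hlim : Tendsto (fun N => ∫ Z, Complex.exp
        ((∑ j ∈ S N, ⟪Z j, (θ * √(2 * β)) • v j⟫ : ℝ) * Complex.I) ∂(iidGaussian d)) atTop
        (𝓝 (∫ Z, Complex.exp
      ((θ * ∑ t ∈ J, ⟪u t, centredBridgePath β d Z t⟫ : ℝ) * Complex.I) ∂(iidGaussian d))) := by
      refine tendsto_integral_of_dominated_convergence (fun _ => 1) (fun N => ?_)
        (integrable_const _) (fun N => ae_of_all _ fun Z => ?_) ?_
      · exact Continuous.aestronglyMeasurable (by fun_prop)
      · rw [Complex.norm_exp_ofReal_mul_I]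
      · filter_upwards [ae_summable_levyTerm β d] with Z hZ
        have h1 := hZ.of_norm.hasSum.tendsto_sum_nat
        have h2 : Tendsto (fun N => θ * ∑ t ∈ J,
            ⟪u t, (√(2 * β) • ∑ n ∈ Finset.range N, levyTerm β d n Z) t⟫) atTop
            (𝓝 (θ * ∑ t ∈ J, ⟪u t, centredBridgePath β d Z t⟫)) := by
          refine Tendsto.const_mul _ (tendsto_finsetSum _ fun t _ => ?_)
          have h3 : Continuous fun f : PathSpace β d => ⟪u t, (√(2 * β) • f) t⟫ := by
            have : Continuous fun f : PathSpace β d => f t := continuous_eval_const t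
            simp only [ContinuousMap.smul_apply]
            fun_prop
          exact (h3.tendsto _).comp h1
        have h4 : Continuous fun r : ℝ => Complex.exp ((r : ℂ) * Complex.I) := by fun_prop
        refine ((h4.tendsto _).comp h2).congr fun N => ?_
        simp only [Function.comp_apply]
        congr 3
        have := sum_inner_levyTerm β J u N (S N) (hS N) Z
        simp only [ContinuousMap.smul_apply, inner_smul_right, ← Finset.mul_sum]
        rw [this, mul_assoc]
    refine tendsto_nhds_unique hlim ?_
    simp only [charFun_sum_inner_iidGaussian]
    have h5 : Continuous fun r : ℝ => Complex.exp ((-(θ ^ 2 * r) / 2 : ℝ) : ℂ) := by fun_prop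
    refine ((h5.tendsto _).comp hvar).congr fun N => ?_
    simp only [Function.comp_apply]
    congr 4
    rw [Finset.mul_sum, Finset.mul_sum]
    refine Finset.sum_congr rfl fun j _ => ?_
    rw [norm_smul, mul_pow, Real.norm_eq_abs, sq_abs, mul_pow, Real.sq_sqrt (by positivity)]
    ring
  have hl : Measurable fun ω : PathSpace β d => ∑ t ∈ J, ⟪u t, ω t⟫ := by
    refine Continuous.measurable (continuous_finsetSum _ fun t _ => ?_)
    have : Continuous fun f : PathSpace β d => f t := continuous_eval_const t
    fun_prop
  have : IsProbabilityMeasure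
      ((brownianBridge β x y).map fun ω : PathSpace β d => ∑ t ∈ J, ⟪u t, ω t⟫) :=
    Measure.isProbabilityMeasure_map hl.aemeasurable
  refine Measure.ext_of_charFun ?_
  ext θ
  have hc : Continuous fun r : ℝ => Complex.exp (θ * r * Complex.I) := by fun_prop
  rw [charFun_gaussianReal, charFun_apply_real, brownianBridge,
    AEMeasurable.map_map_of_aemeasurable hl.aemeasurable hF,
    integral_map (hl.comp_aemeasurable hF) hc.aestronglyMeasurable, Real.coe_toNNReal _ hV0]
  have h6 (Z : ℕ × ℕ → EuclideanSpace ℝ (Fin d)) : Complex.exp (θ *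
      (((fun ω : PathSpace β d => ∑ t ∈ J, ⟪u t, ω t⟫) ∘
        fun Z => linePath β x y + centredBridgePath β d Z) Z : ℝ) * Complex.I)
      = Complex.exp (θ * m * Complex.I) * Complex.exp
      ((θ * ∑ t ∈ J, ⟪u t, centredBridgePath β d Z t⟫ : ℝ) * Complex.I) := by
    rw [← Complex.exp_add, ← add_mul]
    congr 2
    simp only [Function.comp_apply, ContinuousMap.add_apply, inner_add_right,
      Finset.sum_add_distrib]
    have : ∑ t ∈ J, ⟪u t, linePath β x y t⟫ = m := rfl
    rw [this]
    push_cast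
    ring
  simp only [h6]
  rw [integral_const_mul, hchar, ← Complex.exp_add]
  congr 1
  push_cast
  ring

instance instIsProbabilityMeasureBrownianBridge {d : ℕ} (β : ℝ)
    (x y : EuclideanSpace ℝ (Fin d)) : IsProbabilityMeasure (brownianBridge β x y) :=
  Measure.isProbabilityMeasure_map ((aemeasurable_centredBridgePath β d).const_add _)

theorem measurable_brownianBridge (β : ℝ) (d : ℕ) :
    Measurable fun p : EuclideanSpace ℝ (Fin d) × EuclideanSpace ℝ (Fin d) =>
      brownianBridge β p.1 p.2 := by
  have hline : Continuous fun p : EuclideanSpace ℝ (Fin d) × EuclideanSpace ℝ (Fin d) =>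
      linePath β p.1 p.2 := by
    refine ContinuousMap.continuous_of_continuous_uncurry _ ?_
    change Continuous fun r : (EuclideanSpace ℝ (Fin d) × EuclideanSpace ℝ (Fin d)) ×
      Icc (0 : ℝ) β => r.1.1 + (r.2 / β : ℝ) • (r.1.2 - r.1.1)
    fun_prop
  set b := (iidGaussian d).map (centredBridgePath β d) with hb
  have hb' : IsProbabilityMeasure b :=
    Measure.isProbabilityMeasure_map (aemeasurable_centredBridgePath β d)
  refine Measure.measurable_of_measurable_coe _ fun A hA => ?_
  have hadd : Measurable fun r : (EuclideanSpace ℝ (Fin d) × EuclideanSpace ℝ (Fin d)) ×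
      PathSpace β d => linePath β r.1.1 r.1.2 + r.2 :=
    (hline.measurable.comp measurable_fst).add measurable_snd
  have e (p : EuclideanSpace ℝ (Fin d) × EuclideanSpace ℝ (Fin d)) :
      brownianBridge β p.1 p.2 A = b (Prod.mk p ⁻¹' ((fun r : (EuclideanSpace ℝ (Fin d) ×
        EuclideanSpace ℝ (Fin d)) × PathSpace β d => linePath β r.1.1 r.1.2 + r.2) ⁻¹' A)) := by
    have h1 : brownianBridge β p.1 p.2 = b.map fun ω => linePath β p.1 p.2 + ω := by
      rw [hb, AEMeasurable.map_map_of_aemeasurable (measurable_const_add _).aemeasurable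
        (aemeasurable_centredBridgePath β d)]
      rfl
    rw [h1, Measure.map_apply (measurable_const_add _) hA]
    rfl
  simp only [e]
  exact measurable_measure_prodMk_left (hadd hA)

theorem measurable_measure_pi {ι X Y : Type*} [Fintype ι] [MeasurableSpace X] [MeasurableSpace Y]
    (κ : ι → Y → Measure X) [∀ i y, IsProbabilityMeasure (κ i y)] (hκ : ∀ i, Measurable (κ i)) :
    Measurable fun y => Measure.pi fun i => κ i y := by
  refine Measurable.measure_of_isPiSystem_of_isProbabilityMeasure generateFrom_pi.symm
    isPiSystem_pi ?_
  rintro _ ⟨A, hA, rfl⟩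
  simp only [Measure.pi_pi]
  refine Finset.measurable_fun_prod _ fun i _ => ?_
  have hAi : MeasurableSet (A i) := hA i (mem_univ i)
  exact (Measure.measurable_coe hAi).comp (hκ i)

/-- The product of the bridges from `x i` to `x (σ i)` depends measurably on `x`, so the mixture in
`symmetrisedMeasure` is a genuine one. -/
theorem measurable_pi_brownianBridge (β : ℝ) (d N : ℕ) (σ : Equiv.Perm (Fin N)) :
    Measurable fun x : Fin N → EuclideanSpace ℝ (Fin d) =>
      Measure.pi fun i => brownianBridge β (x i) (x (σ i)) := by
  have h (i : Fin N) : Measurable fun x : Fin N → EuclideanSpace ℝ (Fin d) =>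
      brownianBridge β (x i) (x (σ i)) := by
    have h2 : Measurable fun x : Fin N → EuclideanSpace ℝ (Fin d) => (x i, x (σ i)) := by
      fun_prop
    exact Measurable.comp (f := fun x : Fin N → EuclideanSpace ℝ (Fin d) => (x i, x (σ i)))
      (measurable_brownianBridge β d) h2
  exact measurable_measure_pi _ h

/-- The symmetrised measure: a uniform random permutation `σ` is chosen, the initial points
`x 1, …, x N` are independent with law `m`, and the `i`-th path is a Brownian bridge from `x i` to
`x (σ i)`, these being independent given `σ` and the points. -/
noncomputable def symmetrisedMeasure {d : ℕ} (β : ℝ) (m : Measure (EuclideanSpace ℝ (Fin d)))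
    (N : ℕ) : Measure (Fin N → PathSpace β d) :=
  (N.factorial : ℝ≥0∞)⁻¹ • ∑ σ : Equiv.Perm (Fin N),
    (Measure.pi fun _ : Fin N => m).bind
      fun x => Measure.pi fun i => brownianBridge β (x i) (x (σ i))

/-- The empirical measure `(1 / N) ∑ i, δ_{ω i}` of `N ≥ 1` points. -/
noncomputable def empiricalMeasure {X : Type*} [MeasurableSpace X] (N : ℕ) [NeZero N]
    (ω : Fin N → X) : ProbabilityMeasure X :=
  ⟨(N : ℝ≥0∞)⁻¹ • ∑ i, Measure.dirac (ω i), ⟨by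
    simp [ENNReal.inv_mul_cancel (Nat.cast_ne_zero.2 (NeZero.ne N)) (ENNReal.natCast_ne_top N)]⟩⟩

/-- The Legendre-Fenchel transform of the `q`-averaged logarithmic moment generating function of the
Brownian bridges. -/
noncomputable def bridgeRate {d : ℕ} (β : ℝ)
    (q : Measure (EuclideanSpace ℝ (Fin d) × EuclideanSpace ℝ (Fin d)))
    (μ : Measure (PathSpace β d)) : EReal :=
  ⨆ Φ : PathSpace β d →ᵇ ℝ,
    ((∫ ω, Φ ω ∂μ
      - ∫ p, Real.log (∫ ω, Real.exp (Φ ω) ∂(brownianBridge β p.1 p.2)) ∂q : ℝ) : EReal)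

/-- The shift-invariant pair measures: probability measures on `ℝ^d × ℝ^d` whose two marginals
agree. -/
def shiftInvariantMeasures (d : ℕ) :
    Set (ProbabilityMeasure (EuclideanSpace ℝ (Fin d) × EuclideanSpace ℝ (Fin d))) :=
  {q | (q : Measure (EuclideanSpace ℝ (Fin d) × EuclideanSpace ℝ (Fin d))).fst
    = (q : Measure (EuclideanSpace ℝ (Fin d) × EuclideanSpace ℝ (Fin d))).snd}

/-- The rate function of the empirical path measures: the infimum of
`H(q | q̄ ⊗ m) + bridgeRate β q μ` over the shift-invariant pair measures `q`, where `q̄` is the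
marginal of `q` and `H` the relative entropy. -/
noncomputable def symmetrisedRate {d : ℕ} (β : ℝ) (m : Measure (EuclideanSpace ℝ (Fin d)))
    (μ : ProbabilityMeasure (PathSpace β d)) : EReal :=
  ⨅ q ∈ shiftInvariantMeasures d,
    (klDiv (q : Measure (EuclideanSpace ℝ (Fin d) × EuclideanSpace ℝ (Fin d)))
        ((q : Measure (EuclideanSpace ℝ (Fin d) × EuclideanSpace ℝ (Fin d))).fst.prod m) : EReal)
      + bridgeRate β (q : Measure (EuclideanSpace ℝ (Fin d) × EuclideanSpace ℝ (Fin d)))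
          (μ : Measure (PathSpace β d))

/-- A rate function: `[0,∞]`-valued, lower semicontinuous, not identically `∞`, with compact level
sets. -/
structure IsRateFunction {X : Type*} [TopologicalSpace X] (I : X → EReal) : Prop where
  nonneg : ∀ x, 0 ≤ I x
  lowerSemicontinuous : LowerSemicontinuous I
  exists_ne_top : ∃ x, I x ≠ ⊤
  isCompact_level : ∀ c : ℝ, 0 ≤ c → IsCompact {x | I x ≤ c}

/-- The large deviations principle for the random variables `Y n` under `P n`, with speed `a n` and
rate function `I`. -/
structure SatisfiesLDP {Ω : ℕ → Type*} [∀ n, MeasurableSpace (Ω n)] {X : Type*}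
    [TopologicalSpace X] (P : ∀ n, Measure (Ω n)) (Y : ∀ n, Ω n → X) (a : ℕ → ℝ)
    (I : X → EReal) : Prop where
  isRateFunction : IsRateFunction I
  upper_bound : ∀ F : Set X, IsClosed F →
    limsup (fun n => ENNReal.log (P n {ω | Y n ω ∈ F}) / (a n : EReal)) atTop ≤ -⨅ x ∈ F, I x
  lower_bound : ∀ G : Set X, IsOpen G →
    -⨅ x ∈ G, I x ≤ liminf (fun n => ENNReal.log (P n {ω | Y n ω ∈ G}) / (a n : EReal)) atTop

/-! A Brownian bridge minus the straight line between its endpoints is a centred bridge, whose law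
`b` does not depend on the endpoints. So under the symmetrised measure the paths are continuous
images of labelled pairs ((x_i, x_σ(i)), z_i): the points x_i are i.i.d. with law m, the labels z_i
are i.i.d. with law b, σ is a uniform permutation, and all are independent. The theorem thus becomes
a large deviations principle for the empirical measure of these pairs. Its rate at R (`pairRate`) is
H(R | R₁ ⊗ m ⊗ b), with R₁ the law of the first point, if both points have the same law under R, and
∞ otherwise. The continuous maps `splitLaw` and `joinLaw` carry the bounds back to path measures.

Upper bound. By duality a test function nearly attains the entropy, and it can be normalised so that
exp Ψ integrates to one in the second point and the label for every first point. The exponential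
moment is then an average over σ of ∏ a(x_i, x_σ(i)) with ∫ a(x, y) m(dy) = 1. Compactness of the
support of m replaces the first argument by one of finitely many points, at cost e^(εN). The word so
obtained has only polynomially many types, and for a fixed type the points integrate out to 1
(`exists_lintegral_prod_exp_le`). Markov's inequality then gives a local bound
(`pairRate_local_upper_bound`), which exponential tightness (`exists_isCompact_expDecay`) extends to
closed sets.

Lower bound. Weak neighbourhoods are described by the cell masses of a finite partition
(`exists_cells`). The discretised R is approximated by words with balanced marginals
(`exists_word`), the arrangements of such a word are counted (`le_pairSampleMeasure_arrangements`),
and Stirling's formula turns the count into a relative entropy.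

Rate function. Finiteness of the bridge rate forces q to be the law of the endpoints, and for this q
the bridge rate is the entropy of the split law relative to q ⊗ b. The chain rule adds H(q | q̄ ⊗ m)
to it, giving the single entropy above (`symmetrisedRate_eq`). -/

/-! ### Exponential decay, and large deviations from local bounds. -/

/-- `p n` decays exponentially in `n + 1` at every rate smaller than `t`. -/
def ExpDecay (t : ℝ) (p : ℕ → ℝ≥0∞) : Prop :=
  ∀ s < t, ∀ᶠ n : ℕ in atTop, p n ≤ ENNReal.ofReal (Real.exp (-s * (n + 1)))

theorem ExpDecay.mono_left {t : ℝ} {p q : ℕ → ℝ≥0∞} (h : ExpDecay t q) (hpq : ∀ n, p n ≤ q n) :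
    ExpDecay t p :=
  fun s hs => (h s hs).mono fun n hn => (hpq n).trans hn

/-- The factor 2 is absorbed by the gap between two rates below `t`; this is why the definition asks
only for rates strictly smaller than `t`. -/
theorem ExpDecay.add {t : ℝ} {p q : ℕ → ℝ≥0∞} (hp : ExpDecay t p) (hq : ExpDecay t q) :
    ExpDecay t fun n => p n + q n := by
  intro s hs
  obtain ⟨s', h1, h2⟩ := exists_between hs
  have h3 : Tendsto (fun n : ℕ => (s' - s) * ((n : ℝ) + 1)) atTop atTop :=
    (tendsto_atTop_add_const_right _ 1 tendsto_natCast_atTop_atTop).const_mul_atTop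
      (sub_pos.2 h1)
  filter_upwards [hp s' h2, hq s' h2, h3.eventually_ge_atTop 1] with n a1 a2 a3
  refine (add_le_add a1 a2).trans ?_
  rw [← ENNReal.ofReal_add (Real.exp_nonneg _) (Real.exp_nonneg _)]
  refine ENNReal.ofReal_le_ofReal ?_
  have h4 : Real.exp (-s * (n + 1)) = Real.exp ((s' - s) * (n + 1)) * Real.exp (-s' * (n + 1)) := by
    rw [← Real.exp_add]; ring_nf
  have h5 : 2 ≤ Real.exp ((s' - s) * (n + 1)) := by
    have := Real.add_one_le_exp ((s' - s) * ((n : ℝ) + 1)); linarith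
  rw [h4]
  nlinarith [Real.exp_pos (-s' * (n + 1))]

theorem expDecay_zero (t : ℝ) : ExpDecay t fun _ => 0 :=
  fun _ _ => Eventually.of_forall fun _ => zero_le

theorem log_div_le_of_le_exp {p : ℝ≥0∞} {s : ℝ} {n : ℕ}
    (h : p ≤ ENNReal.ofReal (Real.exp (-s * (n + 1)))) :
    ENNReal.log p / (((n : ℝ) + 1 : ℝ) : EReal) ≤ ((-s : ℝ) : EReal) := by
  have hn : (0 : ℝ) < n + 1 := by positivity
  rw [EReal.div_le_iff_le_mul (by exact_mod_cast hn) (EReal.coe_ne_top _)]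
  refine (ENNReal.log_monotone h).trans ?_
  rw [ENNReal.log_ofReal_of_pos (Real.exp_pos _), Real.log_exp]
  rw [← EReal.coe_mul]
  exact (EReal.coe_le_coe_iff.2 (by linarith))

theorem le_log_div_of_exp_le {p : ℝ≥0∞} {s : ℝ} {n : ℕ}
    (h : ENNReal.ofReal (Real.exp (-s * (n + 1))) ≤ p) :
    ((-s : ℝ) : EReal) ≤ ENNReal.log p / (((n : ℝ) + 1 : ℝ) : EReal) := by
  have hn : (0 : ℝ) < n + 1 := by positivity
  rw [EReal.le_div_iff_mul_le (by exact_mod_cast hn) (EReal.coe_ne_top _)]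
  refine le_trans ?_ (ENNReal.log_monotone h)
  rw [ENNReal.log_ofReal_of_pos (Real.exp_pos _), Real.log_exp]
  rw [← EReal.coe_mul]

/-- A large deviations principle follows from local upper and lower bounds and exponential
tightness. -/
theorem satisfiesLDP_of_local {Ω : ℕ → Type*} [∀ n, MeasurableSpace (Ω n)] {X : Type*}
    [TopologicalSpace X] [T2Space X] (P : ∀ n, Measure (Ω n)) [∀ n, IsProbabilityMeasure (P n)]
    (Y : ∀ n, Ω n → X) (I : X → EReal)
    (hupper : ∀ x, ∀ t : ℝ, (t : EReal) < I x →
      ∃ U : Set X, IsOpen U ∧ x ∈ U ∧ ExpDecay t fun n => P n {ω | Y n ω ∈ U})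
    (htight : ∀ L : ℝ, ∃ K : Set X, IsCompact K ∧ ExpDecay L fun n => P n {ω | Y n ω ∈ Kᶜ})
    (hlower : ∀ x, ∀ s : ℝ, I x < s → ∀ U : Set X, IsOpen U → x ∈ U →
      ∀ᶠ n : ℕ in atTop, ENNReal.ofReal (Real.exp (-s * (n + 1))) ≤ P n {ω | Y n ω ∈ U}) :
    SatisfiesLDP P Y (fun n => (n : ℝ) + 1) I := by
  -- The local lower bound at `x` contradicts decay of the same neighbourhood at a faster rate.
  -- Semicontinuity and compactness of the level sets thus follow from the probability bounds alone,
  -- without looking at the formula for `I`.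
  have key {t s : ℝ} (hst : s < t) {U : Set X} (hU : IsOpen U) {x : X} (hx : x ∈ U)
      (hd : ExpDecay t fun n => P n {ω | Y n ω ∈ U}) : (s : EReal) ≤ I x := by
    by_contra! h
    obtain ⟨s', h1, h2⟩ := exists_between hst
    obtain ⟨n, h3, h4⟩ := ((hlower x s h U hU hx).and (hd s' h2)).exists
    have h5 := h3.trans h4
    rw [ENNReal.ofReal_le_ofReal_iff (Real.exp_nonneg _), Real.exp_le_exp] at h5
    have hn : (0 : ℝ) < n + 1 := by positivity
    nlinarith
  have hlsc : LowerSemicontinuous I := by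
    intro x y hy
    obtain ⟨t, h1, h2⟩ := EReal.lt_iff_exists_real_btwn.1 hy
    obtain ⟨t', h3, h4⟩ := EReal.lt_iff_exists_real_btwn.1 h2
    obtain ⟨U, hU, hx, hd⟩ := hupper x t' h4
    filter_upwards [hU.mem_nhds hx] with z hz
    exact h1.trans_le (key (by exact_mod_cast h3) hU hz hd)
  -- Finitely many of the local neighbourhoods cover `F ∩ K`, and tightness controls the rest.
  have hup (F : Set X) (hF : IsClosed F) (t : ℝ) (ht : (t : EReal) < ⨅ x ∈ F, I x) :
      ExpDecay t fun n => P n {ω | Y n ω ∈ F} := by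
    obtain ⟨K, hK, hKd⟩ := htight t
    have h1 : ExpDecay t fun n => P n {ω | Y n ω ∈ F ∩ K} := by
      refine (hK.inter_left hF).induction_on (p := fun S => ExpDecay t fun n => P n {ω | Y n ω ∈ S})
        ?_ ?_ ?_ ?_
      · simpa using expDecay_zero t
      · exact fun S T hST hT => hT.mono_left fun n => measure_mono fun ω hω => hST hω
      · exact fun S T hS hT => (hS.add hT).mono_left fun n => measure_union_le _ _
      · intro x hx
        obtain ⟨U, hU, hxU, hd⟩ := hupper x t (ht.trans_le (iInf₂_le x hx.1))
        exact ⟨U, mem_nhdsWithin_of_mem_nhds (hU.mem_nhds hxU), hd⟩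
    refine (h1.add hKd).mono_left fun n => (measure_mono ?_).trans (measure_union_le _ _)
    intro ω hω
    by_cases h : Y n ω ∈ K
    · exact Or.inl ⟨hω, h⟩
    · exact Or.inr h
  refine ⟨⟨fun x => ?_, hlsc, ?_, fun c _ => ?_⟩, fun F hF => ?_, fun G hG => ?_⟩
  · by_contra! h
    obtain ⟨s, h1, h2⟩ := EReal.lt_iff_exists_real_btwn.1 h
    obtain ⟨n, hn⟩ := (hlower x s h1 univ isOpen_univ (mem_univ x)).exists
    have h3 : s < 0 := by exact_mod_cast h2
    simp only [mem_univ, ofPred_true, measure_univ, ENNReal.ofReal_le_one, Real.exp_le_one_iff] at hn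
    have hn' : (0 : ℝ) < n + 1 := by positivity
    nlinarith
  -- If `I` were identically infinite, the upper bound would make the probability of the whole space
  -- decay.
  · by_contra! h
    obtain ⟨n, hn⟩ := (hup univ isClosed_univ 1 (by simpa [h] using EReal.coe_lt_top 1) (1 / 2) (by norm_num)).exists
    simp only [mem_univ, ofPred_true, measure_univ, ENNReal.one_le_ofReal,
      Real.one_le_exp_iff] at hn
    have hn' : (0 : ℝ) < n + 1 := by positivity
    nlinarith
  -- Off `K` the rate is at least `c + 1`, because decay at rate `c + 2` yields every smaller value
  -- as a lower bound for `I`.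
  · obtain ⟨K, hK, hKd⟩ := htight (c + 2)
    refine hK.of_isClosed_subset (hlsc.isClosed_preimage c) fun x hx => ?_
    by_contra h
    have h1 := (key (s := c + 1) (by linarith) hK.isClosed.isOpen_compl h hKd).trans hx
    have : c + 1 ≤ c := by exact_mod_cast h1
    linarith
  · by_contra! h
    obtain ⟨r, h1, h2⟩ := EReal.lt_iff_exists_real_btwn.1 h
    obtain ⟨r', h3, h4⟩ := EReal.lt_iff_exists_real_btwn.1 h1
    have h5 := hup F hF (-r') (by
      rw [EReal.coe_neg]
      exact EReal.neg_lt_comm.1 h3) (-r) (by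
        have : r' < r := by exact_mod_cast h4
        linarith)
    refine h2.not_ge (limsup_le_of_le (by isBoundedDefault) (h5.mono fun n hn => ?_))
    simpa using log_div_le_of_le_exp hn
  · by_contra! h
    obtain ⟨r, h1, h2⟩ := EReal.lt_iff_exists_real_btwn.1 h
    have h3 : (⨅ x ∈ G, I x) < ((-r : ℝ) : EReal) := by
      rw [EReal.coe_neg]
      exact EReal.lt_neg_comm.1 h2
    obtain ⟨x, hx⟩ := iInf_lt_iff.1 h3
    obtain ⟨hxG, hx⟩ := iInf_lt_iff.1 hx
    refine h1.not_ge (le_liminf_of_le (by isBoundedDefault)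
      ((hlower x (-r) hx G hG hxG).mono fun n hn => ?_))
    simpa using le_log_div_of_exp_le hn

/-! ### Duality for relative entropy. -/

/-- Pointwise Young inequality f Φ ≤ (f log f + 1 - f) + (exp Φ - 1) for the density f, integrated
against `ν`. The form with exp Φ - 1 in place of a logarithm of the integral is linear in `ν`, which
suits products and mixtures. -/
theorem integral_le_toReal_klDiv_add {α : Type*} [MeasurableSpace α] {μ ν : Measure α}
    [IsProbabilityMeasure μ] [IsProbabilityMeasure ν] (hfin : klDiv μ ν ≠ ∞) {Φ : α → ℝ} {k : ℝ}
    (hΦ : Measurable Φ) (hk : ∀ x, |Φ x| ≤ k) :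
    ∫ x, Φ x ∂μ ≤ (klDiv μ ν).toReal + ∫ x, (Real.exp (Φ x) - 1) ∂ν := by
  obtain ⟨hac, hint⟩ := klDiv_ne_top_iff.1 hfin
  have hi1 : Integrable (fun x => klFun (μ.rnDeriv ν x).toReal) ν :=
    (integrable_klFun_rnDeriv_iff hac).2 hint
  have hi2 : Integrable (fun x => Real.exp (Φ x) - 1) ν := by
    refine Integrable.sub (Integrable.of_bound (by fun_prop) (Real.exp k) ?_) (integrable_const _)
    refine ae_of_all _ fun x => ?_
    rw [Real.norm_of_nonneg (Real.exp_nonneg _)]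
    exact Real.exp_le_exp.2 ((le_abs_self _).trans (hk x))
  have hi3 : Integrable Φ μ := Integrable.of_bound (by fun_prop) k (ae_of_all _ hk)
  rw [toReal_klDiv_eq_integral_klFun hac, ← integral_add hi1 hi2, ← integral_rnDeriv_smul hac]
  refine integral_mono ((integrable_rnDeriv_smul_iff hac).2 hi3) (hi1.add hi2) fun x => ?_
  simp only [smul_eq_mul, klFun_apply]
  have h0 : 0 ≤ (μ.rnDeriv ν x).toReal := ENNReal.toReal_nonneg
  rcases h0.eq_or_lt with h | h
  · rw [← h]; simp [Real.exp_nonneg]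
  · have h1 := Real.add_one_le_exp (Φ x - Real.log (μ.rnDeriv ν x).toReal)
    rw [Real.exp_sub, Real.exp_log h, le_div_iff₀ h] at h1
    nlinarith

/-- Truncations of the logarithm of the density are nearly optimal test functions. Their integrands
are nonnegative and converge to the entropy integrand, so Fatou's lemma applies. Without absolute
continuity, large multiples of the indicator of a `ν`-null set charged by `μ` break every bound. -/
theorem klDiv_le_of_forall_bounded {α : Type*} [MeasurableSpace α] {μ ν : Measure α}
    [IsProbabilityMeasure μ] [IsProbabilityMeasure ν] {c : ℝ}
    (h : ∀ Φ : α → ℝ, ∀ k : ℝ, Measurable Φ → (∀ x, |Φ x| ≤ k) →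
      ∫ x, Φ x ∂μ - ∫ x, (Real.exp (Φ x) - 1) ∂ν ≤ c) :
    klDiv μ ν ≤ ENNReal.ofReal c := by
  by_cases hac : μ ≪ ν
  · rw [klDiv_eq_lintegral_klFun_of_ac hac]
    set f := fun x => (μ.rnDeriv ν x).toReal with hf
    have hfm : Measurable f := (Measure.measurable_rnDeriv μ ν).ennreal_toReal
    have hf0 (x : α) : 0 ≤ f x := ENNReal.toReal_nonneg
    -- Where the density vanishes its logarithm should be -∞, while `Real.log 0 = 0`; hence the
    -- separate value `-k`.
    let Φ (k : ℕ) (x : α) : ℝ := if f x = 0 then -k else max (-k) (min k (Real.log (f x)))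
    let g (k : ℕ) (x : α) : ℝ := f x * Φ k x - (Real.exp (Φ k x) - 1)
    have hΦm (k : ℕ) : Measurable (Φ k) :=
      Measurable.ite (hfm (measurableSet_singleton 0)) measurable_const
        (measurable_const.max (measurable_const.min (Real.measurable_log.comp hfm)))
    have hΦk (k : ℕ) (x : α) : |Φ k x| ≤ k := by
      have hk : (0 : ℝ) ≤ k := Nat.cast_nonneg k
      simp only [Φ]
      split_ifs
      · simp
      · rw [abs_le]
        exact ⟨le_max_left _ _, max_le (by linarith) (min_le_left _ _)⟩
    have hg0 (k : ℕ) (x : α) : 0 ≤ g k x := by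
      -- The truncation lies between 0 and log f, so Φ (f - exp Φ) is nonnegative whichever sign Φ
      -- has.
      have h1 : Φ k x * Real.exp (Φ k x) ≤ f x * Φ k x := by
        have hk : (0 : ℝ) ≤ k := Nat.cast_nonneg k
        simp only [Φ]
        split_ifs with hx
        · rw [hx]
          have := Real.exp_pos (-(k : ℝ))
          nlinarith
        · have hpos : 0 < f x := lt_of_le_of_ne (hf0 x) (Ne.symm hx)
          rcases le_total 0 (Real.log (f x)) with hl | hl
          · have e : max (-(k : ℝ)) (min (k : ℝ) (Real.log (f x))) = min (k : ℝ) (Real.log (f x)) :=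
              max_eq_right ((neg_nonpos.2 hk).trans (le_min hk hl))
            rw [e, mul_comm]
            refine mul_le_mul_of_nonneg_right ?_ (le_min hk hl)
            rw [← Real.le_log_iff_exp_le hpos]
            exact min_le_right _ _
          · have e : min (k : ℝ) (Real.log (f x)) = Real.log (f x) := min_eq_right (hl.trans hk)
            rw [e, mul_comm]
            refine mul_le_mul_of_nonpos_right ?_ (max_le (by linarith) hl)
            rw [← Real.log_le_iff_le_exp hpos]
            exact le_max_right _ _
      have h2 := Real.add_one_le_exp (-Φ k x)
      have h3 : Real.exp (-Φ k x) * Real.exp (Φ k x) = 1 := by rw [← Real.exp_add]; simp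
      have h4 : (-Φ k x + 1) * Real.exp (Φ k x) ≤ 1 := by
        exact (mul_le_mul_of_nonneg_right h2 (Real.exp_pos _).le).trans_eq h3
      simp only [g]
      linarith
    have hlim (x : α) : Tendsto (fun k => g k x) atTop (𝓝 (klFun (f x))) := by
      by_cases hx : f x = 0
      · have : Tendsto (fun k : ℕ => 1 - Real.exp (-(k : ℝ))) atTop (𝓝 (1 - 0)) :=
          tendsto_const_nhds.sub
            (Real.tendsto_exp_neg_atTop_nhds_zero.comp tendsto_natCast_atTop_atTop)
        simpa [g, Φ, hx, klFun_apply] using this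
      · refine tendsto_const_nhds.congr' ?_
        filter_upwards [tendsto_natCast_atTop_atTop.eventually_ge_atTop |Real.log (f x)|]
          with k hk
        have hpos : 0 < f x := lt_of_le_of_ne (hf0 x) (Ne.symm hx)
        obtain ⟨h1, h2⟩ := abs_le.1 hk
        simp only [g, Φ, if_neg hx]
        rw [min_eq_right h2, max_eq_right h1, Real.exp_log hpos, klFun_apply]
        ring
    have hint (k : ℕ) : ∫⁻ x, ENNReal.ofReal (g k x) ∂ν ≤ ENNReal.ofReal c := by
      have i1 : Integrable (fun x => f x * Φ k x) ν :=
        (integrable_rnDeriv_smul_iff hac).2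
          (Integrable.of_bound (hΦm k).aestronglyMeasurable k (ae_of_all _ (hΦk k)))
      have i2 : Integrable (fun x => Real.exp (Φ k x) - 1) ν := by
        refine Integrable.sub (Integrable.of_bound
          (Real.measurable_exp.comp (hΦm k)).aestronglyMeasurable (Real.exp k) ?_)
          (integrable_const _)
        refine ae_of_all _ fun x => ?_
        rw [Real.norm_of_nonneg (Real.exp_nonneg _)]
        exact Real.exp_le_exp.2 ((le_abs_self _).trans (hΦk k x))
      rw [← ofReal_integral_eq_lintegral_ofReal (f := g k) (i1.sub i2) (ae_of_all _ (hg0 k))]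
      refine ENNReal.ofReal_le_ofReal ?_
      have e : ∫ x, f x * Φ k x ∂ν = ∫ x, Φ k x ∂μ := by
        rw [← integral_rnDeriv_smul hac]; rfl
      simp only [g]
      rw [integral_sub i1 i2, e]
      exact h (Φ k) k (hΦm k) (hΦk k)
    calc ∫⁻ x, ENNReal.ofReal (klFun (f x)) ∂ν
        = ∫⁻ x, liminf (fun k => ENNReal.ofReal (g k x)) atTop ∂ν := by
          refine lintegral_congr fun x => ?_
          exact ((ENNReal.tendsto_ofReal (hlim x)).liminf_eq).symm
      _ ≤ liminf (fun k => ∫⁻ x, ENNReal.ofReal (g k x) ∂ν) atTop := by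
          refine lintegral_liminf_le fun k => ENNReal.measurable_ofReal.comp ?_
          exact (hfm.mul (hΦm k)).sub ((Real.measurable_exp.comp (hΦm k)).sub measurable_const)
      _ ≤ ENNReal.ofReal c := by
          refine liminf_le_of_le (by isBoundedDefault) fun b hb => ?_
          obtain ⟨k, hk⟩ := hb.exists
          exact hk.trans (hint k)
  · exfalso
    rw [Measure.AbsolutelyContinuous] at hac
    push Not at hac
    obtain ⟨A, hA, hμA⟩ := hac
    set B := toMeasurable ν A
    have hB : MeasurableSet B := measurableSet_toMeasurable ν A
    have hνB : ν B = 0 := by rw [measure_toMeasurable, hA]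
    have hμB : 0 < μ.real B := by
      rw [measureReal_def, ENNReal.toReal_pos_iff]
      exact ⟨(pos_iff_ne_zero.2 hμA).trans_le (measure_mono (subset_toMeasurable ν A)),
        measure_lt_top _ _⟩
    obtain ⟨k, hk⟩ := exists_nat_gt (c / μ.real B)
    have h1 := h (B.indicator fun _ => (k : ℝ)) k (measurable_const.indicator hB) (fun x => by
      by_cases hx : x ∈ B <;> simp [hx])
    have h2 : ∫ x, (Real.exp (B.indicator (fun _ => (k : ℝ)) x) - 1) ∂ν = 0 := by
      refine integral_eq_zero_of_ae ?_
      filter_upwards [measure_eq_zero_iff_ae_notMem.1 hνB] with x hx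
      simp [hx]
    rw [h2, integral_indicator_const _ hB, smul_eq_mul] at h1
    rw [div_lt_iff₀ hμB] at hk
    linarith

/-- Bounded measurable test functions are approximated in L¹(μ + ν) by continuous ones. Clipping to
[-k, k] moves the approximant no further away and makes the exponential Lipschitz with constant exp
k. -/
theorem klDiv_le_of_forall_boundedContinuous {α : Type*} [TopologicalSpace α]
    [TopologicalSpace.PseudoMetrizableSpace α] [MeasurableSpace α] [BorelSpace α]
    {μ ν : Measure α} [IsProbabilityMeasure μ] [IsProbabilityMeasure ν] {c : ℝ}
    (h : ∀ Φ : α →ᵇ ℝ, ∫ x, Φ x ∂μ - ∫ x, (Real.exp (Φ x) - 1) ∂ν ≤ c) :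
    klDiv μ ν ≤ ENNReal.ofReal c := by
  refine klDiv_le_of_forall_bounded fun Φ k hΦ hk => ?_
  have hexp {ψ : α → ℝ} (hψ : Measurable ψ) (hψk : ∀ x, |ψ x| ≤ k) :
      Integrable (fun x => Real.exp (ψ x) - 1) ν := by
    refine Integrable.sub (Integrable.of_bound (by fun_prop) (Real.exp k) ?_) (integrable_const _)
    refine ae_of_all _ fun x => ?_
    rw [Real.norm_of_nonneg (Real.exp_nonneg _)]
    exact Real.exp_le_exp.2 ((le_abs_self _).trans (hψk x))
  have hint (μ' : Measure α) [IsFiniteMeasure μ'] {ψ : α → ℝ} (hψ : Measurable ψ)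
      (hψk : ∀ x, |ψ x| ≤ k) : Integrable ψ μ' :=
    Integrable.of_bound (by fun_prop) k (ae_of_all _ hψk)
  refine le_of_forall_pos_le_add fun ε hε => ?_
  have hE : 0 < 1 + Real.exp k := by positivity
  -- The L¹ error counts once under `μ` and with factor exp k under `ν`, whence the divisor 1 + exp
  -- k.
  obtain ⟨g, hg, hgi⟩ := (hint (μ + ν) hΦ hk).exists_boundedContinuous_integral_sub_le
    (div_pos hε hE)
  set ψ : α →ᵇ ℝ := BoundedContinuousFunction.ofNormedAddCommGroup
    (fun x => max (-k) (min k (g x))) (by fun_prop) |k| (fun x => by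
      rw [Real.norm_eq_abs, abs_le]
      have := neg_abs_le k
      have := le_abs_self k
      have := neg_le_abs k
      exact ⟨(by linarith : -|k| ≤ -k).trans (le_max_left _ _),
        max_le (by linarith) ((min_le_left _ _).trans (by linarith))⟩) with hψdef
  have hψ (x : α) : ψ x = max (-k) (min k (g x)) := rfl
  have hψk (x : α) : |ψ x| ≤ k := by
    have := (abs_nonneg _).trans (hk x)
    rw [hψ, abs_le]
    exact ⟨le_max_left _ _, max_le (by linarith) (min_le_left _ _)⟩
  have hψm : Measurable ψ := ψ.continuous.measurable
  have hcl (x : α) : |Φ x - ψ x| ≤ |Φ x - g x| := by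
    obtain ⟨h1, h2⟩ := abs_le.1 (hk x)
    have e : Φ x = max (-k) (min k (Φ x)) := by rw [min_eq_right h2, max_eq_right h1]
    rw [hψ]
    conv_lhs => rw [e]
    refine (abs_max_sub_max_le_max _ _ _ _).trans ?_
    rw [sub_self, abs_zero, max_eq_right (abs_nonneg _)]
    refine (abs_min_sub_min_le_max _ _ _ _).trans ?_
    rw [sub_self, abs_zero, max_eq_right (abs_nonneg _)]
  have hgi' (μ' : Measure α) [IsFiniteMeasure μ'] : Integrable (fun x => |Φ x - g x|) μ' :=
    ((hint μ' hΦ hk).sub (g.integrable μ')).abs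
  have hsum : ∫ x, |Φ x - g x| ∂μ + ∫ x, |Φ x - g x| ∂ν ≤ ε / (1 + Real.exp k) := by
    rw [← integral_add_measure (hgi' μ) (hgi' ν)]
    exact hg
  have a1 : ∫ x, Φ x ∂μ ≤ ∫ x, ψ x ∂μ + ∫ x, |Φ x - g x| ∂μ := by
    rw [← integral_add (hint μ hψm hψk) (hgi' μ)]
    refine integral_mono (hint μ hΦ hk) ((hint μ hψm hψk).add (hgi' μ)) fun x => ?_
    have := (le_abs_self _).trans (hcl x)
    simp only
    linarith
  have a2 : ∫ x, (Real.exp (ψ x) - 1) ∂ν ≤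
      ∫ x, (Real.exp (Φ x) - 1) ∂ν + Real.exp k * ∫ x, |Φ x - g x| ∂ν := by
    rw [← integral_const_mul, ← integral_add (hexp hΦ hk) ((hgi' ν).const_mul _)]
    refine integral_mono (hexp hψm hψk) ((hexp hΦ hk).add ((hgi' ν).const_mul _)) fun x => ?_
    have h1 := Real.add_one_le_exp (Φ x - ψ x)
    have h2 : Real.exp (Φ x) = Real.exp (Φ x - ψ x) * Real.exp (ψ x) := by
      rw [← Real.exp_add]; ring_nf
    have h3 : Real.exp (ψ x) ≤ Real.exp k := Real.exp_le_exp.2 ((le_abs_self _).trans (hψk x))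
    have h4 := Real.exp_pos (ψ x)
    have h5 := (neg_le_abs _).trans (hcl x)
    have h6 : -(Φ x - ψ x) * Real.exp (ψ x) ≤ |Φ x - g x| * Real.exp k :=
      mul_le_mul h5 h3 h4.le (abs_nonneg _)
    simp only
    nlinarith
  have a3 := h ψ
  have i1 : 0 ≤ ∫ x, |Φ x - g x| ∂μ := integral_nonneg fun _ => abs_nonneg _
  have i2 : 0 ≤ ∫ x, |Φ x - g x| ∂ν := integral_nonneg fun _ => abs_nonneg _
  rw [le_div_iff₀ hE] at hsum
  have := Real.exp_pos k
  nlinarith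

/-! ### Labelled pairs along a uniform random permutation. -/

section PairSample

set_option linter.unusedSectionVars false

variable {X Y : Type*} [MeasurableSpace X] [MeasurableSpace Y]

/-- The list of the labelled pairs `((x i, x (σ i)), z i)`. -/
def pairSample {N : ℕ} (σ : Equiv.Perm (Fin N)) (p : (Fin N → X) × (Fin N → Y)) :
    Fin N → (X × X) × Y :=
  fun i => ((p.1 i, p.1 (σ i)), p.2 i)

theorem measurable_pairSample {N : ℕ} (σ : Equiv.Perm (Fin N)) :
    Measurable (pairSample σ : (Fin N → X) × (Fin N → Y) → _) := by
  unfold pairSample; fun_prop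

/-- The joint law of the labelled pairs `((x i, x (σ i)), z i)` for a uniform random permutation `σ`,
independent points `x i` with law `m` and independent labels `z i` with law `b`. -/
noncomputable def pairSampleMeasure (m : Measure X) (b : Measure Y) (N : ℕ) :
    Measure (Fin N → (X × X) × Y) :=
  (N.factorial : ℝ≥0∞)⁻¹ • ∑ σ : Equiv.Perm (Fin N),
    ((Measure.pi fun _ : Fin N => m).prod (Measure.pi fun _ : Fin N => b)).map (pairSample σ)

variable {m : Measure X} {b : Measure Y} [IsProbabilityMeasure m] [IsProbabilityMeasure b]

theorem factorial_inv_mul_sum_const (N : ℕ) (c : ℝ≥0∞) :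
    (N.factorial : ℝ≥0∞)⁻¹ * ∑ _σ : Equiv.Perm (Fin N), c = c := by
  rw [Finset.sum_const, Finset.card_univ, Fintype.card_perm, Fintype.card_fin, nsmul_eq_mul,
    ← mul_assoc, ENNReal.inv_mul_cancel (by exact_mod_cast N.factorial_ne_zero)
      (ENNReal.natCast_ne_top _), one_mul]

theorem lintegral_pairSampleMeasure {N : ℕ} {F : (Fin N → (X × X) × Y) → ℝ≥0∞}
    (hF : Measurable F) :
    ∫⁻ w, F w ∂(pairSampleMeasure m b N) = (N.factorial : ℝ≥0∞)⁻¹ * ∑ σ : Equiv.Perm (Fin N),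
      ∫⁻ x, ∫⁻ z, F (pairSample σ (x, z)) ∂(Measure.pi fun _ : Fin N => b)
        ∂(Measure.pi fun _ : Fin N => m) := by
  rw [pairSampleMeasure, lintegral_smul_measure, lintegral_finsetSum_measure, smul_eq_mul]
  congr 1
  refine Finset.sum_congr rfl fun σ _ => ?_
  rw [lintegral_map hF (measurable_pairSample σ),
    lintegral_prod (fun a => F (pairSample σ a))
      (hF.comp (measurable_pairSample σ)).aemeasurable]

instance instIsProbabilityMeasurePairSample (N : ℕ) :
    IsProbabilityMeasure (pairSampleMeasure m b N) := by
  constructor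
  have h := lintegral_pairSampleMeasure (m := m) (b := b) (N := N) (F := fun _ => 1)
    measurable_const
  simp only [lintegral_const, measure_univ, mul_one, one_mul] at h
  rw [h, factorial_inv_mul_sum_const]

theorem lintegral_pi_prod {N : ℕ} {Z : Type*} [MeasurableSpace Z] (μ : Measure Z)
    [IsProbabilityMeasure μ] {f : Fin N → Z → ℝ≥0∞} (hf : ∀ i, Measurable (f i)) :
    ∫⁻ z, ∏ i, f i (z i) ∂(Measure.pi fun _ : Fin N => μ) = ∏ i, ∫⁻ z, f i z ∂μ := by
  have hind : iIndepFun (fun (i : Fin N) (z : Fin N → Z) => f i (z i))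
      (Measure.pi fun _ : Fin N => μ) := iIndepFun_pi fun i => (hf i).aemeasurable
  rw [lintegral_prod_eq_prod_lintegral_of_indepFun Finset.univ
    (fun i (z : Fin N → Z) => f i (z i)) hind fun i => (hf i).comp (measurable_pi_apply i)]
  refine Finset.prod_congr rfl fun i _ => ?_
  exact (measurePreserving_eval (fun _ : Fin N => μ) i).lintegral_comp (hf i)

/-- Given the points and σ the labels are independent, so they integrate out factor by factor. What
remains is the mean of a permanent divided by N!. -/
theorem lintegral_pairSampleMeasure_prod {N : ℕ} {g : (X × X) × Y → ℝ≥0∞} (hg : Measurable g) :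
    ∫⁻ w, ∏ i, g (w i) ∂(pairSampleMeasure m b N) =
      ∫⁻ x, (N.factorial : ℝ≥0∞)⁻¹ * ∑ σ : Equiv.Perm (Fin N), ∏ i, ∫⁻ z, g ((x i, x (σ i)), z) ∂b
        ∂(Measure.pi fun _ : Fin N => m) := by
  have hm (σ : Equiv.Perm (Fin N)) :
      Measurable fun x : Fin N → X => ∏ i, ∫⁻ z, g ((x i, x (σ i)), z) ∂b := by
    refine Finset.measurable_fun_prod _ fun i _ => ?_
    exact (hg.lintegral_prod_right').comp
      ((measurable_pi_apply i).prodMk (measurable_pi_apply (σ i)))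
  have hm' : Measurable fun w : Fin N → (X × X) × Y => ∏ i, g (w i) :=
    Finset.measurable_fun_prod _ fun i _ => hg.comp (measurable_pi_apply i)
  rw [lintegral_pairSampleMeasure hm', lintegral_const_mul _ (Finset.measurable_fun_sum _ fun σ _ =>
    hm σ), lintegral_finsetSum _ fun σ _ => hm σ]
  congr 1
  refine Finset.sum_congr rfl fun σ _ => lintegral_congr fun x => ?_
  exact lintegral_pi_prod b (f := fun i z => g ((x i, x (σ i)), z))
    fun i => hg.comp measurable_prodMk_left

end PairSample

/-! ### Types of words. -/

/-- Equinumerous fibres are matched letter by letter and the bijections are glued together. -/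
theorem exists_perm_comp_eq {α ι : Type*} [Fintype α] [DecidableEq ι] {f g : α → ι}
    (h : ∀ i, Fintype.card {a // f a = i} = Fintype.card {a // g a = i}) :
    ∃ π : Equiv.Perm α, g = f ∘ π := by
  let e (i : ι) : {a // g a = i} ≃ {a // f a = i} := Fintype.equivOfCardEq (h i).symm
  refine ⟨((Equiv.sigmaFiberEquiv g).symm.trans (Equiv.sigmaCongrRight e)).trans
    (Equiv.sigmaFiberEquiv f), ?_⟩
  ext a
  exact ((e (g a)) ⟨a, rfl⟩).2.symm

/-- The average of a function over the arrangements of a word is at most the sum of such averages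
over a set of `(N + 1) ^ card ι` representatives. -/
theorem exists_types (N : ℕ) (ι : Type*) [Fintype ι] [DecidableEq ι] [Nonempty ι] :
    ∃ rep : (ι → Fin (N + 1)) → Fin N → ι, ∀ (F : (Fin N → ι) → ℝ≥0∞) (c : Fin N → ι),
      ∑ σ : Equiv.Perm (Fin N), F (c ∘ σ) ≤ ∑ s, ∑ σ : Equiv.Perm (Fin N), F (rep s ∘ σ) := by
  -- The type of a word is its vector of letter counts. Words of equal type differ by a permutation,
  -- which merely reindexes the sum over σ; so one representative per type suffices, and it depends
  -- neither on `F` nor on the given word.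
  let τ (c : Fin N → ι) (i : ι) : Fin (N + 1) :=
    ⟨Fintype.card {a // c a = i}, Nat.lt_succ_of_le ((Fintype.card_subtype_le _).trans_eq (by simp))⟩
  refine ⟨Function.invFun τ, fun F c => ?_⟩
  have h1 : τ (Function.invFun τ (τ c)) = τ c := Function.invFun_eq ⟨c, rfl⟩
  obtain ⟨π, hπ⟩ := exists_perm_comp_eq (f := c) (g := Function.invFun τ (τ c)) fun i =>
    (congrArg Fin.val (congrFun h1 i)).symm
  have h2 : ∑ σ : Equiv.Perm (Fin N), F (c ∘ σ)
      = ∑ σ : Equiv.Perm (Fin N), F (Function.invFun τ (τ c) ∘ σ) := by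
    rw [hπ, ← Equiv.sum_comp (Equiv.mulLeft π)]
    rfl
  rw [h2]
  exact Finset.single_le_sum (f := fun s => ∑ σ : Equiv.Perm (Fin N), F (Function.invFun τ s ∘ σ))
    (fun _ _ => zero_le) (Finset.mem_univ (τ c))

/-! ### Subexponential moments of normalised test functions. -/

section UpperBound

set_option linter.unusedSectionVars false

variable {X Y : Type*} [MetricSpace X] [SecondCountableTopology X] [MeasurableSpace X]
  [BorelSpace X] [MetricSpace Y] [SecondCountableTopology Y] [MeasurableSpace Y] [BorelSpace Y]
  {m : Measure X} {b : Measure Y} [IsProbabilityMeasure m] [IsProbabilityMeasure b]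

theorem integrable_exp_comp {Z : Type*} [TopologicalSpace Z] [MeasurableSpace Z] [BorelSpace Z]
    (μ : Measure Z) [IsFiniteMeasure μ] (Φ : Z →ᵇ ℝ) :
    Integrable (fun z => Real.exp (Φ z)) μ := by
  refine Integrable.of_bound (Real.measurable_exp.comp Φ.continuous.measurable).aestronglyMeasurable
    (Real.exp ‖Φ‖) (ae_of_all _ fun z => ?_)
  rw [Real.norm_of_nonneg (Real.exp_nonneg _)]
  exact Real.exp_le_exp.2 ((le_abs_self _).trans (Φ.norm_coe_le_norm z))

theorem continuous_integral_exp (Φ : (X × X) × Y →ᵇ ℝ) :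
    Continuous fun p : X × X => ∫ z, Real.exp (Φ (p, z)) ∂b := by
  refine continuous_of_dominated (bound := fun _ => Real.exp ‖Φ‖) (fun p => ?_)
    (fun p => ae_of_all _ fun z => ?_) (integrable_const _) (ae_of_all _ fun z => ?_)
  · exact Continuous.aestronglyMeasurable (by fun_prop)
  · rw [Real.norm_of_nonneg (Real.exp_nonneg _)]
    exact Real.exp_le_exp.2 ((le_abs_self _).trans (Φ.norm_coe_le_norm _))
  · fun_prop

theorem exp_neg_norm_le_integral_exp (Φ : (X × X) × Y →ᵇ ℝ) (p : X × X) :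
    Real.exp (-‖Φ‖) ≤ ∫ z, Real.exp (Φ (p, z)) ∂b ∧
      ∫ z, Real.exp (Φ (p, z)) ∂b ≤ Real.exp ‖Φ‖ := by
  have hi : Integrable (fun z => Real.exp (Φ (p, z))) b :=
    integrable_exp_comp b (Φ.compContinuous ⟨fun z : Y => (p, z), by fun_prop⟩)
  have h1 : ∫ _z : Y, Real.exp (-‖Φ‖) ∂b = Real.exp (-‖Φ‖) := by simp
  have h2 : ∫ _z : Y, Real.exp ‖Φ‖ ∂b = Real.exp ‖Φ‖ := by simp
  constructor
  · rw [← h1]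
    exact integral_mono (integrable_const _) hi fun z => Real.exp_le_exp.2
      (neg_le_of_abs_le (Φ.norm_coe_le_norm _))
  · refine (integral_mono hi (integrable_const (Real.exp ‖Φ‖)) fun z => Real.exp_le_exp.2
      ((le_abs_self _).trans (Φ.norm_coe_le_norm _))).trans_eq h2

/-- By compactness `f (x', ·)` is within `ε` above `f (x, ·)`, uniformly on `K`, for `x'` near `x`;
finitely many `x` serve all of `K`. The choice `c` need not be measurable, since it only enters a
pointwise bound. -/
theorem exists_step_majorant {f : X × X → ℝ} (hf : Continuous f) {K : Set X} (hK : IsCompact K)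
    (hK' : K.Nonempty) {ε : ℝ} (hε : 0 < ε) :
    ∃ (T : Finset X) (c : X → T), ∀ x ∈ K, ∀ y ∈ K, f (x, y) ≤ f (c x, y) + ε := by
  have hU (x : X) (_ : x ∈ K) : {x' | ∀ y ∈ K, f (x', y) < f (x, y) + ε} ∈ 𝓝 x := by
    refine hK.eventually_forall_of_forall_eventually fun y _ => ?_
    have h1 : Continuous fun p : X × X => f (p.1, p.2) - f (x, p.2) := by fun_prop
    have h2 : ∀ᶠ p in 𝓝 (x, y), f (p.1, p.2) - f (x, p.2) < ε :=
      h1.continuousAt.eventually_lt continuousAt_const (by simpa using hε)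
    filter_upwards [h2] with p hp
    linarith
  obtain ⟨T, hT, hcov⟩ := hK.elim_nhds_subcover _ hU
  obtain ⟨x₀, hx₀⟩ := hK'
  obtain ⟨t₀, ht₀, -⟩ := mem_iUnion₂.1 (hcov hx₀)
  have h3 (x : X) : ∃ t : T, x ∈ K → ∀ y ∈ K, f (x, y) ≤ f (t, y) + ε := by
    by_cases hx : x ∈ K
    · obtain ⟨t, ht, hxt⟩ := mem_iUnion₂.1 (hcov hx)
      exact ⟨⟨t, ht⟩, fun _ y hy => (hxt y hy).le⟩
    · exact ⟨⟨t₀, ht₀⟩, fun h => (hx h).elim⟩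
  choose c hc using h3
  exact ⟨T, c, fun x hx => hc x hx⟩

/-- The exponential moments of the pair sample are subexponential for test functions that are
normalised in the second point and the label. -/
theorem exists_lintegral_prod_exp_le {K : Set X} (hK : IsCompact K) (hmK : m Kᶜ = 0)
    (Ψ : (X × X) × Y →ᵇ ℝ)
    (hΨ : ∀ x, ∫ y, ∫ z, Real.exp (Ψ ((x, y), z)) ∂b ∂m = 1) {ε : ℝ} (hε : 0 < ε) :
    ∃ r : ℕ, ∀ N : ℕ, ∫⁻ w, ∏ i, ENNReal.ofReal (Real.exp (Ψ (w i))) ∂(pairSampleMeasure m b N)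
      ≤ ENNReal.ofReal (Real.exp (N * ε)) * ((N : ℝ≥0∞) + 1) ^ r := by
  classical
  set a : X × X → ℝ := fun p => ∫ z, Real.exp (Ψ (p, z)) ∂b with ha
  have hac : Continuous a := continuous_integral_exp Ψ
  have ha0 (p : X × X) : 0 < a p := (Real.exp_pos _).trans_le (exp_neg_norm_le_integral_exp Ψ p).1
  have hKne : K.Nonempty := by
    by_contra h
    rw [not_nonempty_iff_eq_empty] at h
    simp [h] at hmK
  -- Applied to log a, so that the additive error becomes a factor exp ε per particle.
  obtain ⟨T, c, hc⟩ := exists_step_majorant (f := fun p => Real.log (a p))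
    (hac.log fun p => (ha0 p).ne') hK hKne hε
  have : Nonempty T := ⟨c hKne.some⟩
  have hc' (x : X) (hx : x ∈ K) (y : X) (hy : y ∈ K) : ENNReal.ofReal (a (x, y)) ≤
      ENNReal.ofReal (Real.exp ε) * ENNReal.ofReal (a (c x, y)) := by
    rw [← ENNReal.ofReal_mul (Real.exp_nonneg _)]
    refine ENNReal.ofReal_le_ofReal ?_
    have h1 := Real.exp_le_exp.2 (hc x hx y hy)
    rwa [Real.exp_add, Real.exp_log (ha0 _), Real.exp_log (ha0 _), mul_comm] at h1
  have hae (p : X × X) :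
      ∫⁻ z, ENNReal.ofReal (Real.exp (Ψ (p, z))) ∂b = ENNReal.ofReal (a p) := by
    rw [← ofReal_integral_eq_lintegral_ofReal _ (ae_of_all _ fun z => Real.exp_nonneg _)]
    exact integrable_exp_comp b (Ψ.compContinuous ⟨fun z : Y => (p, z), by fun_prop⟩)
  have ham (t : X) : Measurable fun y => ENNReal.ofReal (a (t, y)) :=
    ENNReal.measurable_ofReal.comp (hac.measurable.comp measurable_prodMk_left)
  have ha1 (t : X) : ∫⁻ y, ENNReal.ofReal (a (t, y)) ∂m = 1 := by
    rw [← ofReal_integral_eq_lintegral_ofReal _ (ae_of_all _ fun y => (ha0 _).le), ← ENNReal.ofReal_one]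
    · exact congrArg ENNReal.ofReal (hΨ t)
    · refine Integrable.of_bound (hac.comp (by fun_prop)).aestronglyMeasurable (Real.exp ‖Ψ‖)
        (ae_of_all _ fun y => ?_)
      rw [Real.norm_of_nonneg (ha0 _).le]
      exact (exp_neg_norm_le_integral_exp Ψ _).2
  refine ⟨Fintype.card T, fun N => ?_⟩
  obtain ⟨rep, hrep⟩ := exists_types N T
  rw [lintegral_pairSampleMeasure_prod
    (g := fun q => ENNReal.ofReal (Real.exp (Ψ q))) (by fun_prop)]
  simp only [hae]
  have hmem : ∀ᵐ x ∂(Measure.pi fun _ : Fin N => m), ∀ i, x i ∈ K := by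
    rw [ae_all_iff]
    intro i
    exact (measurePreserving_eval (fun _ : Fin N => m) i).quasiMeasurePreserving.ae
      (measure_eq_zero_iff_ae_notMem.1 hmK |>.mono fun x hx => by simpa using hx)
  have hmeas (u : Fin N → T) :
      Measurable fun x : Fin N → X => ∏ j, ENNReal.ofReal (a (u j, x j)) :=
    Finset.measurable_fun_prod _ fun j _ => (ham _).comp (measurable_pi_apply j)
  calc ∫⁻ x, (N.factorial : ℝ≥0∞)⁻¹ * ∑ σ : Equiv.Perm (Fin N),
          ∏ i, ENNReal.ofReal (a (x i, x (σ i))) ∂(Measure.pi fun _ : Fin N => m)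
      ≤ ∫⁻ x, ENNReal.ofReal (Real.exp (N * ε)) * ((N.factorial : ℝ≥0∞)⁻¹ *
          ∑ s, ∑ σ : Equiv.Perm (Fin N), ∏ j, ENNReal.ofReal (a (rep s (σ j), x j)))
          ∂(Measure.pi fun _ : Fin N => m) := by
        refine lintegral_mono_ae ?_
        filter_upwards [hmem] with x hx
        have h1 (σ : Equiv.Perm (Fin N)) : ∏ i, ENNReal.ofReal (a (x i, x (σ i))) ≤
            ENNReal.ofReal (Real.exp (N * ε)) *
              ∏ j, ENNReal.ofReal (a (c (x (σ⁻¹ j)), x j)) := by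
          have h2 : ∏ j, ENNReal.ofReal (a (c (x (σ⁻¹ j)), x j))
              = ∏ i, ENNReal.ofReal (a (c (x i), x (σ i))) := by
            rw [← Equiv.prod_comp σ]
            simp
          have h3 : ENNReal.ofReal (Real.exp (N * ε))
              = ∏ _i : Fin N, ENNReal.ofReal (Real.exp ε) := by
            rw [Finset.prod_const, Finset.card_univ, Fintype.card_fin,
              ← ENNReal.ofReal_pow (Real.exp_nonneg _), ← Real.exp_nat_mul]
          rw [h2, h3, ← Finset.prod_mul_distrib]
          exact Finset.prod_le_prod' fun i _ => hc' _ (hx _) _ (hx _)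
        rw [mul_left_comm]
        refine mul_le_mul_right ?_ _
        refine (Finset.sum_le_sum fun σ _ => h1 σ).trans ?_
        rw [← Finset.mul_sum]
        refine mul_le_mul_right ?_ _
        -- With σ replaced by its inverse the permutation acts on the word `c (x i)` instead of the
        -- points. Passing to representatives of types then removes the dependence of the word on
        -- `x`.
        rw [← Equiv.sum_comp (Equiv.inv (Equiv.Perm (Fin N)))]
        simp only [Equiv.inv_apply, inv_inv]
        exact hrep (fun u => ∏ j, ENNReal.ofReal (a (u j, x j))) fun i => c (x i)
    -- For a fixed word the coordinates of `x` are independent and each factor integrates to 1 by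
    -- the normalisation; only the number of types is left.
    _ = ENNReal.ofReal (Real.exp (N * ε)) * ((N.factorial : ℝ≥0∞)⁻¹ *
          ∑ _s : T → Fin (N + 1), ∑ _σ : Equiv.Perm (Fin N), 1) := by
        rw [lintegral_const_mul, lintegral_const_mul, lintegral_finsetSum]
        · congr 2
          refine Finset.sum_congr rfl fun s _ => ?_
          rw [lintegral_finsetSum _ fun σ _ => hmeas fun j => rep s (σ j)]
          refine Finset.sum_congr rfl fun σ _ => ?_
          rw [lintegral_pi_prod m fun j => ham _]
          simp [ha1]
        · exact fun s _ => Finset.measurable_fun_sum _ fun σ _ => hmeas fun j => rep s (σ j)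
        · exact Finset.measurable_fun_sum _ fun s _ =>
            Finset.measurable_fun_sum _ fun σ _ => hmeas fun j => rep s (σ j)
        · exact (Finset.measurable_fun_sum _ fun s _ =>
            Finset.measurable_fun_sum _ fun σ _ => hmeas fun j => rep s (σ j)).const_mul _
    _ ≤ ENNReal.ofReal (Real.exp (N * ε)) * ((N : ℝ≥0∞) + 1) ^ Fintype.card T := by
        gcongr
        rw [Finset.mul_sum]
        simp only [factorial_inv_mul_sum_const]
        simp

end UpperBound

/-! ### Integrals, masses and images of empirical measures. -/

section Empirical

variable {Z W : Type*} [MeasurableSpace Z] [MeasurableSpace W]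

theorem coe_empiricalMeasure (N : ℕ) [NeZero N] (w : Fin N → Z) :
    (empiricalMeasure N w : Measure Z) = (N : ℝ≥0∞)⁻¹ • ∑ i, Measure.dirac (w i) := rfl

theorem integral_empiricalMeasure (N : ℕ) [NeZero N] (w : Fin N → Z) {f : Z → ℝ}
    (hf : StronglyMeasurable f) :
    ∫ z, f z ∂(empiricalMeasure N w : Measure Z) = (N : ℝ)⁻¹ * ∑ i, f (w i) := by
  rw [coe_empiricalMeasure, integral_smul_measure, integral_finsetSum_measure]
  · simp [integral_dirac' _ _ hf]
  · intro i _
    exact integrable_dirac' hf (by simp)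

theorem empiricalMeasure_apply (N : ℕ) [NeZero N] (w : Fin N → Z) {S : Set Z}
    (hS : MeasurableSet S) :
    (empiricalMeasure N w : Measure Z) S = (N : ℝ≥0∞)⁻¹ * ∑ i, S.indicator 1 (w i) := by
  rw [coe_empiricalMeasure, Measure.smul_apply, Measure.finsetSum_apply]
  simp [Measure.dirac_apply' _ hS]

theorem map_empiricalMeasure (N : ℕ) [NeZero N] (w : Fin N → Z) {f : Z → W} (hf : Measurable f) :
    (empiricalMeasure N w : Measure Z).map f = (empiricalMeasure N (f ∘ w) : Measure W) := by
  rw [coe_empiricalMeasure, coe_empiricalMeasure, Measure.map_smul]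
  congr 1
  ext S hS
  simp [Measure.map_apply hf hS, Measure.finsetSum_apply, Measure.dirac_apply' _ hS,
    Measure.dirac_apply' _ (hf hS)]
  rfl

end Empirical

/-- Polynomial factors and arbitrarily small losses in the exponent are invisible on the exponential
scale. The degree `r` may depend on `ε`, as the number of types does. -/
theorem expDecay_of_le_mul_pow {t : ℝ} {p : ℕ → ℝ≥0∞}
    (h : ∀ ε > 0, ∃ r : ℕ, ∀ n : ℕ, p n ≤
      ENNReal.ofReal (Real.exp (-(t - ε) * (n + 1))) * (((n + 1 : ℕ) : ℝ≥0∞) + 1) ^ r) :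
    ExpDecay t p := by
  intro s hs
  obtain ⟨r, hr⟩ := h ((t - s) / 2) (by linarith)
  have hb : 0 < (t - s) / 2 := by linarith
  have h1 := (isLittleO_pow_exp_pos_mul_atTop r hb).bound (c := Real.exp (-((t - s) / 2)))
    (Real.exp_pos _)
  have h2 : Tendsto (fun n : ℕ => ((n + 1 : ℕ) : ℝ) + 1) atTop atTop :=
    tendsto_atTop_add_const_right _ 1
      (tendsto_natCast_atTop_atTop.comp (tendsto_add_atTop_nat 1))
  filter_upwards [h2.eventually h1] with n hn
  refine (hr n).trans ?_
  have e1 : (((n + 1 : ℕ) : ℝ≥0∞) + 1) ^ r = ENNReal.ofReal ((((n + 1 : ℕ) : ℝ) + 1) ^ r) := by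
    rw [ENNReal.ofReal_pow (by positivity), ENNReal.ofReal_add (by positivity) zero_le_one,
      ENNReal.ofReal_natCast, ENNReal.ofReal_one]
  rw [e1, ← ENNReal.ofReal_mul (Real.exp_nonneg _)]
  refine ENNReal.ofReal_le_ofReal ?_
  rw [Real.norm_of_nonneg (by positivity), Real.norm_of_nonneg (Real.exp_nonneg _),
    ← Real.exp_add] at hn
  calc Real.exp (-(t - (t - s) / 2) * (n + 1)) * (((n + 1 : ℕ) : ℝ) + 1) ^ r
      ≤ Real.exp (-(t - (t - s) / 2) * (n + 1)) *
        Real.exp (-((t - s) / 2) + (t - s) / 2 * (((n + 1 : ℕ) : ℝ) + 1)) := by gcongr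
    _ = Real.exp (-s * (n + 1)) := by
        rw [← Real.exp_add]; push_cast; ring_nf

/-! ### The rate of labelled pairs and the local upper bound. -/

section Bounds

variable {X Y : Type*} [MetricSpace X] [SecondCountableTopology X] [MeasurableSpace X]
  [BorelSpace X] [MetricSpace Y] [SecondCountableTopology Y] [MeasurableSpace Y] [BorelSpace Y]

open Classical in
/-- The rate function of the empirical measures of labelled pairs `((x i, x (σ i)), z i)`. -/
noncomputable def pairRate (m : Measure X) (b : Measure Y)
    (R : ProbabilityMeasure ((X × X) × Y)) : EReal :=
  if (R : Measure ((X × X) × Y)).fst.fst = (R : Measure ((X × X) × Y)).fst.snd then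
    (klDiv (R : Measure ((X × X) × Y)) (((R : Measure ((X × X) × Y)).fst.fst.prod m).prod b) : EReal)
  else ⊤

variable {m : Measure X} {b : Measure Y} [IsProbabilityMeasure m] [IsProbabilityMeasure b]

omit [MetricSpace X] [SecondCountableTopology X] [BorelSpace X] [MetricSpace Y]
  [SecondCountableTopology Y] [BorelSpace Y] [IsProbabilityMeasure m] [IsProbabilityMeasure b] in
theorem pairSampleMeasure_apply {N : ℕ} {S : Set (Fin N → (X × X) × Y)} (hS : MeasurableSet S) :
    pairSampleMeasure m b N S = (N.factorial : ℝ≥0∞)⁻¹ * ∑ σ : Equiv.Perm (Fin N),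
      ((Measure.pi fun _ : Fin N => m).prod (Measure.pi fun _ : Fin N => b))
        (pairSample σ ⁻¹' S) := by
  rw [pairSampleMeasure, Measure.smul_apply, Measure.finsetSum_apply, smul_eq_mul]
  simp_rw [Measure.map_apply (measurable_pairSample _) hS]

/-- The normalisation of a test function in the second point and the label. -/
theorem exists_normalised (Φ : (X × X) × Y →ᵇ ℝ) :
    ∃ Ψ : (X × X) × Y →ᵇ ℝ, (∀ x, ∫ y, ∫ z, Real.exp (Ψ ((x, y), z)) ∂b ∂m = 1) ∧
      ∀ μ : Measure ((X × X) × Y), IsProbabilityMeasure μ →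
        ∫ q, Φ q ∂μ - ∫ q, (Real.exp (Φ q) - 1) ∂((μ.fst.fst.prod m).prod b) ≤ ∫ q, Ψ q ∂μ := by
  set a : X → ℝ := fun x => ∫ y, ∫ z, Real.exp (Φ ((x, y), z)) ∂b ∂m with ha
  have hi (x : X) : Integrable (fun y => ∫ z, Real.exp (Φ ((x, y), z)) ∂b) m := by
    refine Integrable.of_bound ((continuous_integral_exp Φ).comp (f := fun y => (x, y))
      (by fun_prop)).aestronglyMeasurable (Real.exp ‖Φ‖) (ae_of_all _ fun y => ?_)
    have h := exp_neg_norm_le_integral_exp (b := b) Φ (x, y)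
    rw [Real.norm_of_nonneg ((Real.exp_pos _).le.trans h.1)]
    exact h.2
  have hac : Continuous a := by
    refine continuous_of_dominated (bound := fun _ => Real.exp ‖Φ‖)
      (fun x => (hi x).aestronglyMeasurable)
      (fun x => ae_of_all _ fun y => ?_) (integrable_const _) (ae_of_all _ fun y => ?_)
    · have h := exp_neg_norm_le_integral_exp (b := b) Φ (x, y)
      rw [Real.norm_of_nonneg ((Real.exp_pos _).le.trans h.1)]
      exact h.2
    · exact (continuous_integral_exp Φ).comp (f := fun x => (x, y)) (by fun_prop)
  have ha1 (x : X) : Real.exp (-‖Φ‖) ≤ a x := by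
    have := integral_mono (integrable_const (Real.exp (-‖Φ‖))) (hi x) fun y =>
      (exp_neg_norm_le_integral_exp Φ (x, y)).1
    simpa using this
  have ha2 (x : X) : a x ≤ Real.exp ‖Φ‖ := by
    have := integral_mono (hi x) (integrable_const (Real.exp ‖Φ‖)) fun y =>
      (exp_neg_norm_le_integral_exp Φ (x, y)).2
    simpa using this
  have ha0 (x : X) : 0 < a x := (Real.exp_pos _).trans_le (ha1 x)
  have hlog (x : X) : |Real.log (a x)| ≤ ‖Φ‖ := by
    rw [abs_le]
    exact ⟨(Real.le_log_iff_exp_le (ha0 x)).2 (ha1 x), (Real.log_le_iff_le_exp (ha0 x)).2 (ha2 x)⟩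
  have hlc : Continuous fun q : (X × X) × Y => Real.log (a q.1.1) :=
    (hac.comp (by fun_prop)).log fun q => (ha0 _).ne'
  -- Subtracting the logarithm of the mass of exp Φ given the first point normalises Φ and keeps it
  -- bounded and continuous.
  set Ψ : (X × X) × Y →ᵇ ℝ := BoundedContinuousFunction.ofNormedAddCommGroup
    (fun q => Φ q - Real.log (a q.1.1)) (Φ.continuous.sub hlc) (‖Φ‖ + ‖Φ‖) (fun q =>
      (norm_sub_le _ _).trans (add_le_add (Φ.norm_coe_le_norm q) (hlog _))) with hΨ
  refine ⟨Ψ, fun x => ?_, fun μ hμ => ?_⟩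
  · have e (y : X) (z : Y) : Real.exp (Ψ ((x, y), z)) = (a x)⁻¹ * Real.exp (Φ ((x, y), z)) := by
      change Real.exp (Φ ((x, y), z) - Real.log (a x)) = _
      rw [Real.exp_sub, Real.exp_log (ha0 x), div_eq_inv_mul]
    simp only [e, integral_const_mul]
    exact inv_mul_cancel₀ (ha0 x).ne'
  · have i1 : Integrable (fun q : (X × X) × Y => Real.log (a q.1.1)) μ :=
      Integrable.of_bound hlc.aestronglyMeasurable ‖Φ‖ (ae_of_all _ fun q => hlog _)
    have i2 : Integrable a μ.fst.fst :=
      Integrable.of_bound hac.aestronglyMeasurable (Real.exp ‖Φ‖) (ae_of_all _ fun q => by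
        rw [Real.norm_of_nonneg (ha0 _).le]; exact ha2 _)
    have i3 : Integrable (fun q => Real.exp (Φ q)) ((μ.fst.fst.prod m).prod b) :=
      integrable_exp_comp _ Φ
    have e1 : ∫ q, Ψ q ∂μ = ∫ q, Φ q ∂μ - ∫ q, Real.log (a q.1.1) ∂μ :=
      integral_sub (Φ.integrable μ) i1
    have e2 : ∫ q, Real.log (a q.1.1) ∂μ = ∫ x, Real.log (a x) ∂μ.fst.fst := by
      have hl : Continuous fun x => Real.log (a x) := hac.log fun x => (ha0 x).ne'
      rw [Measure.fst, Measure.fst, Measure.map_map measurable_fst measurable_fst,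
        integral_map (by fun_prop) hl.aestronglyMeasurable]
      rfl
    have e3 : ∫ q, (Real.exp (Φ q) - 1) ∂((μ.fst.fst.prod m).prod b)
        = ∫ x, (a x - 1) ∂μ.fst.fst := by
      rw [integral_sub i3 (integrable_const _), integral_sub i2 (integrable_const _),
        integral_prod _ i3, integral_prod _ i3.integral_prod_left]
      simp [ha]
    -- By log a ≤ a - 1 the normalised functional is at least as large as the original one.
    have e4 : ∫ x, Real.log (a x) ∂μ.fst.fst ≤ ∫ x, (a x - 1) ∂μ.fst.fst := by
      refine integral_mono ?_ (i2.sub (integrable_const _)) fun x =>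
        Real.log_le_sub_one_of_pos (ha0 x)
      exact Integrable.of_bound (hac.log fun x => (ha0 x).ne').aestronglyMeasurable ‖Φ‖
        (ae_of_all _ fun q => hlog _)
    linarith

/-- With equal marginals, a test function beating `t` in the dual formula is normalised and Markov's
inequality is applied to its exponential moment. With different marginals the neighbourhood has
probability zero: σ is a bijection, so an empirical pair measure always has equal marginals. -/
theorem pairRate_local_upper_bound {K : Set X} (hK : IsCompact K) (hmK : m Kᶜ = 0)
    (R : ProbabilityMeasure ((X × X) × Y)) {t : ℝ} (ht : (t : EReal) < pairRate m b R) :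
    ∃ U : Set (ProbabilityMeasure ((X × X) × Y)), IsOpen U ∧ R ∈ U ∧
      ExpDecay t fun n => pairSampleMeasure m b (n + 1) {w | empiricalMeasure (n + 1) w ∈ U} := by
  unfold pairRate at ht
  split_ifs at ht with hR
  · obtain ⟨Φ, hΦ⟩ : ∃ Φ : (X × X) × Y →ᵇ ℝ, t < ∫ q, Φ q ∂(R : Measure ((X × X) × Y)) -
        ∫ q, (Real.exp (Φ q) - 1) ∂(((R : Measure ((X × X) × Y)).fst.fst.prod m).prod b) := by
      -- `ENNReal.ofReal` truncates negative values, so negative `t` is treated separately, with the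
      -- zero test function.
      rcases lt_or_ge t 0 with h0 | h0
      · exact ⟨0, by simpa using h0⟩
      · by_contra! h
        have h1 := klDiv_le_of_forall_boundedContinuous h
        have h2 : (klDiv (R : Measure ((X × X) × Y))
            (((R : Measure ((X × X) × Y)).fst.fst.prod m).prod b) : EReal)
            ≤ ((ENNReal.ofReal t : ℝ≥0∞) : EReal) := EReal.coe_ennreal_le_coe_ennreal_iff.2 h1
        rw [EReal.coe_ennreal_ofReal, max_eq_left h0] at h2
        exact h2.not_gt ht
    obtain ⟨Ψ, hΨ1, hΨ2⟩ := exists_normalised (m := m) (b := b) Φ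
    refine ⟨{R' | t < ∫ q, Ψ q ∂(R' : Measure ((X × X) × Y))}, ?_,
      hΦ.trans_le (hΨ2 R inferInstance), ?_⟩
    · exact isOpen_lt continuous_const
        (ProbabilityMeasure.continuous_integral_boundedContinuousFunction Ψ)
    · refine expDecay_of_le_mul_pow fun ε hε => ?_
      obtain ⟨r, hr⟩ := exists_lintegral_prod_exp_le (b := b) hK hmK Ψ hΨ1 hε
      refine ⟨r, fun n => ?_⟩
      have hN : (0 : ℝ) < ((n + 1 : ℕ) : ℝ) := by positivity
      have h1 := (mul_meas_ge_le_lintegral₀ (μ := pairSampleMeasure m b (n + 1))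
        (f := fun w => ∏ i, ENNReal.ofReal (Real.exp (Ψ (w i))))
        (Finset.measurable_fun_prod _ fun i _ => by fun_prop).aemeasurable
        (ENNReal.ofReal (Real.exp ((n + 1 : ℕ) * t)))).trans (hr (n + 1))
      have h2 : {w : Fin (n + 1) → (X × X) × Y | empiricalMeasure (n + 1) w ∈
          {R' : ProbabilityMeasure ((X × X) × Y) | t < ∫ q, Ψ q ∂(R' : Measure ((X × X) × Y))}} ⊆
          {w | ENNReal.ofReal (Real.exp ((n + 1 : ℕ) * t)) ≤
            ∏ i, ENNReal.ofReal (Real.exp (Ψ (w i)))} := by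
        intro w hw
        simp only [mem_ofPred_eq] at hw ⊢
        rw [integral_empiricalMeasure _ _ Ψ.continuous.stronglyMeasurable,
          lt_inv_mul_iff₀ hN] at hw
        rw [← ENNReal.ofReal_prod_of_nonneg fun i _ => Real.exp_nonneg _, ← Real.exp_sum]
        exact ENNReal.ofReal_le_ofReal (Real.exp_le_exp.2 hw.le)
      refine (measure_mono h2).trans ?_
      have e : ENNReal.ofReal (Real.exp (-(t - ε) * (n + 1)))
          = ENNReal.ofReal (Real.exp ((n + 1 : ℕ) * ε)) /
            ENNReal.ofReal (Real.exp ((n + 1 : ℕ) * t)) := by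
        rw [← ENNReal.ofReal_div_of_pos (Real.exp_pos _), ← Real.exp_sub]
        congr 2
        push_cast
        ring
      rw [e, div_eq_mul_inv, mul_right_comm, ← div_eq_mul_inv, ENNReal.le_div_iff_mul_le
        (Or.inl (by simp [Real.exp_pos])) (Or.inl ENNReal.ofReal_ne_top), mul_comm]
      exact h1
  · obtain ⟨f, hf⟩ : ∃ f : X →ᵇ ℝ, ∫ x, f x ∂(R : Measure ((X × X) × Y)).fst.fst ≠
        ∫ x, f x ∂(R : Measure ((X × X) × Y)).fst.snd := by
      by_contra! h
      exact hR (ext_of_forall_integral_eq_of_IsFiniteMeasure h)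
    let Ψ : (X × X) × Y →ᵇ ℝ := f.compContinuous ⟨fun q => q.1.1, by fun_prop⟩ -
      f.compContinuous ⟨fun q => q.1.2, by fun_prop⟩
    have hΨ (q : (X × X) × Y) : Ψ q = f q.1.1 - f q.1.2 := rfl
    refine ⟨{R' | ∫ q, Ψ q ∂(R' : Measure ((X × X) × Y)) ≠ 0}, ?_, ?_, ?_⟩
    · exact isOpen_ne_fun (ProbabilityMeasure.continuous_integral_boundedContinuousFunction Ψ)
        continuous_const
    · have e1 : ∫ x, f x ∂(R : Measure ((X × X) × Y)).fst.fst
          = ∫ q, f q.1.1 ∂(R : Measure ((X × X) × Y)) := by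
        rw [Measure.fst, Measure.fst, Measure.map_map measurable_fst measurable_fst,
          integral_map (by fun_prop) f.continuous.aestronglyMeasurable]
        rfl
      have e2 : ∫ x, f x ∂(R : Measure ((X × X) × Y)).fst.snd
          = ∫ q, f q.1.2 ∂(R : Measure ((X × X) × Y)) := by
        rw [Measure.fst, Measure.snd, Measure.map_map measurable_snd measurable_fst,
          integral_map (by fun_prop) f.continuous.aestronglyMeasurable]
        rfl
      rw [e1, e2] at hf
      simp only [mem_ofPred_eq, hΨ]
      rw [integral_sub (f := fun q : (X × X) × Y => f q.1.1) (g := fun q => f q.1.2) ((f.compContinuous ⟨fun q : (X × X) × Y => q.1.1, by fun_prop⟩).integrable _)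
        ((f.compContinuous ⟨fun q : (X × X) × Y => q.1.2, by fun_prop⟩).integrable _)]
      exact sub_ne_zero.2 hf
    · refine (expDecay_zero t).mono_left fun n => le_of_eq ?_
      have hS : {w : Fin (n + 1) → (X × X) × Y | empiricalMeasure (n + 1) w ∈
          {R' : ProbabilityMeasure ((X × X) × Y) | ∫ q, Ψ q ∂(R' : Measure ((X × X) × Y)) ≠ 0}} =
          {w | ((n + 1 : ℕ) : ℝ)⁻¹ * ∑ i, Ψ (w i) ≠ 0} := by
        ext w
        simp only [mem_ofPred_eq]
        rw [integral_empiricalMeasure _ _ Ψ.continuous.stronglyMeasurable]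
      have hm : Measurable fun w : Fin (n + 1) → (X × X) × Y =>
          ((n + 1 : ℕ) : ℝ)⁻¹ * ∑ i, Ψ (w i) := by
        have := Ψ.continuous.measurable
        fun_prop
      have hS' : MeasurableSet {w : Fin (n + 1) → (X × X) × Y |
          ((n + 1 : ℕ) : ℝ)⁻¹ * ∑ i, Ψ (w i) ≠ 0} := hm (measurableSet_singleton 0).compl
      rw [hS, pairSampleMeasure_apply hS']
      -- The sum of f(x_i) - f(x_σ(i)) over all indices vanishes identically.
      have h0 (σ : Equiv.Perm (Fin (n + 1))) : (pairSample σ ⁻¹'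
          {w : Fin (n + 1) → (X × X) × Y | ((n + 1 : ℕ) : ℝ)⁻¹ * ∑ i, Ψ (w i) ≠ 0}) = ∅ := by
        ext p
        simp only [mem_preimage, mem_ofPred_eq, mem_empty_iff_false, hΨ, pairSample,
          Finset.sum_sub_distrib, Equiv.sum_comp σ fun i => f (p.1 i), sub_self, mul_zero, ne_eq,
          not_true_eq_false]
      simp only [h0, measure_empty, Finset.sum_const_zero, mul_zero]

end Bounds

/-! ### Exponential tightness. -/

section Tightness

set_option linter.unusedSectionVars false

variable {X Y : Type*} [MetricSpace X] [SecondCountableTopology X] [MeasurableSpace X]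
  [BorelSpace X] [MetricSpace Y] [SecondCountableTopology Y] [MeasurableSpace Y] [BorelSpace Y]
  {m : Measure X} {b : Measure Y} [IsProbabilityMeasure m] [IsProbabilityMeasure b]

theorem pairSampleMeasure_exists_notMem {K : Set X} (hK : IsCompact K) (hmK : m Kᶜ = 0) (N : ℕ) :
    pairSampleMeasure m b N {w | ∃ i, (w i).1 ∉ K ×ˢ K} = 0 := by
  have hKm : MeasurableSet K := hK.measurableSet
  have hS : MeasurableSet {w : Fin N → (X × X) × Y | ∃ i, (w i).1 ∉ K ×ˢ K} := by
    have : {w : Fin N → (X × X) × Y | ∃ i, (w i).1 ∉ K ×ˢ K}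
        = ⋃ i, (fun w => (w i).1) ⁻¹' (K ×ˢ K)ᶜ := by ext w; simp
    rw [this]
    exact MeasurableSet.iUnion fun i =>
      (measurable_fst.comp (measurable_pi_apply i)) (hKm.prod hKm).compl
  rw [pairSampleMeasure_apply hS]
  have h1 : ∀ᵐ x ∂(Measure.pi fun _ : Fin N => m), ∀ i, x i ∈ K := by
    rw [ae_all_iff]
    intro i
    exact (measurePreserving_eval (fun _ : Fin N => m) i).quasiMeasurePreserving.ae
      (measure_eq_zero_iff_ae_notMem.1 hmK |>.mono fun x hx => by simpa using hx)
  have h2 : ∀ᵐ p ∂((Measure.pi fun _ : Fin N => m).prod (Measure.pi fun _ : Fin N => b)),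
      ∀ i, p.1 i ∈ K := Measure.quasiMeasurePreserving_fst.ae h1
  have h3 (σ : Equiv.Perm (Fin N)) :
      ((Measure.pi fun _ : Fin N => m).prod (Measure.pi fun _ : Fin N => b))
        (pairSample σ ⁻¹' {w : Fin N → (X × X) × Y | ∃ i, (w i).1 ∉ K ×ˢ K}) = 0 := by
    rw [measure_eq_zero_iff_ae_notMem]
    filter_upwards [h2] with p hp
    simp only [mem_preimage, mem_ofPred_eq, not_exists, not_not]
    exact fun i => ⟨hp i, hp (σ i)⟩
  simp only [h3, Finset.sum_const_zero, mul_zero]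

/-- A weight on the labels with large values off compact sets. -/
theorem exists_weight [CompleteSpace Y] (b : Measure Y) [IsProbabilityMeasure b] :
    ∃ (C : ℕ → Set Y) (g : Y → ℝ≥0∞), (∀ k, IsCompact (C k)) ∧ Measurable g ∧ (∀ z, 1 ≤ g z) ∧
      (∀ k, ∀ z ∉ C k, ENNReal.ofReal (Real.exp (k + 1)) ≤ g z) ∧ ∫⁻ z, g z ∂b ≤ 3 := by
  have ht : IsTightMeasureSet {b} := isTightMeasureSet_singleton
  rw [isTightMeasureSet_iff_exists_isCompact_measure_compl_le] at ht
  -- The tolerance makes the k-th summand of the weight, of height exp (k + 1) off `C k`, contribute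
  -- at most 2⁻ᵏ to the integral.
  have hC (k : ℕ) : ∃ C, IsCompact C ∧
      b Cᶜ ≤ (ENNReal.ofReal (Real.exp (k + 1)))⁻¹ * 2⁻¹ ^ k := by
    obtain ⟨C, hC, h⟩ := ht ((ENNReal.ofReal (Real.exp (k + 1)))⁻¹ * 2⁻¹ ^ k) (by
      refine ENNReal.mul_pos (ENNReal.inv_ne_zero.2 ENNReal.ofReal_ne_top) ?_
      exact pow_ne_zero _ (by simp))
    exact ⟨C, hC, h b rfl⟩
  choose C hC hb using hC
  have hm (k : ℕ) : Measurable
      ((C k)ᶜ.indicator fun _ => ENNReal.ofReal (Real.exp (k + 1)) : Y → ℝ≥0∞) :=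
    measurable_const.indicator (hC k).measurableSet.compl
  refine ⟨C, fun z => 1 + ∑' k : ℕ, (C k)ᶜ.indicator
    (fun _ => ENNReal.ofReal (Real.exp (k + 1))) z, hC, ?_, fun z => le_self_add, ?_, ?_⟩
  · exact measurable_const.add (Measurable.tsum hm)
  · intro k z hz
    refine le_trans ?_ (le_add_self.trans' (ENNReal.le_tsum k))
    rw [indicator_of_mem (show z ∈ (C k)ᶜ from hz)]
  · rw [lintegral_add_left measurable_const, lintegral_tsum fun k => (hm k).aemeasurable]
    have h1 (k : ℕ) : ∫⁻ z, (C k)ᶜ.indicator (fun _ => ENNReal.ofReal (Real.exp (k + 1))) z ∂b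
        ≤ 2⁻¹ ^ k := by
      rw [lintegral_indicator (hC k).measurableSet.compl, setLIntegral_const]
      refine (mul_le_mul_right (hb k) _).trans ?_
      rw [← mul_assoc, ENNReal.mul_inv_cancel (by simp [Real.exp_pos]) ENNReal.ofReal_ne_top,
        one_mul]
    refine (add_le_add_right (ENNReal.tsum_le_tsum h1) _).trans ?_
    rw [ENNReal.tsum_geometric, ENNReal.one_sub_inv_two, inv_inv]
    simp only [lintegral_const, measure_univ, mul_one]
    norm_num

/-- Almost surely all pairs of points stay in `K ×ˢ K`, so only the labels can escape. If too large
a fraction of them leaves some `C k`, the product of the weights is at least exp (N M), while its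
mean is at most 3 ^ N. -/
theorem exists_isCompact_expDecay [CompleteSpace Y] {K : Set X} (hK : IsCompact K)
    (hmK : m Kᶜ = 0) (L : ℝ) :
    ∃ S : Set (ProbabilityMeasure ((X × X) × Y)), IsCompact S ∧
      ExpDecay L fun n => pairSampleMeasure m b (n + 1) {w | empiricalMeasure (n + 1) w ∈ Sᶜ} := by
  obtain ⟨C, g, hC, hgm, hg1, hgC, hg3⟩ := exists_weight b
  -- The extra 2 pays for the mean, since 3 ≤ exp 2.
  set M : ℝ≥0 := ⟨|L| + 2, by positivity⟩ with hM
  have hML : L ≤ (M : ℝ) - 2 := by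
    change L ≤ |L| + 2 - 2
    linarith [le_abs_self L]
  let u (k : ℕ) : ℝ≥0 := M / ((k : ℝ≥0) + 1)
  have hu : Tendsto u atTop (𝓝 0) := by
    have h1 : Tendsto (fun k : ℕ => (M : ℝ) / ((k : ℝ) + 1)) atTop (𝓝 0) :=
      tendsto_const_nhds.div_atTop
        (tendsto_atTop_add_const_right _ 1 tendsto_natCast_atTop_atTop)
    rw [← NNReal.tendsto_coe]
    simpa [u] using h1
  have hcomp (k : ℕ) : IsCompact ((K ×ˢ K) ×ˢ C k) := (hK.prod hK).prod (hC k)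
  refine ⟨{R | ∀ k, R ((K ×ˢ K) ×ˢ C k)ᶜ ≤ u k},
    isCompact_setOfPred_probabilityMeasure_mass_eq_compl_isCompact_le hu hcomp
      (Or.inl inferInstance), ?_⟩
  intro s hs
  refine Eventually.of_forall fun n => ?_
  have hN : (0 : ℝ) < ((n + 1 : ℕ) : ℝ) := by positivity
  have hsub : {w : Fin (n + 1) → (X × X) × Y | empiricalMeasure (n + 1) w ∈
      {R : ProbabilityMeasure ((X × X) × Y) | ∀ k, R ((K ×ˢ K) ×ˢ C k)ᶜ ≤ u k}ᶜ} ⊆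
      {w | ∃ i, (w i).1 ∉ K ×ˢ K} ∪
      {w | ENNReal.ofReal (Real.exp ((n + 1 : ℕ) * M)) ≤ ∏ i, g (w i).2} := by
    intro w hw
    by_cases hwK : ∃ i, (w i).1 ∉ K ×ˢ K
    · exact Or.inl hwK
    right
    push Not at hwK
    simp only [mem_ofPred_eq, mem_compl_iff, not_forall, not_le] at hw ⊢
    obtain ⟨k, hk⟩ := hw
    classical
    have h1 : (empiricalMeasure (n + 1) w : Measure ((X × X) × Y)) ((K ×ˢ K) ×ˢ C k)ᶜ
        = ((n + 1 : ℕ) : ℝ≥0∞)⁻¹ * ((Finset.univ.filter fun i => (w i).2 ∉ C k).card : ℝ≥0∞) := by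
      rw [empiricalMeasure_apply _ _ (hcomp k).measurableSet.compl, Finset.card_filter]
      push_cast
      congr 1
      refine Finset.sum_congr rfl fun i _ => ?_
      by_cases hi : (w i).2 ∈ C k
      · rw [indicator_of_notMem, if_neg (not_not.2 hi)]
        exact fun h => h ⟨hwK i, hi⟩
      · rw [indicator_of_mem, if_pos hi]
        · rfl
        · exact fun h => hi h.2
    have h2 : (u k : ℝ) * (n + 1 : ℕ) <
        ((Finset.univ.filter fun i => (w i).2 ∉ C k).card : ℝ) := by
      have h3 : ((u k : ℝ≥0∞)) <
          (empiricalMeasure (n + 1) w : Measure ((X × X) × Y)) ((K ×ˢ K) ×ˢ C k)ᶜ := by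
        rw [← ProbabilityMeasure.ennreal_coeFn_eq_coeFn_toMeasure]
        exact_mod_cast hk
      rw [h1, ← ENNReal.toReal_lt_toReal ENNReal.coe_ne_top
        (ENNReal.mul_ne_top (by simp) (by simp))] at h3
      simp only [ENNReal.coe_toReal, ENNReal.toReal_mul, ENNReal.toReal_inv,
        ENNReal.toReal_natCast] at h3
      rwa [lt_inv_mul_iff₀ hN, mul_comm] at h3
    have h4 : ((n + 1 : ℕ) : ℝ) * M ≤
        ((Finset.univ.filter fun i => (w i).2 ∉ C k).card : ℝ) * ((k : ℝ) + 1) := by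
      have h5 : (u k : ℝ) = M / ((k : ℝ) + 1) := by simp [u]
      rw [h5, div_mul_eq_mul_div, div_lt_iff₀ (by positivity)] at h2
      linarith
    calc ENNReal.ofReal (Real.exp ((n + 1 : ℕ) * M))
        ≤ ENNReal.ofReal (Real.exp
          (((Finset.univ.filter fun i => (w i).2 ∉ C k).card : ℝ) * ((k : ℝ) + 1))) :=
          ENNReal.ofReal_le_ofReal (Real.exp_le_exp.2 h4)
      _ = ∏ i ∈ Finset.univ.filter fun i => (w i).2 ∉ C k,
            ENNReal.ofReal (Real.exp ((k : ℝ) + 1)) := by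
          rw [Finset.prod_const, ← ENNReal.ofReal_pow (Real.exp_nonneg _), ← Real.exp_nat_mul]
      _ ≤ ∏ i ∈ Finset.univ.filter fun i => (w i).2 ∉ C k, g (w i).2 :=
          Finset.prod_le_prod' fun i hi => hgC k _ (Finset.mem_filter.1 hi).2
      _ ≤ ∏ i, g (w i).2 :=
          Finset.prod_le_prod_of_subset_of_one_le' (Finset.subset_univ _) fun i _ _ => hg1 _
  have h6 : ∫⁻ w, ∏ i, g (w i).2 ∂(pairSampleMeasure m b (n + 1)) ≤ 3 ^ (n + 1) := by
    rw [lintegral_pairSampleMeasure_prod (g := fun q : (X × X) × Y => g q.2)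
      (hgm.comp measurable_snd)]
    simp only [Finset.prod_const, Finset.card_univ, Fintype.card_fin, factorial_inv_mul_sum_const,
      lintegral_const, measure_univ, mul_one]
    gcongr
  have hpm : Measurable fun w : Fin (n + 1) → (X × X) × Y => ∏ i, g (w i).2 :=
    Finset.measurable_fun_prod _ fun i _ =>
      hgm.comp (measurable_snd.comp (measurable_pi_apply i))
  have h7 := (mul_meas_ge_le_lintegral₀ (μ := pairSampleMeasure m b (n + 1)) hpm.aemeasurable
    (ENNReal.ofReal (Real.exp ((n + 1 : ℕ) * M)))).trans h6
  refine (measure_mono hsub).trans ((measure_union_le _ _).trans ?_)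
  rw [pairSampleMeasure_exists_notMem hK hmK, zero_add]
  rw [mul_comm, ← ENNReal.le_div_iff_mul_le (Or.inl (by simp [Real.exp_pos]))
    (Or.inl ENNReal.ofReal_ne_top)] at h7
  refine h7.trans ?_
  have h8 : (3 : ℝ≥0∞) ^ (n + 1) ≤ ENNReal.ofReal (Real.exp ((n + 1 : ℕ) * 2)) := by
    rw [Real.exp_nat_mul, ENNReal.ofReal_pow (Real.exp_nonneg _)]
    gcongr
    have : (3 : ℝ) ≤ Real.exp 2 := by
      have := Real.add_one_le_exp (2 : ℝ); linarith
    simpa using ENNReal.ofReal_le_ofReal this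
  refine (ENNReal.div_le_div_right h8 _).trans ?_
  rw [← ENNReal.ofReal_div_of_pos (Real.exp_pos _), ← Real.exp_sub]
  refine ENNReal.ofReal_le_ofReal (Real.exp_le_exp.2 ?_)
  push_cast at hN ⊢
  nlinarith

end Tightness

/-! ### Finite partitions and weak neighbourhoods. -/

/-- A probability measure on a separable metric space is carried, up to small mass, by finitely many
small cells of a measurable partition. -/
theorem exists_measurable_partition {X : Type*} [MetricSpace X] [SecondCountableTopology X]
    [MeasurableSpace X] [BorelSpace X] (μ : Measure X) [IsProbabilityMeasure μ] {η : ℝ}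
    (hη : 0 < η) :
    ∃ (n : ℕ) (f : X → Fin (n + 1)), Measurable f ∧
      μ (f ⁻¹' {Fin.last n}) ≤ ENNReal.ofReal η ∧
      ∀ x y, f x = f y → f x ≠ Fin.last n → dist x y < η := by
  classical
  have : Nonempty X := nonempty_of_isProbabilityMeasure μ
  let D := TopologicalSpace.denseSeq X
  have hex (x : X) : ∃ j, dist x (D j) < η / 2 := by
    obtain ⟨_, hj, ⟨j, rfl⟩⟩ := Metric.dense_iff.1 (TopologicalSpace.denseRange_denseSeq X) x
      (η / 2) (half_pos hη)
    exact ⟨j, by rw [dist_comm]; exact hj⟩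
  let h (x : X) : ℕ := Nat.find (hex x)
  have hm : Measurable h := measurable_find hex fun j =>
    (isOpen_lt (by fun_prop) continuous_const).measurableSet
  have hlim : Tendsto (fun n : ℕ => μ (h ⁻¹' Ici n)) atTop (𝓝 0) := by
    have h1 := tendsto_measure_iInter_atTop (μ := μ) (s := fun n : ℕ => h ⁻¹' Ici n)
      (fun n => (hm measurableSet_Ici).nullMeasurableSet)
      (fun i j hij => preimage_mono (Ici_subset_Ici.2 hij)) ⟨0, measure_ne_top _ _⟩
    have h2 : ⋂ n : ℕ, h ⁻¹' Ici n = ∅ := by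
      ext x
      simp only [mem_iInter, mem_preimage, mem_Ici, mem_empty_iff_false, iff_false, not_forall,
        not_le]
      exact ⟨h x + 1, Nat.lt_succ_self _⟩
    rwa [h2, measure_empty] at h1
  obtain ⟨n, hn⟩ := (hlim.eventually (ge_mem_nhds (ENNReal.ofReal_pos.2 hη))).exists
  -- The last cell gathers every point far from the first `n` dense points: it may be wide, but its
  -- mass is small.
  let trunc (j : ℕ) : Fin (n + 1) := ⟨min j n, Nat.lt_succ_of_le (min_le_right _ _)⟩
  refine ⟨n, fun x => trunc (h x), (measurable_from_top (f := trunc)).comp hm, ?_, ?_⟩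
  · refine (measure_mono fun x hx => ?_).trans hn
    have : min (h x) n = n := congrArg Fin.val hx
    exact min_eq_right_iff.1 this
  · intro x y hxy hx
    have h1 : min (h x) n = min (h y) n := congrArg Fin.val hxy
    have h2 : min (h x) n ≠ n := fun h => hx (Fin.ext h)
    have h3 : h x = h y := by omega
    have h4 : dist x (D (h x)) < η / 2 := Nat.find_spec (hex x)
    have h5 : dist y (D (h y)) < η / 2 := Nat.find_spec (hex y)
    rw [← h3, dist_comm] at h5
    linarith [dist_triangle x (D (h x)) y]

/-- The cell of a labelled pair. -/
def cellMap {X Y A V : Type*} (f : X → A) (g : Y → V) (q : (X × X) × Y) : (A × A) × V :=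
  ((f q.1.1, f q.1.2), g q.2)

theorem measurable_cellMap {X Y A V : Type*} [MeasurableSpace X] [MeasurableSpace Y]
    [MeasurableSpace A] [MeasurableSpace V] {f : X → A} {g : Y → V} (hf : Measurable f)
    (hg : Measurable g) : Measurable (cellMap f g) := by
  unfold cellMap; fun_prop

/-- Weak neighbourhoods contain sets given by the masses of the cells of a finite partition. -/
theorem exists_cells {X Y : Type*} [MetricSpace X] [SecondCountableTopology X] [MeasurableSpace X]
    [BorelSpace X] [MetricSpace Y] [SecondCountableTopology Y] [MeasurableSpace Y] [BorelSpace Y]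
    (R : ProbabilityMeasure ((X × X) × Y))
    (hR : (R : Measure ((X × X) × Y)).fst.fst = (R : Measure ((X × X) × Y)).fst.snd)
    {U : Set (ProbabilityMeasure ((X × X) × Y))} (hU : IsOpen U) (hRU : R ∈ U) :
    ∃ (n k : ℕ) (f : X → Fin (n + 1)) (g : Y → Fin (k + 1)) (η : ℝ), Measurable f ∧ Measurable g ∧
      0 < η ∧ ∀ R' : ProbabilityMeasure ((X × X) × Y),
        (∀ T : Set ((Fin (n + 1) × Fin (n + 1)) × Fin (k + 1)),
          (R : Measure ((X × X) × Y)) (cellMap f g ⁻¹' T) ≤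
            (R' : Measure ((X × X) × Y)) (cellMap f g ⁻¹' T) + ENNReal.ofReal η) → R' ∈ U := by
  have hU' := hU.preimage (LevyProkhorov.probabilityMeasureHomeomorph
    (Ω := (X × X) × Y)).symm.continuous
  obtain ⟨ε, hε, hball⟩ := Metric.isOpen_iff.1 hU' (LevyProkhorov.ofMeasure R) hRU
  -- The Lévy–Prokhorov budget ε / 2 is spent in four shares: the exceptional cells of the first
  -- point, of the second point and of the label, and the discrepancy of cell masses.
  have hη : 0 < ε / 8 := by positivity
  obtain ⟨n, f, hf, hfm, hfd⟩ :=
    exists_measurable_partition (R : Measure ((X × X) × Y)).fst.fst hη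
  obtain ⟨k, g, hg, hgm, hgd⟩ := exists_measurable_partition (R : Measure ((X × X) × Y)).snd hη
  refine ⟨n, k, f, g, ε / 8, hf, hg, hη, fun R' hR' => ?_⟩
  suffices h : levyProkhorovDist (R : Measure ((X × X) × Y)) R' ≤ ε / 2 by
    have : LevyProkhorov.ofMeasure R' ∈ Metric.ball (LevyProkhorov.ofMeasure R) ε := by
      rw [Metric.mem_ball, dist_comm]
      exact lt_of_le_of_lt h (by linarith)
    exact hball this
  refine levyProkhorovDist_le_of_forall_le _ _ (by positivity) fun δ B hδ hB => ?_
  let S : Set ((Fin (n + 1) × Fin (n + 1)) × Fin (k + 1)) :=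
    {κ | κ.1.1 = Fin.last n ∨ κ.1.2 = Fin.last n ∨ κ.2 = Fin.last k}
  let T : Set ((Fin (n + 1) × Fin (n + 1)) × Fin (k + 1)) :=
    {κ | κ ∉ S ∧ ∃ q ∈ B, cellMap f g q = κ}
  have h1 : B ⊆ cellMap f g ⁻¹' S ∪ cellMap f g ⁻¹' T := by
    intro q hq
    by_cases h : cellMap f g q ∈ S
    · exact Or.inl h
    · exact Or.inr ⟨h, q, hq, rfl⟩
  have h2 : cellMap f g ⁻¹' T ⊆ Metric.thickening δ B := by
    rintro q ⟨hqS, q', hq', he⟩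
    rw [Metric.mem_thickening_iff]
    refine ⟨q', hq', ?_⟩
    simp only [S, mem_ofPred_eq, not_or, cellMap] at hqS
    simp only [cellMap, Prod.mk.injEq] at he
    have d1 := hfd q.1.1 q'.1.1 he.1.1.symm hqS.1
    have d2 := hfd q.1.2 q'.1.2 he.1.2.symm hqS.2.1
    have d3 := hgd q.2 q'.2 he.2.symm hqS.2.2
    rw [Prod.dist_eq, Prod.dist_eq]
    exact max_lt (max_lt (by linarith) (by linarith)) (by linarith)
  have h3 : (R : Measure ((X × X) × Y)) (cellMap f g ⁻¹' S) ≤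
      ENNReal.ofReal (ε / 8) + (ENNReal.ofReal (ε / 8) + ENNReal.ofReal (ε / 8)) := by
    have e1 : (R : Measure ((X × X) × Y)).fst.fst (f ⁻¹' {Fin.last n})
        = (R : Measure ((X × X) × Y)) {q | f q.1.1 = Fin.last n} := by
      rw [Measure.fst_apply (hf (measurableSet_singleton _)),
        Measure.fst_apply (measurable_fst (hf (measurableSet_singleton _)))]
      rfl
    -- Equality of the marginals lets a single partition of `X` serve both points.
    have e2 : (R : Measure ((X × X) × Y)).fst.fst (f ⁻¹' {Fin.last n})
        = (R : Measure ((X × X) × Y)) {q | f q.1.2 = Fin.last n} := by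
      rw [hR, Measure.snd_apply (hf (measurableSet_singleton _)),
        Measure.fst_apply (measurable_snd (hf (measurableSet_singleton _)))]
      rfl
    have e3 : (R : Measure ((X × X) × Y)).snd (g ⁻¹' {Fin.last k})
        = (R : Measure ((X × X) × Y)) {q | g q.2 = Fin.last k} := by
      rw [Measure.snd_apply (hg (measurableSet_singleton _))]
      rfl
    have hsub : cellMap f g ⁻¹' S ⊆ {q | f q.1.1 = Fin.last n} ∪
        ({q | f q.1.2 = Fin.last n} ∪ {q | g q.2 = Fin.last k}) := fun q hq => hq
    refine (measure_mono hsub).trans ((measure_union_le _ _).trans (add_le_add (e1 ▸ hfm) ?_))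
    exact (measure_union_le _ _).trans (add_le_add (e2 ▸ hfm) (e3 ▸ hgm))
  calc (R : Measure ((X × X) × Y)) B
      ≤ (R : Measure ((X × X) × Y)) (cellMap f g ⁻¹' S) +
        (R : Measure ((X × X) × Y)) (cellMap f g ⁻¹' T) :=
        (measure_mono h1).trans (measure_union_le _ _)
    _ ≤ (ENNReal.ofReal (ε / 8) + (ENNReal.ofReal (ε / 8) + ENNReal.ofReal (ε / 8))) +
        ((R' : Measure ((X × X) × Y)) (Metric.thickening δ B) + ENNReal.ofReal (ε / 8)) :=
        add_le_add h3 ((hR' T).trans (add_le_add (measure_mono h2) le_rfl))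
    _ = (R' : Measure ((X × X) × Y)) (Metric.thickening δ B) + ENNReal.ofReal (ε / 2) := by
        have : ENNReal.ofReal (ε / 2) = ENNReal.ofReal (ε / 8) + (ENNReal.ofReal (ε / 8) +
            ENNReal.ofReal (ε / 8)) + ENNReal.ofReal (ε / 8) := by
          rw [← ENNReal.ofReal_add hη.le hη.le, ← ENNReal.ofReal_add hη.le (by positivity),
            ← ENNReal.ofReal_add (by positivity) hη.le]
          congr 1
          ring
        rw [this]
        ring
    _ ≤ (R' : Measure ((X × X) × Y)) (Metric.thickening δ B) + ENNReal.ofReal δ := by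
        gcongr

/-! ### Counting permutations that realise a word of cells. -/

section Counting

variable {X Y A V : Type*} [MeasurableSpace X] [MeasurableSpace Y]
  [Fintype A] [DecidableEq A] [MeasurableSpace A] [MeasurableSingletonClass A]
  [Fintype V] [DecidableEq V] [MeasurableSpace V] [MeasurableSingletonClass V]

/-- The permutations carrying `w` to `u` are either none or a coset of the stabiliser of `w`, whose
order is the product of the factorials. -/
theorem card_perm_comp_eq_le {N : ℕ} {ι : Type*} [Fintype ι] [DecidableEq ι] (w u : Fin N → ι) :
    Fintype.card {π : Equiv.Perm (Fin N) // w ∘ π = u} ≤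
      ∏ i, (Fintype.card {a // w a = i}).factorial := by
  rw [← DomMulAct.stabilizer_card w]
  by_cases h : Nonempty {π : Equiv.Perm (Fin N) // w ∘ π = u}
  · obtain ⟨π₀, h₀⟩ := h
    refine Fintype.card_le_of_injective (fun π => ⟨π.1 * π₀⁻¹, ?_⟩) fun π π' h => ?_
    · funext a
      have h1 := congrFun π.2 (π₀⁻¹ a)
      have h2 := congrFun h₀ (π₀⁻¹ a)
      have e : π₀ (π₀⁻¹ a) = a := π₀.apply_symm_apply a
      simp only [Function.comp_apply, e] at h1 h2
      simp only [Function.comp_apply, Equiv.Perm.coe_mul]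
      rw [h1, h2]
    · exact Subtype.ext (mul_right_cancel (congrArg Subtype.val h))
  · rw [not_nonempty_iff] at h
    rw [Fintype.card_eq_zero]
    exact Nat.zero_le _

/-- The probability that the cells of the pair sample are an arrangement of a given word. -/
theorem le_pairSampleMeasure_arrangements {m : Measure X} {b : Measure Y} [IsProbabilityMeasure m]
    [IsProbabilityMeasure b] {f : X → A} {g : Y → V} (hf : Measurable f) (hg : Measurable g)
    {N : ℕ} (w : Fin N → (A × A) × V) (τ : Equiv.Perm (Fin N))
    (hτ : ∀ i, (w i).1.2 = (w (τ i)).1.1) :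
    (∏ i, m (f ⁻¹' {(w i).1.2}) * b (g ⁻¹' {(w i).2})) *
        ((∏ a, (Fintype.card {i // (w i).1.1 = a}).factorial : ℕ) : ℝ≥0∞) ≤
      ((∏ κ, (Fintype.card {i // w i = κ}).factorial : ℕ) : ℝ≥0∞) *
        pairSampleMeasure m b N {W | ∃ π : Equiv.Perm (Fin N), w ∘ π = cellMap f g ∘ W} := by
  classical
  set μ := (Measure.pi fun _ : Fin N => m).prod (Measure.pi fun _ : Fin N => b) with hμ
  set w₁ : Fin N → A := fun i => (w i).1.1 with hw₁
  set c := ∏ i, m (f ⁻¹' {(w i).1.2}) * b (g ⁻¹' {(w i).2}) with hc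
  have hcell := measurable_cellMap hf hg
  have hS : MeasurableSet {W : Fin N → (X × X) × Y |
      ∃ π : Equiv.Perm (Fin N), w ∘ π = cellMap f g ∘ W} := by
    have h1 : Measurable fun W : Fin N → (X × X) × Y => cellMap f g ∘ W :=
      measurable_pi_lambda _ fun i => hcell.comp (measurable_pi_apply i)
    exact h1 (toFinite {u | ∃ π : Equiv.Perm (Fin N), w ∘ π = u}).measurableSet
  -- Double count of the pairs (σ, π) for which the sample along σ spells `w ∘ π`: each spelled word
  -- is hit by a bounded number of π, and each π admits many compatible σ.
  let G (σ π : Equiv.Perm (Fin N)) : Set ((Fin N → X) × (Fin N → Y)) :=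
    {p | w ∘ π = cellMap f g ∘ pairSample σ p}
  have hG (σ π : Equiv.Perm (Fin N)) : MeasurableSet (G σ π) := by
    have h1 : Measurable fun p : (Fin N → X) × (Fin N → Y) => cellMap f g ∘ pairSample σ p :=
      measurable_pi_lambda _ fun i =>
        hcell.comp ((measurable_pi_apply i).comp (measurable_pairSample σ))
    exact h1 (toFinite {u | w ∘ π = u}).measurableSet
  have hle (σ : Equiv.Perm (Fin N)) : ∑ π, μ (G σ π) ≤
      ((∏ κ, (Fintype.card {i // w i = κ}).factorial : ℕ) : ℝ≥0∞) *
        μ (pairSample σ ⁻¹' {W | ∃ π : Equiv.Perm (Fin N), w ∘ π = cellMap f g ∘ W}) := by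
    simp only [← lintegral_indicator_one (hG σ _)]
    rw [← lintegral_indicator_one (measurable_pairSample σ hS), ← lintegral_finsetSum _
      fun π _ => measurable_one.indicator (hG σ π), ← lintegral_const_mul _
      (measurable_one.indicator (measurable_pairSample σ hS))]
    refine lintegral_mono fun p => ?_
    simp only [indicator_apply, Pi.one_apply]
    by_cases h : ∃ π : Equiv.Perm (Fin N), w ∘ π = cellMap f g ∘ pairSample σ p
    · rw [if_pos (by exact h), mul_one]
      have h1 := card_perm_comp_eq_le w (cellMap f g ∘ pairSample σ p)
      rw [Fintype.card_subtype, Finset.card_filter] at h1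
      exact_mod_cast h1
    · push Not at h
      refine (Finset.sum_eq_zero fun π _ => if_neg ?_).trans_le zero_le
      exact h π
  -- If σ is compatible with `w ∘ π`, it suffices to put each point in the cell of its first letter
  -- and each label in its cell. Reindexing by π and τ turns the product over first letters into one
  -- over second letters.
  have hge (σ π : Equiv.Perm (Fin N)) (h : ∀ i, (w (π i)).1.2 = (w (π (σ i))).1.1) :
      c ≤ μ (G σ π) := by
    have hsub : (univ.pi fun i => f ⁻¹' {(w (π i)).1.1}) ×ˢ (univ.pi fun i => g ⁻¹' {(w (π i)).2})
        ⊆ G σ π := by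
      rintro p ⟨h1, h2⟩
      simp only [Set.mem_pi, mem_univ, mem_preimage, mem_singleton_iff, forall_const] at h1 h2
      funext i
      simp only [Function.comp_apply, cellMap, pairSample]
      rw [h1, h1, h2, ← h]
    refine le_trans (le_of_eq ?_) (measure_mono hsub)
    rw [hμ, Measure.prod_prod, Measure.pi_pi, Measure.pi_pi, hc, Finset.prod_mul_distrib]
    congr 1
    · rw [Equiv.prod_comp π fun i => m (f ⁻¹' {(w i).1.1})]
      simp only [hτ]
      rw [Equiv.prod_comp τ fun i => m (f ⁻¹' {(w i).1.1})]
    · rw [Equiv.prod_comp π fun i => b (g ⁻¹' {(w i).2})]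
  have hsum (π : Equiv.Perm (Fin N)) :
      c * ((∏ a, (Fintype.card {i // w₁ i = a}).factorial : ℕ) : ℝ≥0∞) ≤ ∑ σ, μ (G σ π) := by
    rw [← DomMulAct.stabilizer_card w₁, Fintype.card_subtype, Finset.card_filter]
    push_cast
    -- The compatible σ are obtained as π⁻¹ s τ π with s in the stabiliser of the word of first
    -- letters.
    rw [Finset.mul_sum, ← Equiv.sum_comp
      ((Equiv.mulLeft π⁻¹).trans (Equiv.mulRight (τ * π))) fun σ => μ (G σ π)]
    refine Finset.sum_le_sum fun s _ => ?_
    split_ifs with hs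
    · rw [mul_one]
      refine hge _ _ fun i => ?_
      have h1 := congrFun hs (τ (π i))
      simp only [Function.comp_apply, hw₁] at h1
      have e (x : Fin N) : π (π⁻¹ x) = x := π.apply_symm_apply x
      change _ = (w (π (π⁻¹ (s (τ (π i)))))).1.1
      rw [e, hτ, ← h1]
    · rw [mul_zero]; exact zero_le
  rw [pairSampleMeasure_apply hS, mul_left_comm, Finset.mul_sum]
  calc c * ((∏ a, (Fintype.card {i // w₁ i = a}).factorial : ℕ) : ℝ≥0∞)
      = (N.factorial : ℝ≥0∞)⁻¹ * ∑ _π : Equiv.Perm (Fin N),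
          c * ((∏ a, (Fintype.card {i // w₁ i = a}).factorial : ℕ) : ℝ≥0∞) :=
        (factorial_inv_mul_sum_const N _).symm
    _ ≤ (N.factorial : ℝ≥0∞)⁻¹ * ∑ π : Equiv.Perm (Fin N), ∑ σ, μ (G σ π) :=
        mul_le_mul_right (Finset.sum_le_sum fun π _ => hsum π) _
    _ ≤ _ := by
        rw [Finset.sum_comm]
        exact mul_le_mul_right (Finset.sum_le_sum fun σ _ => hle σ) _

end Counting

/-! ### Words with balanced marginals approximating a probability vector. -/

/-- A discrete coupling, pairing the elements off arbitrarily. It fills the gaps left in a word by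
rounding its counts down. -/
theorem Multiset.exists_map_fst_snd {A B : Type*} (s : Multiset A) (t : Multiset B)
    (h : s.card = t.card) : ∃ u : Multiset (A × B), u.map Prod.fst = s ∧ u.map Prod.snd = t := by
  induction s using Multiset.induction_on generalizing t with
  | empty => exact ⟨0, by simp, by simpa using (Multiset.card_eq_zero.1 (by simpa using h.symm)).symm⟩
  | cons a s ih =>
    rw [Multiset.card_cons] at h
    obtain ⟨b, hb⟩ := Multiset.card_pos_iff_exists_mem.1 (by omega : 0 < t.card)
    obtain ⟨t', rfl⟩ := Multiset.exists_cons_of_mem hb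
    rw [Multiset.card_cons] at h
    obtain ⟨u, hu1, hu2⟩ := ih t' (by omega)
    exact ⟨(a, b) ::ₘ u, by simp [hu1], by simp [hu2]⟩

theorem Multiset.exists_fin_map_eq {ι : Type*} {N : ℕ} (M : Multiset ι) (h : M.card = N) :
    ∃ w : Fin N → ι, (Finset.univ : Finset (Fin N)).val.map w = M := by
  obtain ⟨l, rfl⟩ : ∃ l : List ι, (l : Multiset ι) = M := Quot.exists_rep M
  subst h
  exact ⟨l.get, (Fin.univ_val_map l.get).trans (congrArg _ (List.ofFn_get l))⟩

theorem card_fiber_eq_count {α ι : Type*} [Fintype α] [DecidableEq ι] (f : α → ι) (i : ι) :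
    Fintype.card {a // f a = i} = ((Finset.univ : Finset α).val.map f).count i := by
  rw [Multiset.count_map, Fintype.card_subtype, Finset.card_def, Finset.filter_val]
  simp only [eq_comm]

/-- A probability vector on labelled pairs with equal marginals is approximated, with bounded error
in the counts, by words whose two marginal types agree. -/
theorem exists_word {A V : Type*} [Fintype A] [DecidableEq A] [Fintype V] [DecidableEq V]
    {q : (A × A) × V → ℝ} (hq0 : ∀ κ, 0 ≤ q κ) (hq1 : ∑ κ, q κ = 1)
    (hmarg : ∀ a, ∑ κ with κ.1.1 = a, q κ = ∑ κ with κ.1.2 = a, q κ) (N : ℕ) :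
    ∃ (w : Fin N → (A × A) × V) (τ : Equiv.Perm (Fin N)), (∀ i, (w i).1.2 = (w (τ i)).1.1) ∧
      (∀ κ, |(Fintype.card {i // w i = κ} : ℝ) - N * q κ| ≤ Fintype.card ((A × A) × V) + 1) ∧
      ∀ i, (∃ κ, 0 < q κ ∧ κ.1.2 = (w i).1.2) ∧ ∃ κ, 0 < q κ ∧ κ.2 = (w i).2 := by
  obtain ⟨κ₀, -, hκ₀⟩ := Finset.exists_ne_zero_of_sum_ne_zero (hq1.trans_ne one_ne_zero)
  have hκ₀ : 0 < q κ₀ := lt_of_le_of_ne (hq0 _) (Ne.symm hκ₀)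
  set c : (A × A) × V → ℕ := fun κ => ⌊N * q κ⌋₊ with hc
  set p : A → ℝ := fun a => ∑ κ with κ.1.2 = a, q κ with hp
  have hp0 (a : A) : 0 ≤ p a := Finset.sum_nonneg fun κ _ => hq0 κ
  have hp1 : ∑ a, p a = 1 := by rw [← hq1]; exact Finset.sum_fiberwise _ _ _
  have hpos {a : A} (ha : 0 < p a) : ∃ κ, 0 < q κ ∧ κ.1.2 = a := by
    obtain ⟨κ, hκ, h⟩ := Finset.exists_ne_zero_of_sum_ne_zero ha.ne'
    exact ⟨κ, lt_of_le_of_ne (hq0 _) (Ne.symm h), (Finset.mem_filter.1 hκ).2⟩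
  have hfloor {x : ℝ} (hx : 0 ≤ x) : ((⌊N * x⌋₊ : ℕ) : ℝ) ≤ N * x := Nat.floor_le (by positivity)
  have hpN : ∑ a, ⌊N * p a⌋₊ ≤ N := by
    have : ((∑ a, ⌊N * p a⌋₊ : ℕ) : ℝ) ≤ N := by
      push_cast
      refine (Finset.sum_le_sum fun a _ => hfloor (hp0 a)).trans_eq ?_
      rw [← Finset.mul_sum, hp1, mul_one]
    exact_mod_cast this
  set M₀ : Multiset ((A × A) × V) := ∑ κ, c κ • {κ} with hM₀
  -- The common marginal to be reached: rounded-down counts, topped up to `N` letters with a letter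
  -- of positive mass.
  set T : Multiset A := ∑ a, ⌊N * p a⌋₊ • {a} + (N - ∑ a, ⌊N * p a⌋₊) • {κ₀.1.2} with hT
  have hcM (κ : (A × A) × V) : M₀.count κ = c κ := by
    simp [hM₀, Multiset.count_sum', Multiset.count_singleton]
  have hTcard : T.card = N := by
    simp only [hT, Multiset.card_add, Multiset.card_sum, Multiset.card_nsmul,
      Multiset.card_singleton, mul_one]
    omega
  have hTc (a : A) : ⌊N * p a⌋₊ ≤ T.count a := by
    simp [hT, Multiset.count_sum', Multiset.count_singleton]
  have hTmem {a : A} (ha : a ∈ T) : 0 < p a := by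
    rw [hT, Multiset.mem_add] at ha
    rcases ha with ha | ha
    · rw [Multiset.mem_sum] at ha
      obtain ⟨a', -, ha'⟩ := ha
      obtain ⟨h0, h1⟩ := Multiset.mem_nsmul.1 ha'
      rw [Multiset.mem_singleton] at h1
      subst h1
      by_contra! h
      exact h0 (Nat.floor_of_nonpos (mul_nonpos_of_nonneg_of_nonpos (Nat.cast_nonneg N) h))
    · have h1 := Multiset.mem_singleton.1 (Multiset.mem_of_mem_nsmul ha)
      subst h1
      refine hκ₀.trans_le (Finset.single_le_sum (f := q) (fun κ _ => hq0 κ) ?_)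
      simp
  -- A sum of integer parts is at most the integer part of the sum, so both marginals of `M₀` fit
  -- inside `T`.
  have hle (π : (A × A) × V → A) (hπ : ∀ a, ∑ κ with π κ = a, q κ = p a) : M₀.map π ≤ T := by
    rw [Multiset.le_iff_count]
    intro a
    refine le_trans ?_ (hTc a)
    have h1 : (M₀.map π).count a = ∑ κ with π κ = a, c κ := by
      rw [hM₀, ← Multiset.coe_mapAddMonoidHom, map_sum]
      simp only [Multiset.coe_mapAddMonoidHom, Multiset.map_nsmul, Multiset.map_singleton,
        Multiset.count_sum', Multiset.count_nsmul, Multiset.count_singleton, Finset.sum_filter,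
        mul_ite, mul_one, mul_zero, eq_comm]
    rw [h1]
    refine Nat.le_floor ?_
    push_cast
    rw [← hπ a, Finset.mul_sum]
    exact Finset.sum_le_sum fun κ _ => hfloor (hq0 κ)
  have hle1 := hle (fun κ => κ.1.1) hmarg
  have hle2 := hle (fun κ => κ.1.2) fun a => rfl
  obtain ⟨u, hu1, hu2⟩ := Multiset.exists_map_fst_snd (T - M₀.map fun κ => κ.1.1)
    (T - M₀.map fun κ => κ.1.2) (by
      rw [Multiset.card_sub hle1, Multiset.card_sub hle2, Multiset.card_map, Multiset.card_map])
  -- The added triples may themselves have `q`-mass zero. Their second letters and labels are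
  -- charged separately, and the lower bound needs no more.
  set M : Multiset ((A × A) × V) := M₀ + u.map fun e => (e, κ₀.2) with hM
  have hM1 : M.map (fun κ => κ.1.1) = T := by
    rw [hM, Multiset.map_add, Multiset.map_map]
    exact (congrArg _ hu1).trans (add_tsub_cancel_of_le hle1)
  have hM2 : M.map (fun κ => κ.1.2) = T := by
    rw [hM, Multiset.map_add, Multiset.map_map]
    exact (congrArg _ hu2).trans (add_tsub_cancel_of_le hle2)
  have hMcard : M.card = N := by rw [← hTcard, ← hM1, Multiset.card_map]
  obtain ⟨w, hw⟩ := Multiset.exists_fin_map_eq M hMcard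
  have hwM (i : Fin N) : w i ∈ M := by
    rw [← hw]; exact Multiset.mem_map_of_mem w (Finset.mem_univ_val i)
  obtain ⟨τ, hτ⟩ := exists_perm_comp_eq (f := fun i => (w i).1.1) (g := fun i => (w i).1.2)
    fun a => by
      rw [card_fiber_eq_count, card_fiber_eq_count, ← Function.comp_def (fun κ => κ.1.1) w,
        ← Function.comp_def (fun κ => κ.1.2) w, ← Multiset.map_map, ← Multiset.map_map, hw, hM1,
        hM2]
  refine ⟨w, τ, congrFun hτ, fun κ => ?_, fun i => ⟨?_, ?_⟩⟩
  · have h1 : Fintype.card {i // w i = κ} = c κ + (u.map fun e => (e, κ₀.2)).count κ := by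
      rw [card_fiber_eq_count, hw, hM, Multiset.count_add, hcM]
    have h2 : (u.map fun e => (e, κ₀.2)).count κ ≤ u.card :=
      (Multiset.count_le_card _ _).trans_eq (Multiset.card_map _ _)
    have h3 : M₀.card + u.card = N := by
      rw [← hMcard, hM, Multiset.card_add, Multiset.card_map]
    have h4 : M₀.card = ∑ κ, c κ := by
      simp [hM₀, Multiset.card_sum]
    have h5 : (N : ℝ) - Fintype.card ((A × A) × V) ≤ ∑ κ, (c κ : ℝ) := by
      have : ∑ κ : (A × A) × V, (N * q κ - 1) ≤ ∑ κ, (c κ : ℝ) :=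
        Finset.sum_le_sum fun κ _ => (Nat.sub_one_lt_floor _).le
      rw [Finset.sum_sub_distrib, ← Finset.mul_sum, hq1, mul_one] at this
      simpa using this
    -- Rounding down loses at most one triple per cell, which bounds the number of added triples.
    have h6 : (u.card : ℝ) ≤ Fintype.card ((A × A) × V) := by
      have : (M₀.card : ℝ) + u.card = N := by exact_mod_cast h3
      rw [h4] at this
      push_cast at this h5
      linarith
    have h7 : (((u.map fun e => (e, κ₀.2)).count κ : ℕ) : ℝ) ≤ u.card := by exact_mod_cast h2
    have h8 := hfloor (hq0 κ)
    have h9 : N * q κ - 1 < c κ := Nat.sub_one_lt_floor _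
    have h10 : (0 : ℝ) ≤ ((u.map fun e => (e, κ₀.2)).count κ : ℕ) := Nat.cast_nonneg _
    rw [h1, abs_le]
    push_cast
    constructor
    · have : (0 : ℝ) ≤ Fintype.card ((A × A) × V) := Nat.cast_nonneg _
      linarith
    · linarith
  · refine hpos (hTmem ?_)
    rw [← hM2]
    exact Multiset.mem_map_of_mem (fun κ : (A × A) × V => κ.1.2) (hwM i)
  · have h1 := hwM i
    rw [hM, Multiset.mem_add] at h1
    rcases h1 with h1 | h1
    · refine ⟨w i, ?_, rfl⟩
      have h2 : 0 < c (w i) := by rw [← hcM]; exact Multiset.count_pos.2 h1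
      by_contra! h
      exact h2.ne' (Nat.floor_of_nonpos (mul_nonpos_of_nonneg_of_nonpos (Nat.cast_nonneg N) h))
    · obtain ⟨e, -, he⟩ := Multiset.mem_map.1 h1
      exact ⟨κ₀, hκ₀, by rw [← he]⟩

/-! ### Stirling bounds and relative entropy on finite sets. -/

theorem mul_log_sub_le_log_factorial (n : ℕ) :
    n * Real.log n - n ≤ Real.log n.factorial := by
  rcases n.eq_zero_or_pos with rfl | hn
  · simp
  have h1 := Real.pow_div_factorial_le_exp (n : ℝ) (Nat.cast_nonneg n) n
  have hn' : (0 : ℝ) < n := Nat.cast_pos.2 hn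
  have hf : (0 : ℝ) < n.factorial := Nat.cast_pos.2 n.factorial_pos
  have h2 := Real.log_le_log (by positivity) h1
  rw [Real.log_exp, Real.log_div (by positivity) hf.ne', Real.log_pow] at h2
  linarith

/-- The Stirling sequence decreases, so it is bounded by its value at 1; at `n = 0` the convention
`Real.log 0 = 0` is used. -/
theorem log_factorial_le (n : ℕ) :
    Real.log n.factorial ≤ n * Real.log n - n + (1 + Real.log n) := by
  rcases n with _ | n
  · simp
  have hn' : (0 : ℝ) < (n + 1 : ℕ) := by positivity
  have h1 := Stirling.log_stirlingSeq_formula (n + 1)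
  have h2 := Stirling.log_stirlingSeq'_antitone (Nat.zero_le n)
  simp only [Function.comp_apply, Nat.succ_eq_add_one, zero_add, Stirling.stirlingSeq_one] at h2
  rw [Real.log_div (Real.exp_ne_zero _) (by positivity), Real.log_exp, Real.log_sqrt (by norm_num)]
    at h2
  rw [Real.log_div hn'.ne' (Real.exp_ne_zero _), Real.log_exp, Real.log_mul two_ne_zero hn'.ne']
    at h1
  have h3 : 0 ≤ Real.log (n + 1 : ℕ) := Real.log_natCast_nonneg _
  linarith

theorem toReal_klDiv_eq_sum {ι : Type*} [Fintype ι] [MeasurableSpace ι]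
    [MeasurableSingletonClass ι] {μ ν : Measure ι} [IsProbabilityMeasure μ]
    [IsProbabilityMeasure ν] (h : μ ≪ ν) :
    (klDiv μ ν).toReal = ∑ i, μ.real {i} * Real.log (μ.real {i} / ν.real {i}) := by
  rw [toReal_klDiv_of_measure_eq h (by simp), integral_fintype Integrable.of_finite]
  refine Finset.sum_congr rfl fun i _ => ?_
  rw [smul_eq_mul]
  by_cases hi : ν {i} = 0
  · simp [measureReal_def, h hi]
  · have h1 : μ.rnDeriv ν i * ν {i} = μ {i} := by
      rw [← Measure.setLIntegral_rnDeriv h, lintegral_singleton]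
    have h2 : μ.real {i} / ν.real {i} = (μ.rnDeriv ν i).toReal := by
      rw [measureReal_def, measureReal_def, ← h1, ENNReal.toReal_mul, mul_div_cancel_right₀]
      exact (ENNReal.toReal_pos hi (measure_ne_top _ _)).ne'
    rw [h2, llr]

theorem card_fiber_comp_eq_sum {α ι A : Type*} [Fintype α] [Fintype ι] [DecidableEq ι]
    [DecidableEq A] (w : α → ι) (π : ι → A) (a : A) :
    Fintype.card {i // π (w i) = a} = ∑ κ with π κ = a, Fintype.card {i // w i = κ} := by
  rw [Fintype.card_subtype, Finset.card_eq_sum_card_fiberwise (f := w)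
    (t := Finset.univ.filter fun κ => π κ = a) fun i hi => by simpa using hi]
  refine Finset.sum_congr rfl fun κ hκ => ?_
  rw [Fintype.card_subtype, Finset.filter_filter]
  congr 1
  ext i
  simp only [Finset.mem_filter, Finset.mem_univ, true_and] at hκ ⊢
  exact ⟨fun h => h.2, fun h => ⟨by rw [h, hκ], h⟩⟩

theorem sum_comp_eq_sum_card_fiber {α ι : Type*} [Fintype α] [Fintype ι] [DecidableEq ι]
    (w : α → ι) (l : ι → ℝ) :
    ∑ i, l (w i) = ∑ κ, (Fintype.card {i // w i = κ} : ℝ) * l κ := by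
  rw [← Finset.sum_fiberwise Finset.univ w]
  refine Finset.sum_congr rfl fun κ _ => ?_
  rw [Finset.sum_congr rfl fun i hi => by rw [(Finset.mem_filter.1 hi).2], Finset.sum_const,
    nsmul_eq_mul, Fintype.card_subtype]

theorem natCast_prod_factorial {ι : Type*} [Fintype ι] (n : ι → ℕ) :
    ((∏ i, (n i).factorial : ℕ) : ℝ≥0∞)
      = ENNReal.ofReal (Real.exp (∑ i, Real.log (n i).factorial)) := by
  rw [Real.exp_sum, ← ENNReal.ofReal_natCast]
  congr 1
  push_cast
  exact Finset.prod_congr rfl fun i _ => (Real.exp_log (by exact_mod_cast (n i).factorial_pos)).symm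

theorem mul_log_eq_mul_mul_log_div {N x : ℝ} (hN : 0 < N) :
    x * Real.log x = N * (x / N * Real.log (x / N)) + x * Real.log N := by
  rcases eq_or_ne x 0 with rfl | hx
  · simp
  · rw [Real.log_div hx hN.ne']
    field_simp
    ring

/-! ### The local lower bound. -/

section LowerBound

variable {X Y A V : Type*} [MeasurableSpace X] [MeasurableSpace Y]
  [Fintype A] [DecidableEq A] [MeasurableSpace A] [MeasurableSingletonClass A]
  [Fintype V] [DecidableEq V] [MeasurableSpace V] [MeasurableSingletonClass V]

/-- Stirling's bounds are put into the quotient of the factorials of first-letter counts by those of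
cell counts. Both families of counts sum to `N`, so the terms N log N - N cancel. What remains is
`N` times minus the relative entropy of ν to ν₁ ⊗ m ⊗ b on cells, up to a logarithmic error per
cell. -/
theorem exp_le_pairSampleMeasure_arrangements {m : Measure X} {b : Measure Y}
    [IsProbabilityMeasure m] [IsProbabilityMeasure b] {f : X → A} {g : Y → V} (hf : Measurable f)
    (hg : Measurable g) {N : ℕ} (hN : 0 < N) (w : Fin N → (A × A) × V) (τ : Equiv.Perm (Fin N))
    (hτ : ∀ i, (w i).1.2 = (w (τ i)).1.1)
    (hpos : ∀ i, 0 < m.real (f ⁻¹' {(w i).1.2}) ∧ 0 < b.real (g ⁻¹' {(w i).2}))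
    (ν : (A × A) × V → ℝ) (hν : ∀ κ, ν κ = Fintype.card {i // w i = κ} / N) :
    ENNReal.ofReal (Real.exp (N * (∑ a, (∑ κ with κ.1.1 = a, ν κ) *
        Real.log (∑ κ with κ.1.1 = a, ν κ) - ∑ κ, ν κ * Real.log (ν κ) +
        ∑ κ, ν κ * (Real.log (m.real (f ⁻¹' {κ.1.2})) + Real.log (b.real (g ⁻¹' {κ.2})))) -
        Fintype.card ((A × A) × V) * (1 + Real.log N))) ≤
      pairSampleMeasure m b N {W | ∃ π : Equiv.Perm (Fin N), w ∘ π = cellMap f g ∘ W} := by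
  have hN' : (0 : ℝ) < N := Nat.cast_pos.2 hN
  set l : (A × A) × V → ℝ := fun κ =>
    Real.log (m.real (f ⁻¹' {κ.1.2})) + Real.log (b.real (g ⁻¹' {κ.2})) with hl
  set n : (A × A) × V → ℕ := fun κ => Fintype.card {i // w i = κ} with hn
  set n₁ : A → ℕ := fun a => Fintype.card {i // (w i).1.1 = a} with hn₁
  have h := le_pairSampleMeasure_arrangements (m := m) (b := b) hf hg w τ hτ
  have e1 : ∏ i, m (f ⁻¹' {(w i).1.2}) * b (g ⁻¹' {(w i).2})
      = ENNReal.ofReal (Real.exp (∑ κ, n κ * l κ)) := by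
    rw [← sum_comp_eq_sum_card_fiber w l, Real.exp_sum,
      ENNReal.ofReal_prod_of_nonneg fun i _ => Real.exp_nonneg _]
    refine Finset.prod_congr rfl fun i _ => ?_
    rw [hl, Real.exp_add, Real.exp_log (hpos i).1, Real.exp_log (hpos i).2,
      ENNReal.ofReal_mul measureReal_nonneg, ofReal_measureReal, ofReal_measureReal]
  rw [e1, natCast_prod_factorial, natCast_prod_factorial,
    ← ENNReal.ofReal_mul (Real.exp_nonneg _), ← Real.exp_add] at h
  have hsum : ∑ κ, (n κ : ℝ) = N := by
    have := sum_comp_eq_sum_card_fiber w fun _ => (1 : ℝ)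
    simpa using this.symm
  have hsum₁ : ∑ a, (n₁ a : ℝ) = N := by
    have := sum_comp_eq_sum_card_fiber (fun i => (w i).1.1) fun _ => (1 : ℝ)
    simpa using this.symm
  have hnν (κ : (A × A) × V) : (n κ : ℝ) / N = ν κ := (hν κ).symm
  have hnν₁ (a : A) : (n₁ a : ℝ) / N = ∑ κ with κ.1.1 = a, ν κ := by
    have h0 : n₁ a = ∑ κ with κ.1.1 = a, n κ := card_fiber_comp_eq_sum w (fun κ => κ.1.1) a
    rw [h0]
    push_cast
    rw [Finset.sum_div]
    exact Finset.sum_congr rfl fun κ _ => hnν κ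
  have b1 : N * ∑ a, (∑ κ with κ.1.1 = a, ν κ) * Real.log (∑ κ with κ.1.1 = a, ν κ)
      + N * Real.log N - N ≤ ∑ a, Real.log (n₁ a).factorial := by
    refine le_trans (le_of_eq ?_) (Finset.sum_le_sum fun a _ => mul_log_sub_le_log_factorial (n₁ a))
    rw [Finset.sum_sub_distrib, hsum₁, Finset.sum_congr rfl fun a _ =>
      mul_log_eq_mul_mul_log_div (x := n₁ a) hN', Finset.sum_add_distrib, ← Finset.sum_mul, hsum₁,
      ← Finset.mul_sum]
    simp only [hnν₁]
  have b2 : ∑ κ, Real.log (n κ).factorial ≤ N * ∑ κ, ν κ * Real.log (ν κ) + N * Real.log N - N +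
      Fintype.card ((A × A) × V) * (1 + Real.log N) := by
    have hlog (κ : (A × A) × V) : Real.log (n κ) ≤ Real.log N := by
      have h1 : n κ ≤ N := (Fintype.card_subtype_le _).trans_eq (Fintype.card_fin N)
      rcases (n κ).eq_zero_or_pos with h0 | h0
      · rw [h0]; simpa using Real.log_natCast_nonneg N
      · exact Real.log_le_log (by exact_mod_cast h0) (by exact_mod_cast h1)
    refine (Finset.sum_le_sum fun κ _ => (log_factorial_le (n κ)).trans
      (add_le_add_right (add_le_add_right (hlog κ) 1) _)).trans (le_of_eq ?_)
    rw [Finset.sum_add_distrib, Finset.sum_sub_distrib, hsum, Finset.sum_congr rfl fun κ _ =>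
      mul_log_eq_mul_mul_log_div (x := n κ) hN', Finset.sum_add_distrib, ← Finset.sum_mul, hsum,
      ← Finset.mul_sum, Finset.sum_const, Finset.card_univ, nsmul_eq_mul]
    simp only [hnν]
  have b3 : ∑ κ, n κ * l κ = N * ∑ κ, ν κ * l κ := by
    rw [Finset.mul_sum]
    refine Finset.sum_congr rfl fun κ _ => ?_
    rw [← hnν]
    field_simp
  have h2 := ENNReal.div_le_of_le_mul' h
  refine le_trans ?_ h2
  rw [← ENNReal.ofReal_div_of_pos (Real.exp_pos _), ← Real.exp_sub]
  refine ENNReal.ofReal_le_ofReal (Real.exp_le_exp.2 ?_)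
  rw [b3]
  linarith

end LowerBound

/-- Relative entropy does not increase under the cell map, so the discretised law still has entropy
below `s`. It is approximated by words, whose arrangements have the required probability and whose
cell frequencies force the empirical measure into `U`. -/
theorem pairRate_local_lower_bound {X Y : Type*} [MetricSpace X] [SecondCountableTopology X]
    [MeasurableSpace X] [BorelSpace X] [MetricSpace Y] [SecondCountableTopology Y]
    [MeasurableSpace Y] [BorelSpace Y] {m : Measure X} {b : Measure Y} [IsProbabilityMeasure m]
    [IsProbabilityMeasure b] (R : ProbabilityMeasure ((X × X) × Y)) {s : ℝ}
    (hs : pairRate m b R < s) {U : Set (ProbabilityMeasure ((X × X) × Y))} (hU : IsOpen U)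
    (hRU : R ∈ U) :
    ∀ᶠ n : ℕ in atTop, ENNReal.ofReal (Real.exp (-s * (n + 1))) ≤
      pairSampleMeasure m b (n + 1) {w | empiricalMeasure (n + 1) w ∈ U} := by
  unfold pairRate at hs
  split_ifs at hs with hR
  swap
  · exact absurd hs (by simp)
  obtain ⟨i₀, j₀, f, g, η, hf, hg, hη, hcells⟩ := exists_cells R hR hU hRU
  set ν₀ := ((R : Measure ((X × X) × Y)).fst.fst.prod m).prod b with hν₀
  have hcell := measurable_cellMap hf hg
  set Q := (R : Measure ((X × X) × Y)).map (cellMap f g) with hQ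
  have : IsProbabilityMeasure Q := Measure.isProbabilityMeasure_map hcell.aemeasurable
  have : IsProbabilityMeasure (ν₀.map (cellMap f g)) :=
    Measure.isProbabilityMeasure_map hcell.aemeasurable
  have hfin : klDiv (R : Measure ((X × X) × Y)) ν₀ ≠ ∞ := by
    intro h
    rw [h] at hs
    exact absurd hs (by simp)
  have hkl := klDiv_map_le (R : Measure ((X × X) × Y)) ν₀ hcell
  have hac : Q ≪ ν₀.map (cellMap f g) := (klDiv_ne_top_iff.1 (ne_top_of_le_ne_top hfin hkl)).1
  have hs' : (klDiv Q (ν₀.map (cellMap f g))).toReal < s := by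
    refine (ENNReal.toReal_mono hfin hkl).trans_lt ?_
    rw [← EReal.coe_lt_coe_iff, EReal.coe_ennreal_toReal hfin]
    exact hs
  rw [toReal_klDiv_eq_sum hac] at hs'
  set q : (Fin (i₀ + 1) × Fin (i₀ + 1)) × Fin (j₀ + 1) → ℝ := fun κ => Q.real {κ} with hq
  have hq0 (κ) : 0 ≤ q κ := measureReal_nonneg
  have hq1 : ∑ κ, q κ = 1 := by
    have h := sum_measureReal_singleton (μ := Q) Finset.univ
    rwa [Finset.coe_univ, probReal_univ] at h
  have hp1 (a) : ∑ κ with κ.1.1 = a, q κ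
      = (R : Measure ((X × X) × Y)).fst.fst.real (f ⁻¹' {a}) := by
    rw [sum_measureReal_singleton, hQ, map_measureReal_apply hcell (Set.toFinite _).measurableSet,
      measureReal_def, measureReal_def, Measure.fst_apply (hf (measurableSet_singleton _)),
      Measure.fst_apply (measurable_fst (hf (measurableSet_singleton _)))]
    congr 2
    ext z
    simp [cellMap]
  have hp2 (a) : ∑ κ with κ.1.2 = a, q κ
      = (R : Measure ((X × X) × Y)).fst.fst.real (f ⁻¹' {a}) := by
    rw [sum_measureReal_singleton, hQ, map_measureReal_apply hcell (Set.toFinite _).measurableSet,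
      measureReal_def, measureReal_def, hR, Measure.snd_apply (hf (measurableSet_singleton _)),
      Measure.fst_apply (measurable_snd (hf (measurableSet_singleton _)))]
    congr 2
    ext z
    simp [cellMap]
  have hν (κ) : (ν₀.map (cellMap f g)).real {κ} = (∑ κ' with κ'.1.1 = κ.1.1, q κ') *
      m.real (f ⁻¹' {κ.1.2}) * b.real (g ⁻¹' {κ.2}) := by
    rw [hp1, map_measureReal_apply hcell (measurableSet_singleton _)]
    have : cellMap f g ⁻¹' {κ} = ((f ⁻¹' {κ.1.1}) ×ˢ (f ⁻¹' {κ.1.2})) ×ˢ (g ⁻¹' {κ.2}) := by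
      ext z
      simp [cellMap, Prod.ext_iff]
    rw [this, hν₀, measureReal_prod_prod, measureReal_prod_prod]
  have hqpos {κ} (hκ : 0 < q κ) : 0 < (∑ κ' with κ'.1.1 = κ.1.1, q κ') ∧
      0 < m.real (f ⁻¹' {κ.1.2}) ∧ 0 < b.real (g ⁻¹' {κ.2}) := by
    have h1 : (ν₀.map (cellMap f g)).real {κ} ≠ 0 := by
      intro h
      rw [measureReal_eq_zero_iff] at h
      exact hκ.ne' (by simp [hq, measureReal_def, hac h])
    rw [hν] at h1
    have h0 : 0 ≤ ∑ κ' with κ'.1.1 = κ.1.1, q κ' := Finset.sum_nonneg fun κ _ => hq0 κ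
    exact ⟨lt_of_le_of_ne h0 fun h => h1 (by simp [← h]),
      lt_of_le_of_ne measureReal_nonneg fun h => h1 (by simp [← h]),
      lt_of_le_of_ne measureReal_nonneg fun h => h1 (by simp [← h])⟩
  -- Minus the relative entropy, expanded so as to be continuous in ν also at the boundary: x log x
  -- is continuous and the logarithms of the reference masses are constants. Cells of reference mass
  -- zero get the harmless value `Real.log 0 = 0`, since `q` does not charge them.
  set H : ((Fin (i₀ + 1) × Fin (i₀ + 1)) × Fin (j₀ + 1) → ℝ) → ℝ := fun ν =>
    ∑ a, (∑ κ with κ.1.1 = a, ν κ) *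
        Real.log (∑ κ with κ.1.1 = a, ν κ) - ∑ κ, ν κ * Real.log (ν κ) +
        ∑ κ, ν κ * (Real.log (m.real (f ⁻¹' {κ.1.2})) + Real.log (b.real (g ⁻¹' {κ.2}))) with hH
  have hHc : Continuous H := by
    have h1 (a) : Continuous fun ν : (Fin (i₀ + 1) × Fin (i₀ + 1)) × Fin (j₀ + 1) → ℝ =>
        (∑ κ with κ.1.1 = a, ν κ) * Real.log (∑ κ with κ.1.1 = a, ν κ) :=
      Real.continuous_mul_log.comp (by fun_prop)
    have h2 (κ) : Continuous fun ν : (Fin (i₀ + 1) × Fin (i₀ + 1)) × Fin (j₀ + 1) → ℝ =>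
        ν κ * Real.log (ν κ) := Real.continuous_mul_log.comp (by fun_prop)
    exact ((continuous_finsetSum _ fun a _ => h1 a).sub (continuous_finsetSum _ fun κ _ => h2 κ)).add
      (by fun_prop)
  have hHq : -s < H q := by
    have h1 : ∑ κ, Q.real {κ} * Real.log (Q.real {κ} / (ν₀.map (cellMap f g)).real {κ}) = -H q := by
      have h2 : ∑ a, (∑ κ with κ.1.1 = a, q κ) * Real.log (∑ κ with κ.1.1 = a, q κ)
          = ∑ κ, q κ * Real.log (∑ κ' with κ'.1.1 = κ.1.1, q κ') := by
        rw [← Finset.sum_fiberwise Finset.univ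
          (fun κ : (Fin (i₀ + 1) × Fin (i₀ + 1)) × Fin (j₀ + 1) => κ.1.1)
          (fun κ => q κ * Real.log (∑ κ' with κ'.1.1 = κ.1.1, q κ'))]
        refine Finset.sum_congr rfl fun a _ => ?_
        rw [Finset.sum_mul]
        refine Finset.sum_congr rfl fun κ hκ => ?_
        rw [(Finset.mem_filter.1 hκ).2]
      rw [hH]
      simp only
      rw [h2, ← Finset.sum_sub_distrib, ← Finset.sum_add_distrib, ← Finset.sum_neg_distrib]
      refine Finset.sum_congr rfl fun κ _ => ?_
      change q κ * Real.log (q κ / _) = _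
      rcases (hq0 κ).eq_or_lt with h | h
      · simp [← h]
      · obtain ⟨c1, c2, c3⟩ := hqpos h
        rw [hν, Real.log_div h.ne' (by positivity), Real.log_mul (by positivity) c3.ne',
          Real.log_mul c1.ne' c2.ne']
        ring
    rw [h1] at hs'
    linarith
  have hwords (n : ℕ) := exists_word hq0 hq1 (fun a => (hp1 a).trans (hp2 a).symm) (n + 1)
  choose w τ hτ hcount hsupp using hwords
  let ν (n : ℕ) (κ : (Fin (i₀ + 1) × Fin (i₀ + 1)) × Fin (j₀ + 1)) : ℝ :=
    Fintype.card {i // w n i = κ} / (n + 1 : ℕ)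
  have hNlim : Tendsto (fun n : ℕ => ((n + 1 : ℕ) : ℝ)) atTop atTop :=
    tendsto_natCast_atTop_atTop.comp (tendsto_add_atTop_nat 1)
  have hνlim : Tendsto ν atTop (𝓝 q) := by
    rw [tendsto_pi_nhds]
    intro κ
    rw [tendsto_iff_norm_sub_tendsto_zero]
    refine squeeze_zero (fun _ => norm_nonneg _) (fun n => ?_) ((tendsto_const_nhds (x :=
      (Fintype.card ((Fin (i₀ + 1) × Fin (i₀ + 1)) × Fin (j₀ + 1)) : ℝ) + 1)).div_atTop hNlim)
    have hN : (0 : ℝ) < (n + 1 : ℕ) := by positivity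
    rw [le_div_iff₀ hN, Real.norm_eq_abs, ← abs_of_pos hN, ← abs_mul]
    have e : (ν n κ - q κ) * (n + 1 : ℕ) = Fintype.card {i // w n i = κ} - (n + 1 : ℕ) * q κ := by
      simp only [ν]
      field_simp
    rw [e]
    exact hcount n κ
  have hlog : Tendsto (fun n : ℕ => (Fintype.card
      ((Fin (i₀ + 1) × Fin (i₀ + 1)) × Fin (j₀ + 1)) : ℝ) * ((1 + Real.log (n + 1 : ℕ)) /
        (n + 1 : ℕ))) atTop (𝓝 ((Fintype.card
      ((Fin (i₀ + 1) × Fin (i₀ + 1)) × Fin (j₀ + 1)) : ℝ) * 0)) := by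
    refine Tendsto.const_mul _ ?_
    have h1 := (Real.tendsto_pow_log_div_mul_add_atTop 1 0 1 one_ne_zero).comp hNlim
    have h2 := (tendsto_const_nhds (x := (1 : ℝ))).div_atTop hNlim
    have h3 := h2.add h1
    rw [add_zero] at h3
    refine h3.congr fun n => ?_
    simp only [Function.comp_apply, pow_one, one_mul, add_zero]
    rw [← add_div]
  have hev1 : ∀ᶠ n in atTop, -s < H (ν n) - (Fintype.card
      ((Fin (i₀ + 1) × Fin (i₀ + 1)) × Fin (j₀ + 1)) : ℝ) * ((1 + Real.log (n + 1 : ℕ)) /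
        (n + 1 : ℕ)) := by
    have h1 := ((hHc.tendsto q).comp hνlim).sub hlog
    rw [mul_zero, sub_zero] at h1
    exact h1.eventually (lt_mem_nhds hHq)
  -- There are only finitely many sets of cells, so convergence of frequencies is uniform over them.
  have hev2 : ∀ᶠ n in atTop, ∀ T : Set ((Fin (i₀ + 1) × Fin (i₀ + 1)) × Fin (j₀ + 1)),
      ∑ κ ∈ (Set.toFinite T).toFinset, q κ ≤ ∑ κ ∈ (Set.toFinite T).toFinset, ν n κ + η := by
    rw [eventually_all]
    intro T
    have h1 : Tendsto (fun n => ∑ κ ∈ (Set.toFinite T).toFinset, ν n κ + η) atTop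
        (𝓝 (∑ κ ∈ (Set.toFinite T).toFinset, q κ + η)) :=
      (tendsto_finsetSum _ fun κ _ => tendsto_pi_nhds.1 hνlim κ).add_const η
    exact (h1.eventually (lt_mem_nhds (lt_add_of_pos_right _ hη))).mono fun n hn => hn.le
  filter_upwards [hev1, hev2] with n hn1 hn2
  have hN : (0 : ℝ) < (n + 1 : ℕ) := by positivity
  have hlow := exp_le_pairSampleMeasure_arrangements (m := m) (b := b) hf hg n.succ_pos (w n) (τ n)
    (hτ n) (fun i => by
      obtain ⟨⟨κ, hκ, e⟩, ⟨κ', hκ', e'⟩⟩ := hsupp n i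
      rw [← e, ← e']
      exact ⟨(hqpos hκ).2.1, (hqpos hκ').2.2⟩) (ν n) fun κ => rfl
  refine le_trans ?_ (hlow.trans (measure_mono ?_))
  · refine ENNReal.ofReal_le_ofReal (Real.exp_le_exp.2 ?_)
    have h1 := mul_lt_mul_of_pos_left hn1 hN
    rw [mul_sub, mul_left_comm _ _ ((1 + Real.log (n + 1 : ℕ)) / (n + 1 : ℕ)),
      mul_div_cancel₀ _ hN.ne'] at h1
    have e : ((n + 1 : ℕ) : ℝ) = (n : ℝ) + 1 := by push_cast; ring
    have h2 : -s * ((n : ℝ) + 1) = ((n + 1 : ℕ) : ℝ) * -s := by rw [e]; ring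
    rw [h2]
    exact h1.le
  -- Rearranging a word does not change its cell frequencies.
  · rintro W ⟨π, hπ⟩
    refine hcells _ fun T => ?_
    have e1 : (R : Measure ((X × X) × Y)) (cellMap f g ⁻¹' T)
        = ENNReal.ofReal (∑ κ ∈ (Set.toFinite T).toFinset, q κ) := by
      rw [sum_measureReal_singleton, Set.Finite.coe_toFinset, ofReal_measureReal, hQ,
        Measure.map_apply hcell (Set.toFinite T).measurableSet]
    have e2 : (empiricalMeasure (n + 1) W : Measure ((X × X) × Y)) (cellMap f g ⁻¹' T)
        = ENNReal.ofReal (∑ κ ∈ (Set.toFinite T).toFinset, ν n κ) := by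
      classical
      have h1 : (empiricalMeasure (n + 1) W : Measure ((X × X) × Y)) (cellMap f g ⁻¹' T)
          = ((n + 1 : ℕ) : ℝ≥0∞)⁻¹ * ∑ i, T.indicator (fun _ => (1 : ℝ≥0∞)) (w n i) := by
        rw [empiricalMeasure_apply _ _ (hcell (Set.toFinite T).measurableSet),
          ← Equiv.sum_comp π fun i => T.indicator (fun _ => (1 : ℝ≥0∞)) (w n i)]
        congr 1
        refine Finset.sum_congr rfl fun i _ => ?_
        have := congrFun hπ i
        simp only [Function.comp_apply] at this
        rw [this]
        rfl
      have h2 : ∑ i, T.indicator (fun _ => (1 : ℝ≥0∞)) (w n i)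
          = ENNReal.ofReal (∑ i, T.indicator (fun _ => (1 : ℝ)) (w n i)) := by
        rw [ENNReal.ofReal_sum_of_nonneg fun i _ => indicator_nonneg (fun _ _ => zero_le_one) _]
        refine Finset.sum_congr rfl fun i _ => ?_
        by_cases h : w n i ∈ T <;> simp [h]
      rw [h1, h2, sum_comp_eq_sum_card_fiber (w n) (T.indicator (fun _ => (1 : ℝ))),
        ← ENNReal.ofReal_natCast, ← ENNReal.ofReal_inv_of_pos hN,
        ← ENNReal.ofReal_mul (by positivity)]
      congr 1
      rw [Finset.mul_sum, ← Finset.sum_subset (Finset.subset_univ (Set.toFinite T).toFinset)]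
      · refine Finset.sum_congr rfl fun κ hκ => ?_
        rw [indicator_of_mem ((Set.Finite.mem_toFinset _).1 hκ)]
        simp only [ν]
        field_simp
      · intro κ _ hκ
        rw [indicator_of_notMem fun h => hκ ((Set.Finite.mem_toFinset _).2 h)]
        simp
    rw [e1, e2, ← ENNReal.ofReal_add (Finset.sum_nonneg fun κ _ => by positivity) hη.le]
    exact ENNReal.ofReal_le_ofReal (hn2 T)

/-! ### Splitting paths into endpoints and deviation; the rate function. -/

/-- The chain rule for `R` disintegrated over its first coordinate, with a product regarded as a
composition with a constant kernel. -/
theorem klDiv_prod_eq_add {Z Y : Type*} [MeasurableSpace Z] [MeasurableSpace Y]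
    [StandardBorelSpace Y] [Nonempty Y] (R : Measure (Z × Y)) [IsProbabilityMeasure R]
    (ν : Measure Z) [IsProbabilityMeasure ν] (b : Measure Y) [IsProbabilityMeasure b] :
    klDiv R (ν.prod b) = klDiv R.fst ν + klDiv R (R.fst.prod b) := by
  have h := klDiv_compProd_eq_add (μ := R.fst) (ν := ν) (κ := R.condKernel)
    (η := Kernel.const Z b)
  rwa [Measure.disintegrate, Measure.compProd_const, Measure.compProd_const] at h

section Decomposition

variable {d : ℕ} {β : ℝ}

/-- The law of the Brownian bridge from `0` to `0`. -/
noncomputable def centredBridge (β : ℝ) (d : ℕ) : Measure (PathSpace β d) :=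
  (iidGaussian d).map (centredBridgePath β d)

instance instIsProbabilityMeasureCentredBridge (β : ℝ) (d : ℕ) :
    IsProbabilityMeasure (centredBridge β d) :=
  Measure.isProbabilityMeasure_map (aemeasurable_centredBridgePath β d)

theorem brownianBridge_eq_map (x y : EuclideanSpace ℝ (Fin d)) :
    brownianBridge β x y = (centredBridge β d).map fun ω => linePath β x y + ω := by
  rw [centredBridge, AEMeasurable.map_map_of_aemeasurable (measurable_const_add _).aemeasurable
    (aemeasurable_centredBridgePath β d)]
  rfl

theorem continuous_linePath : Continuous fun p : EuclideanSpace ℝ (Fin d) ×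
    EuclideanSpace ℝ (Fin d) => linePath β p.1 p.2 := by
  refine ContinuousMap.continuous_of_continuous_uncurry _ ?_
  change Continuous fun r : (EuclideanSpace ℝ (Fin d) × EuclideanSpace ℝ (Fin d)) ×
    Icc (0 : ℝ) β => r.1.1 + (r.2 / β : ℝ) • (r.1.2 - r.1.1)
  fun_prop

/-- The path with given endpoints and given deviation from the straight line between them. -/
noncomputable def joinPath (β : ℝ) (d : ℕ)
    (r : (EuclideanSpace ℝ (Fin d) × EuclideanSpace ℝ (Fin d)) × PathSpace β d) : PathSpace β d :=
  linePath β r.1.1 r.1.2 + r.2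

theorem continuous_joinPath : Continuous (joinPath β d) := by
  unfold joinPath
  exact (continuous_linePath.comp continuous_fst).add continuous_snd

/-- The pair of endpoints of a path. -/
def endpoints (hβ : 0 < β) (ω : PathSpace β d) :
    EuclideanSpace ℝ (Fin d) × EuclideanSpace ℝ (Fin d) :=
  (ω ⟨0, left_mem_Icc.2 hβ.le⟩, ω ⟨β, right_mem_Icc.2 hβ.le⟩)

theorem continuous_endpoints (hβ : 0 < β) : Continuous (endpoints (d := d) hβ) :=
  (continuous_eval_const _).prodMk (continuous_eval_const _)

/-- The endpoints of a path together with its deviation from the straight line between them. -/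
noncomputable def splitPath (hβ : 0 < β) (ω : PathSpace β d) :
    (EuclideanSpace ℝ (Fin d) × EuclideanSpace ℝ (Fin d)) × PathSpace β d :=
  (endpoints hβ ω, ω - linePath β (endpoints hβ ω).1 (endpoints hβ ω).2)

theorem continuous_splitPath (hβ : 0 < β) : Continuous (splitPath (d := d) hβ) :=
  (continuous_endpoints hβ).prodMk
    (continuous_id.sub (continuous_linePath.comp (continuous_endpoints hβ)))

theorem joinPath_splitPath (hβ : 0 < β) (ω : PathSpace β d) :
    joinPath β d (splitPath hβ ω) = ω := add_sub_cancel _ _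

theorem endpoints_joinPath (hβ : 0 < β)
    {r : (EuclideanSpace ℝ (Fin d) × EuclideanSpace ℝ (Fin d)) × PathSpace β d}
    (hr : endpoints hβ r.2 = 0) : endpoints hβ (joinPath β d r) = r.1 := by
  have h1 := congrArg Prod.fst hr
  have h2 := congrArg Prod.snd hr
  simp only [endpoints, Prod.fst_zero, Prod.snd_zero] at h1 h2
  refine Prod.ext ?_ ?_
  · simp [endpoints, joinPath, linePath, h1]
  · simp [endpoints, joinPath, linePath, h2, hβ.ne']

theorem splitPath_joinPath (hβ : 0 < β)
    {r : (EuclideanSpace ℝ (Fin d) × EuclideanSpace ℝ (Fin d)) × PathSpace β d}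
    (hr : endpoints hβ r.2 = 0) : splitPath hβ (joinPath β d r) = r := by
  rw [splitPath, endpoints_joinPath hβ hr]
  exact Prod.ext rfl (add_sub_cancel_left _ _)

/-- The Schauder tents vanish at both ends. This holds for every `Z`, as a divergent series has sum
zero by convention. -/
theorem endpoints_centredBridgePath (hβ : 0 < β) (Z : ℕ × ℕ → EuclideanSpace ℝ (Fin d)) :
    endpoints hβ (centredBridgePath β d Z) = 0 := by
  have key (t : Icc (0 : ℝ) β) (h : ∀ n, levyTerm β d n Z t = 0) :
      centredBridgePath β d Z t = 0 := by
    rw [centredBridgePath, ContinuousMap.smul_apply]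
    by_cases hs : Summable fun n => levyTerm β d n Z
    · rw [← ContinuousMap.tsum_apply hs t]
      simp [h]
    · rw [tsum_eq_zero_of_not_summable hs]
      simp
  refine Prod.ext (key _ fun n => ?_) (key _ fun n => ?_)
  · change ∑ k ∈ Finset.range (2 ^ n), schauderFunction n k (0 / β) • Z (n, k) = 0
    refine Finset.sum_eq_zero fun k _ => ?_
    rw [schauderFunction_of_le (by simp), zero_smul]
  · change ∑ k ∈ Finset.range (2 ^ n), schauderFunction n k (β / β) • Z (n, k) = 0
    refine Finset.sum_eq_zero fun k hk => ?_
    rw [schauderFunction_of_ge (Finset.mem_range.1 hk) (by simp [hβ.ne']), zero_smul]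

theorem ae_endpoints_eq_zero (hβ : 0 < β) :
    ∀ᵐ ω ∂(centredBridge β d), endpoints hβ ω = 0 := by
  rw [centredBridge, ae_map_iff (aemeasurable_centredBridgePath β d)]
  · exact ae_of_all _ fun Z => endpoints_centredBridgePath hβ Z
  · exact (isClosed_eq (continuous_endpoints hβ) continuous_const).measurableSet

theorem integral_exp_brownianBridge (Φ : PathSpace β d →ᵇ ℝ)
    (p : EuclideanSpace ℝ (Fin d) × EuclideanSpace ℝ (Fin d)) :
    ∫ ω, Real.exp (Φ ω) ∂(brownianBridge β p.1 p.2)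
      = ∫ z, Real.exp (Φ (joinPath β d (p, z))) ∂(centredBridge β d) := by
  rw [brownianBridge_eq_map, integral_map (measurable_const_add _).aemeasurable
    (Continuous.aestronglyMeasurable (by fun_prop))]
  rfl

/-- Every bridge is the centred bridge shifted by a straight line, so the deviations are i.i.d.
labels independent of points and permutation. -/
theorem symmetrisedMeasure_eq_map (m : Measure (EuclideanSpace ℝ (Fin d))) [IsProbabilityMeasure m]
    (N : ℕ) : symmetrisedMeasure β m N
      = (pairSampleMeasure m (centredBridge β d) N).map fun w i => joinPath β d (w i) := by
  have hj : Measurable fun (w : Fin N → (EuclideanSpace ℝ (Fin d) × EuclideanSpace ℝ (Fin d)) ×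
      PathSpace β d) i => joinPath β d (w i) :=
    measurable_pi_lambda _ fun i => continuous_joinPath.measurable.comp (measurable_pi_apply i)
  ext S hS
  rw [Measure.map_apply hj hS, pairSampleMeasure_apply (hj hS), symmetrisedMeasure,
    Measure.smul_apply, Measure.finsetSum_apply, smul_eq_mul]
  congr 1
  refine Finset.sum_congr rfl fun σ _ => ?_
  rw [Measure.bind_apply hS (measurable_pi_brownianBridge β d N σ).aemeasurable,
    Measure.prod_apply (measurable_pairSample σ (hj hS))]
  refine lintegral_congr fun x => ?_
  simp_rw [brownianBridge_eq_map]
  rw [← Measure.pi_map_pi fun i => (measurable_const_add _).aemeasurable,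
    Measure.map_apply (by fun_prop) hS]
  rfl

instance instIsProbabilityMeasureSymmetrised (m : Measure (EuclideanSpace ℝ (Fin d)))
    [IsProbabilityMeasure m] (N : ℕ) : IsProbabilityMeasure (symmetrisedMeasure β m N) := by
  rw [symmetrisedMeasure_eq_map]
  exact Measure.isProbabilityMeasure_map (measurable_pi_lambda _ fun i =>
    continuous_joinPath.measurable.comp (measurable_pi_apply i)).aemeasurable

/-- Splitting undoes joining only when the deviation vanishes at both ends, which is almost sure
under the centred bridge. -/
theorem map_splitPath_symmetrisedMeasure (hβ : 0 < β) (m : Measure (EuclideanSpace ℝ (Fin d)))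
    [IsProbabilityMeasure m] (N : ℕ) :
    (symmetrisedMeasure β m N).map (fun ω i => splitPath hβ (ω i))
      = pairSampleMeasure m (centredBridge β d) N := by
  have hs : Measurable fun (ω : Fin N → PathSpace β d) i => splitPath hβ (ω i) :=
    measurable_pi_lambda _ fun i =>
      (continuous_splitPath hβ).measurable.comp (measurable_pi_apply i)
  have hj : Measurable fun (w : Fin N → (EuclideanSpace ℝ (Fin d) × EuclideanSpace ℝ (Fin d)) ×
      PathSpace β d) i => joinPath β d (w i) :=
    measurable_pi_lambda _ fun i => continuous_joinPath.measurable.comp (measurable_pi_apply i)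
  ext S hS
  rw [symmetrisedMeasure_eq_map, Measure.map_map hs hj, Measure.map_apply (hs.comp hj) hS,
    pairSampleMeasure_apply ((hs.comp hj) hS), pairSampleMeasure_apply hS]
  congr 1
  refine Finset.sum_congr rfl fun σ _ => measure_congr ?_
  have h0 : ∀ᵐ p ∂((Measure.pi fun _ : Fin N => m).prod
      (Measure.pi fun _ : Fin N => centredBridge β d)), ∀ i, endpoints hβ (p.2 i) = 0 := by
    rw [eventually_all]
    intro i
    exact Measure.quasiMeasurePreserving_snd.ae
      ((Measure.quasiMeasurePreserving_eval (μ := fun _ : Fin N => centredBridge β d) i).ae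
        (ae_endpoints_eq_zero hβ))
  filter_upwards [h0] with p hp
  have : (fun i => splitPath hβ (joinPath β d (pairSample σ p i))) = pairSample σ p :=
    funext fun i => splitPath_joinPath hβ (hp i)
  change S _ = S _
  simp only [Function.comp_apply]
  exact congrArg S this

theorem abs_log_integral_exp_le {b : Measure (PathSpace β d)} [IsProbabilityMeasure b]
    (F : (EuclideanSpace ℝ (Fin d) × EuclideanSpace ℝ (Fin d)) × PathSpace β d →ᵇ ℝ)
    (p : EuclideanSpace ℝ (Fin d) × EuclideanSpace ℝ (Fin d)) :
    |Real.log (∫ z, Real.exp (F (p, z)) ∂b)| ≤ ‖F‖ := by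
  have h := exp_neg_norm_le_integral_exp (b := b) F p
  have h0 := (Real.exp_pos _).trans_le h.1
  rw [abs_le]
  exact ⟨(Real.le_log_iff_exp_le h0).2 h.1, (Real.log_le_iff_le_exp h0).2 h.2⟩

/-- Entropy duality is tested with Φ ∘ join minus its logarithmic moment given the endpoints. The
exponential of this function has mean one under `b` for each pair of endpoints, so the correction
term drops out. -/
theorem bridgeRate_map_joinPath_le (ρ : Measure ((EuclideanSpace ℝ (Fin d) ×
    EuclideanSpace ℝ (Fin d)) × PathSpace β d)) [IsProbabilityMeasure ρ] :
    bridgeRate β ρ.fst (ρ.map (joinPath β d))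
      ≤ (klDiv ρ (ρ.fst.prod (centredBridge β d)) : EReal) := by
  by_cases hfin : klDiv ρ (ρ.fst.prod (centredBridge β d)) = ∞
  · rw [hfin]; exact le_top
  refine iSup_le fun Φ => ?_
  rw [← EReal.coe_ennreal_toReal hfin, EReal.coe_le_coe_iff]
  set b := centredBridge β d
  set F : (EuclideanSpace ℝ (Fin d) × EuclideanSpace ℝ (Fin d)) × PathSpace β d →ᵇ ℝ :=
    Φ.compContinuous ⟨joinPath β d, continuous_joinPath⟩ with hF
  set a : EuclideanSpace ℝ (Fin d) × EuclideanSpace ℝ (Fin d) → ℝ :=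
    fun p => ∫ z, Real.exp (F (p, z)) ∂b with ha
  have hac : Continuous a := continuous_integral_exp F
  have ha0 (p) : 0 < a p := (Real.exp_pos _).trans_le (exp_neg_norm_le_integral_exp F p).1
  have hlog (p) : |Real.log (a p)| ≤ ‖F‖ := abs_log_integral_exp_le F p
  have hlc : Continuous fun p => Real.log (a p) := hac.log fun p => (ha0 p).ne'
  have hlc' : Continuous fun r : (EuclideanSpace ℝ (Fin d) × EuclideanSpace ℝ (Fin d)) ×
    PathSpace β d => Real.log (a r.1) := hlc.comp continuous_fst
  have h := integral_le_toReal_klDiv_add hfin (Φ := fun r => F r - Real.log (a r.1))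
    (k := ‖F‖ + ‖F‖) (F.continuous.sub hlc').measurable fun r =>
      (abs_sub _ _).trans (add_le_add (F.norm_coe_le_norm r) (hlog _))
  have e1 : ∫ r, (F r - Real.log (a r.1)) ∂ρ
      = ∫ ω, Φ ω ∂(ρ.map (joinPath β d)) - ∫ p, Real.log (a p) ∂ρ.fst := by
    rw [integral_sub (F.integrable ρ) (Integrable.of_bound hlc'.aestronglyMeasurable ‖F‖
      (ae_of_all _ fun r => hlog _)), Measure.fst,
      integral_map continuous_joinPath.measurable.aemeasurable Φ.continuous.aestronglyMeasurable,
      integral_map measurable_fst.aemeasurable hlc.aestronglyMeasurable]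
    rfl
  have e2 : ∫ r, (Real.exp (F r - Real.log (a r.1)) - 1) ∂(ρ.fst.prod b) = 0 := by
    have hi : Integrable (fun r => Real.exp (F r - Real.log (a r.1))) (ρ.fst.prod b) := by
      refine Integrable.of_bound (Real.continuous_exp.comp
        (F.continuous.sub hlc')).aestronglyMeasurable (Real.exp (‖F‖ + ‖F‖))
        (ae_of_all _ fun r => ?_)
      rw [Real.norm_of_nonneg (Real.exp_nonneg _)]
      exact Real.exp_le_exp.2 ((le_abs_self _).trans
        ((abs_sub _ _).trans (add_le_add (F.norm_coe_le_norm r) (hlog _))))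
    rw [integral_sub hi (integrable_const _), integral_prod _ hi]
    simp only [Real.exp_sub, Real.exp_log (ha0 _), integral_div]
    have e (p) : (∫ z, Real.exp (F (p, z)) ∂b) / a p = 1 := div_self (ha0 p).ne'
    simp [e]
  rw [e1, e2, add_zero] at h
  simp_rw [integral_exp_brownianBridge]
  exact h

/-- Since log a ≤ a - 1, the functional defining the bridge rate dominates the dual entropy
functional for the `q`-mixture of bridges. -/
theorem klDiv_le_of_bridgeRate_le {q : Measure (EuclideanSpace ℝ (Fin d) ×
    EuclideanSpace ℝ (Fin d))} [IsProbabilityMeasure q] {μ : Measure (PathSpace β d)}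
    [IsProbabilityMeasure μ] {c : ℝ} (hc : bridgeRate β q μ ≤ c) :
    klDiv μ ((q.prod (centredBridge β d)).map (joinPath β d)) ≤ ENNReal.ofReal c := by
  set b := centredBridge β d
  have : IsProbabilityMeasure ((q.prod b).map (joinPath β d)) :=
    Measure.isProbabilityMeasure_map continuous_joinPath.measurable.aemeasurable
  refine klDiv_le_of_forall_boundedContinuous fun Φ => ?_
  have h := (le_iSup (fun Φ : PathSpace β d →ᵇ ℝ => ((∫ ω, Φ ω ∂μ
      - ∫ p, Real.log (∫ ω, Real.exp (Φ ω) ∂(brownianBridge β p.1 p.2)) ∂q : ℝ) : EReal)) Φ).trans hc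
  rw [EReal.coe_le_coe_iff] at h
  simp_rw [integral_exp_brownianBridge] at h
  set F : (EuclideanSpace ℝ (Fin d) × EuclideanSpace ℝ (Fin d)) × PathSpace β d →ᵇ ℝ :=
    Φ.compContinuous ⟨joinPath β d, continuous_joinPath⟩ with hF
  set a : EuclideanSpace ℝ (Fin d) × EuclideanSpace ℝ (Fin d) → ℝ :=
    fun p => ∫ z, Real.exp (F (p, z)) ∂b with ha
  have hac : Continuous a := continuous_integral_exp F
  have ha0 (p) : 0 < a p := (Real.exp_pos _).trans_le (exp_neg_norm_le_integral_exp F p).1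
  have hlog (p) : |Real.log (a p)| ≤ ‖F‖ := abs_log_integral_exp_le F p
  have hlc : Continuous fun p => Real.log (a p) := hac.log fun p => (ha0 p).ne'
  have i1 : Integrable (fun p => Real.log (a p)) q :=
    Integrable.of_bound hlc.aestronglyMeasurable ‖F‖ (ae_of_all _ hlog)
  have i2 : Integrable a q := (integrable_exp_comp (q.prod b) F).integral_prod_left
  have e : ∫ ω, (Real.exp (Φ ω) - 1) ∂((q.prod b).map (joinPath β d)) = ∫ p, (a p - 1) ∂q := by
    rw [integral_map continuous_joinPath.measurable.aemeasurable
      (Continuous.aestronglyMeasurable (by fun_prop))]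
    change ∫ r, (Real.exp (F r) - 1) ∂(q.prod b) = _
    rw [integral_sub (integrable_exp_comp (q.prod b) F) (integrable_const _),
      integral_sub i2 (integrable_const _), integral_prod _ (integrable_exp_comp (q.prod b) F)]
    simp [ha]
  have h2 : ∫ p, Real.log (a p) ∂q ≤ ∫ p, (a p - 1) ∂q :=
    integral_mono i1 (i2.sub (integrable_const _)) fun p => Real.log_le_sub_one_of_pos (ha0 p)
  have h3 : ∫ ω, Φ ω ∂μ - ∫ p, Real.log (a p) ∂q ≤ c := h
  linarith

/-- A function of the endpoints is deterministic under a bridge, so on multiples of it the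
functional is linear; a linear function bounded above on the whole line vanishes. -/
theorem map_endpoints_eq_of_bridgeRate_le (hβ : 0 < β) {q : Measure (EuclideanSpace ℝ (Fin d) ×
    EuclideanSpace ℝ (Fin d))} [IsProbabilityMeasure q] {μ : Measure (PathSpace β d)}
    [IsProbabilityMeasure μ] {c : ℝ} (hc : bridgeRate β q μ ≤ c) :
    μ.map (endpoints hβ) = q := by
  have : IsProbabilityMeasure (μ.map (endpoints hβ)) :=
    Measure.isProbabilityMeasure_map (continuous_endpoints hβ).measurable.aemeasurable
  refine ext_of_forall_integral_eq_of_IsFiniteMeasure fun f => ?_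
  rw [integral_map (continuous_endpoints hβ).measurable.aemeasurable
    f.continuous.aestronglyMeasurable]
  set D := ∫ ω, f (endpoints hβ ω) ∂μ - ∫ p, f p ∂q with hD
  have key (t : ℝ) : t * D ≤ c := by
    have h := (le_iSup (fun Φ : PathSpace β d →ᵇ ℝ => ((∫ ω, Φ ω ∂μ
      - ∫ p, Real.log (∫ ω, Real.exp (Φ ω) ∂(brownianBridge β p.1 p.2)) ∂q : ℝ) : EReal))
        ((t • f).compContinuous ⟨endpoints hβ, continuous_endpoints hβ⟩)).trans hc
    rw [EReal.coe_le_coe_iff] at h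
    have e (p : EuclideanSpace ℝ (Fin d) × EuclideanSpace ℝ (Fin d)) :
        Real.log (∫ ω, Real.exp (((t • f).compContinuous
          ⟨endpoints hβ, continuous_endpoints hβ⟩) ω) ∂(brownianBridge β p.1 p.2)) = t * f p := by
      rw [integral_exp_brownianBridge]
      have h1 : ∀ᵐ z ∂(centredBridge β d), Real.exp (((t • f).compContinuous
          ⟨endpoints hβ, continuous_endpoints hβ⟩) (joinPath β d (p, z))) = Real.exp (t * f p) := by
        filter_upwards [ae_endpoints_eq_zero hβ] with z hz
        simp [endpoints_joinPath hβ (r := (p, z)) hz]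
      rw [integral_congr_ae h1]
      simp
    simp only [e, integral_const_mul] at h
    have e3 : ∫ ω, ((t • f).compContinuous ⟨endpoints hβ, continuous_endpoints hβ⟩) ω ∂μ
        = t * ∫ ω, f (endpoints hβ ω) ∂μ := by
      rw [← integral_const_mul]
      rfl
    rw [e3, ← mul_sub] at h
    exact h
  by_contra hne
  have hD0 : D ≠ 0 := sub_ne_zero.2 hne
  have := key ((c + 1) / D)
  rw [div_mul_cancel₀ _ hD0] at this
  linarith

/-- The law of the endpoints and of the deviation from the straight line between them. -/
noncomputable def splitLaw (hβ : 0 < β) (μ : ProbabilityMeasure (PathSpace β d)) :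
    ProbabilityMeasure ((EuclideanSpace ℝ (Fin d) × EuclideanSpace ℝ (Fin d)) × PathSpace β d) :=
  μ.map (continuous_splitPath hβ).measurable.aemeasurable

theorem coe_splitLaw (hβ : 0 < β) (μ : ProbabilityMeasure (PathSpace β d)) :
    (splitLaw hβ μ : Measure _) = (μ : Measure (PathSpace β d)).map (splitPath hβ) := rfl

theorem continuous_splitLaw (hβ : 0 < β) : Continuous (splitLaw (d := d) hβ) :=
  ProbabilityMeasure.continuous_map (continuous_splitPath hβ)

/-- The law of the path with given endpoints and deviation from the straight line. -/
noncomputable def joinLaw (R : ProbabilityMeasure ((EuclideanSpace ℝ (Fin d) ×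
    EuclideanSpace ℝ (Fin d)) × PathSpace β d)) : ProbabilityMeasure (PathSpace β d) :=
  R.map continuous_joinPath.measurable.aemeasurable

theorem continuous_joinLaw : Continuous (joinLaw (d := d) (β := β)) :=
  ProbabilityMeasure.continuous_map continuous_joinPath

theorem map_joinPath_splitLaw (hβ : 0 < β) (μ : ProbabilityMeasure (PathSpace β d)) :
    (splitLaw hβ μ : Measure _).map (joinPath β d) = (μ : Measure (PathSpace β d)) := by
  rw [coe_splitLaw, Measure.map_map continuous_joinPath.measurable
    (continuous_splitPath hβ).measurable]
  have : joinPath β d ∘ splitPath hβ = id := funext (joinPath_splitPath hβ)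
  rw [this, Measure.map_id]

theorem joinLaw_splitLaw (hβ : 0 < β) (μ : ProbabilityMeasure (PathSpace β d)) :
    joinLaw (splitLaw hβ μ) = μ := Subtype.ext (map_joinPath_splitLaw hβ μ)

theorem fst_splitLaw (hβ : 0 < β) (μ : ProbabilityMeasure (PathSpace β d)) :
    (splitLaw hβ μ : Measure ((EuclideanSpace ℝ (Fin d) × EuclideanSpace ℝ (Fin d)) ×
      PathSpace β d)).fst = (μ : Measure (PathSpace β d)).map (endpoints hβ) := by
  rw [coe_splitLaw, Measure.fst, Measure.map_map measurable_fst
    (continuous_splitPath hβ).measurable]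
  rfl

theorem splitLaw_empiricalMeasure (hβ : 0 < β) (N : ℕ) [NeZero N] (ω : Fin N → PathSpace β d) :
    splitLaw hβ (empiricalMeasure N ω) = empiricalMeasure N fun i => splitPath hβ (ω i) :=
  Subtype.ext (map_empiricalMeasure N ω (continuous_splitPath hβ).measurable)

theorem joinLaw_empiricalMeasure (N : ℕ) [NeZero N] (w : Fin N → (EuclideanSpace ℝ (Fin d) ×
    EuclideanSpace ℝ (Fin d)) × PathSpace β d) :
    joinLaw (empiricalMeasure N w) = empiricalMeasure N fun i => joinPath β d (w i) :=
  Subtype.ext (map_empiricalMeasure N w continuous_joinPath.measurable)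

theorem bridgeRate_nonneg (q : Measure (EuclideanSpace ℝ (Fin d) × EuclideanSpace ℝ (Fin d)))
    (μ : Measure (PathSpace β d)) : 0 ≤ bridgeRate β q μ := by
  refine le_trans (le_of_eq ?_) (le_iSup _ (0 : PathSpace β d →ᵇ ℝ))
  simp

/-- The rate function is the relative entropy of the law of endpoints and deviation with respect to
the product of the marginal law, `m` and the centred bridge. -/
theorem symmetrisedRate_eq (hβ : 0 < β) (m : Measure (EuclideanSpace ℝ (Fin d)))
    [IsProbabilityMeasure m] (μ : ProbabilityMeasure (PathSpace β d)) :
    symmetrisedRate β m μ = pairRate m (centredBridge β d) (splitLaw hβ μ) := by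
  refine le_antisymm ?_ (le_iInf₂ fun q hq => ?_)
  · unfold pairRate
    split_ifs with h
    swap
    · exact le_top
    set R := (splitLaw hβ μ : Measure ((EuclideanSpace ℝ (Fin d) × EuclideanSpace ℝ (Fin d)) ×
      PathSpace β d)) with hR
    -- The competitor is the law of the endpoints.
    refine (iInf₂_le (⟨R.fst, inferInstance⟩ : ProbabilityMeasure _) h).trans ?_
    change (klDiv R.fst (R.fst.fst.prod m) : EReal) + bridgeRate β R.fst _ ≤ _
    rw [klDiv_prod_eq_add R (R.fst.fst.prod m), EReal.coe_ennreal_add]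
    refine add_le_add le_rfl ?_
    have h1 := bridgeRate_map_joinPath_le R
    rwa [map_joinPath_splitLaw] at h1
  · rcases eq_or_ne (bridgeRate β (q : Measure _) (μ : Measure (PathSpace β d))) ⊤ with htop | htop
    · rw [htop, EReal.add_top_of_ne_bot (by simp)]
      exact le_top
    set c := (bridgeRate β (q : Measure _) (μ : Measure (PathSpace β d))).toReal
    have hc : bridgeRate β (q : Measure _) (μ : Measure (PathSpace β d)) = c :=
      (EReal.coe_toReal htop (ne_bot_of_le_ne_bot (by simp) (bridgeRate_nonneg _ _))).symm
    have hc0 : 0 ≤ c := EReal.toReal_nonneg (bridgeRate_nonneg _ _)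
    -- A finite bridge rate leaves no choice for `q`, so the infimum is effectively over one
    -- measure.
    have hfst : (splitLaw hβ μ : Measure ((EuclideanSpace ℝ (Fin d) × EuclideanSpace ℝ (Fin d)) ×
        PathSpace β d)).fst = (q : Measure (EuclideanSpace ℝ (Fin d) × EuclideanSpace ℝ (Fin d))) := by
      rw [fst_splitLaw, map_endpoints_eq_of_bridgeRate_le hβ hc.le]
    have hq' : (q : Measure (EuclideanSpace ℝ (Fin d) × EuclideanSpace ℝ (Fin d))).fst
      = (q : Measure (EuclideanSpace ℝ (Fin d) × EuclideanSpace ℝ (Fin d))).snd := hq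
    have hpair : ((q : Measure (EuclideanSpace ℝ (Fin d) × EuclideanSpace ℝ (Fin d))).prod
        (centredBridge β d)).map (splitPath hβ ∘ joinPath β d)
        = (q : Measure (EuclideanSpace ℝ (Fin d) × EuclideanSpace ℝ (Fin d))).prod
        (centredBridge β d) := by
      conv_rhs => rw [← Measure.map_id (μ := (q : Measure (EuclideanSpace ℝ (Fin d) ×
        EuclideanSpace ℝ (Fin d))).prod (centredBridge β d))]
      refine Measure.map_congr ?_
      filter_upwards [Measure.quasiMeasurePreserving_snd.ae (ae_endpoints_eq_zero hβ)] with r hr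
      exact splitPath_joinPath hβ hr
    have hkl : klDiv (splitLaw hβ μ : Measure _) ((q : Measure (EuclideanSpace ℝ (Fin d) ×
        EuclideanSpace ℝ (Fin d))).prod (centredBridge β d)) ≤ ENNReal.ofReal c := by
      have : IsProbabilityMeasure (((q : Measure (EuclideanSpace ℝ (Fin d) ×
          EuclideanSpace ℝ (Fin d))).prod (centredBridge β d)).map (joinPath β d)) :=
        Measure.isProbabilityMeasure_map continuous_joinPath.measurable.aemeasurable
      -- Data processing along the splitting map moves the entropy bound from paths to endpoints and
      -- deviations.
      have h1 := klDiv_map_le (μ : Measure (PathSpace β d)) (((q : Measure (EuclideanSpace ℝ (Fin d) ×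
          EuclideanSpace ℝ (Fin d))).prod (centredBridge β d)).map (joinPath β d))
          (continuous_splitPath hβ).measurable
      rw [Measure.map_map (continuous_splitPath hβ).measurable continuous_joinPath.measurable,
        hpair] at h1
      exact h1.trans (klDiv_le_of_bridgeRate_le hc.le)
    unfold pairRate
    rw [if_pos (by rw [hfst]; exact hq'), klDiv_prod_eq_add, hfst, EReal.coe_ennreal_add, hc]
    refine add_le_add le_rfl ((EReal.coe_ennreal_le_coe_ennreal_iff.2 hkl).trans_eq ?_)
    rw [EReal.coe_ennreal_ofReal, max_eq_left hc0]

end Decomposition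

/-! ### Transfer of the pair principle to path measures. -/

theorem theorem1p1 (d : ℕ) (β : ℝ) (hβ : 0 < β)
    (m : ProbabilityMeasure (EuclideanSpace ℝ (Fin d)))
    (hm : IsCompact (m : Measure (EuclideanSpace ℝ (Fin d))).support) :
    SatisfiesLDP (Ω := fun n => Fin (n + 1) → PathSpace β d)
      (fun n => symmetrisedMeasure β m (n + 1))
      (fun n => empiricalMeasure (n + 1))
      (fun n => (n : ℝ) + 1)
      (symmetrisedRate β m) := by
  have hm0 : (m : Measure (EuclideanSpace ℝ (Fin d)))
      (m : Measure (EuclideanSpace ℝ (Fin d))).supportᶜ = 0 := Measure.measure_compl_support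
  have hsplit (n : ℕ) : AEMeasurable (fun (ω : Fin (n + 1) → PathSpace β d) i =>
      splitPath hβ (ω i)) (symmetrisedMeasure β m (n + 1)) :=
    (measurable_pi_lambda _ fun i =>
      (continuous_splitPath hβ).measurable.comp (measurable_pi_apply i)).aemeasurable
  have hjoin (n : ℕ) : AEMeasurable (fun (w : Fin (n + 1) → (EuclideanSpace ℝ (Fin d) ×
      EuclideanSpace ℝ (Fin d)) × PathSpace β d) i => joinPath β d (w i))
      (pairSampleMeasure m (centredBridge β d) (n + 1)) :=
    (measurable_pi_lambda _ fun i =>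
      continuous_joinPath.measurable.comp (measurable_pi_apply i)).aemeasurable
  refine satisfiesLDP_of_local _ _ _ (fun μ t ht => ?_) (fun L => ?_) (fun μ s hs U hU hμ => ?_)
  · rw [symmetrisedRate_eq hβ] at ht
    obtain ⟨V, hV, hμV, hdecay⟩ := pairRate_local_upper_bound hm hm0 (splitLaw hβ μ) ht
    refine ⟨splitLaw hβ ⁻¹' V, hV.preimage (continuous_splitLaw hβ), hμV,
      hdecay.mono_left fun n => ?_⟩
    rw [← map_splitPath_symmetrisedMeasure hβ]
    -- `Measure.le_map_apply` holds for arbitrary sets, so the events need not be shown measurable.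
    refine le_trans (measure_mono fun ω hω => ?_) (Measure.le_map_apply (hsplit n) _)
    change empiricalMeasure (n + 1) _ ∈ V
    rw [← splitLaw_empiricalMeasure]
    exact hω
  · obtain ⟨S, hS, hdecay⟩ := exists_isCompact_expDecay (m := (m : Measure _))
      (b := centredBridge β d) hm hm0 L
    -- Compactness passes through the continuous joining map, and an empirical measure outside the
    -- image splits to one outside `S`.
    refine ⟨joinLaw '' S, hS.image continuous_joinLaw, hdecay.mono_left fun n => ?_⟩
    rw [← map_splitPath_symmetrisedMeasure hβ]
    refine le_trans (measure_mono fun ω hω => ?_) (Measure.le_map_apply (hsplit n) _)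
    change empiricalMeasure (n + 1) _ ∉ S
    rw [← splitLaw_empiricalMeasure]
    exact fun h => hω ⟨_, h, joinLaw_splitLaw hβ _⟩
  · rw [symmetrisedRate_eq hβ] at hs
    filter_upwards [pairRate_local_lower_bound (splitLaw hβ μ) hs (hU.preimage continuous_joinLaw)
      (by rwa [mem_preimage, joinLaw_splitLaw])] with n hn
    rw [symmetrisedMeasure_eq_map]
    refine hn.trans (le_trans (measure_mono fun w hw => ?_) (Measure.le_map_apply (hjoin n) _))
    change empiricalMeasure (n + 1) _ ∈ U
    rw [← joinLaw_empiricalMeasure]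
    exact hw
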